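/- Let $\mathcal V$ be a set (possibly empty) of variables. \emph{Terms} are built from variables with a binary operation symbol $\cdot$. \emph{Formulae} are built from the atomic formulae $\top$ and $p\equiv q$ ($p,q$ terms) with a binary connective $\wedge$. The category $\dot S_\equiv$ has formulae as objects. Its arrows are equivalence classes of arrow terms. The primitive arrow terms are, for all formulae $A,B,C$ and all terms $x,y,z,w$, $$\mathbf 1_A:A\vdash A,\quad b^{\rightarrow}_{A,B,C}:A\wedge(B\wedge C)\vdash(A\wedge B)\wedge C,\quad b^{\leftarrow}_{A,B,C}:(A\wedge B)\wedge C\vdash A\wedge(B\wedge C),$$ $$\delta^{\rightarrow}_A:A\wedge\top\vdash A,\quad \delta^{\leftarrow}_A:A\vdash A\wedge\top,\quad \sigma^{\rightarrow}_A:\top\wedge A\vdash A,\quad \sigma^{\leftarrow}_A:A\vdash\top\wedge A,\quad c_{A,B}:A\wedge B\vdash B\wedge A,$$ $$r_x:\top\vdash x\equiv x,\quad t_{x,y,z}:x\equiv y\wedge y\equiv z\vdash x\equiv z,\quad s_{x,y}:x\equiv y\vdash y\equiv x,\quad a_{x,y,z,w}:x\equiv y\wedge z\equiv w\vdash x\cdot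 z\equiv y\cdot w,$$ and arrow terms are closed under $f\wedge g:A\wedge C\vdash B\wedge D$ (for $f:A\vdash B$, $g:C\vdash D$) and under composition $g\circ f$. Equality of arrow terms is the smallest equivalence relation that is a congruence for $\wedge$ and $\circ$ and satisfies the equations of categories, bifunctoriality of $\wedge$, the equations of symmetric monoidal categories (naturality of $b^{\rightarrow},\delta^{\rightarrow},\sigma^{\rightarrow},c$; $b^{\leftarrow},\delta^{\leftarrow},\sigma^{\leftarrow}$ are inverse to $b^{\rightarrow},\delta^{\rightarrow},\sigma^{\rightarrow}$; $c_{B,A}\circ c_{A,B}=\mathbf 1$; the pentagon, the triangle $b^{\rightarrow}_{A,\top,C}=(\delta^{\leftarrow}_A\wedge\mathbf 1_C)\circ(\mathbf 1_A\wedge\sigma^{\rightarrow}_C)$ and the hexagon), and, for all terms, $$t_{x,y,y}\circ(\mathbf 1_{x\equiv y}\wedge r_y)=\delta^{\rightarrow}_{x\equiv y},\qquad t_{y,y,x}\circ(r_y\wedge\mathbf 1_{y\equiv x})=\sigma^{\rightarrow}_{y\equiv x},$$ $$t_{x,y,u}\circ(\mathbf 1_{x\equiv y}\wedge t_{y,z,u})=t_{x,z,u}\circ(t_{x,y,z}\wedge\mathbf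 1_{z\equiv u})\circ b^{\rightarrow}_{x\equiv y,y\equiv z,z\equiv u},$$ $$s_{y,x}\circ s_{x,y}=\mathbf 1_{x\equiv y},\qquad s_{x,x}\circ r_x=r_x,\qquad s_{x,z}\circ t_{x,y,z}=t_{z,y,x}\circ(s_{y,z}\wedge s_{x,y})\circ c_{x\equiv y,y\equiv z},$$ $$a_{x,x,y,y}\circ(r_x\wedge r_y)\circ\delta^{\leftarrow}_\top=r_{x\cdot y},$$ $$a_{x_1,z_1,x_2,z_2}\circ(t_{x_1,y_1,z_1}\wedge t_{x_2,y_2,z_2})=t_{x_1\cdot x_2,\,y_1\cdot y_2,\,z_1\cdot z_2}\circ(a_{x_1,y_1,x_2,y_2}\wedge a_{y_1,z_1,y_2,z_2})\circ c^m_{x_1\equiv y_1,\,y_1\equiv z_1,\,x_2\equiv y_2,\,y_2\equiv z_2},$$ $$s_{x_1\cdot x_2,\,y_1\cdot y_2}\circ a_{x_1,y_1,x_2,y_2}=a_{y_1,x_1,y_2,x_2}\circ(s_{x_1,y_1}\wedge s_{x_2,y_2}),$$ where $c^m_{A,B,C,D}:(A\wedge B)\wedge(C\wedge D)\vdash(A\wedge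 C)\wedge(B\wedge D)$ is $$c^m_{A,B,C,D}=b^{\rightarrow}_{A,C,B\wedge D}\circ(\mathbf 1_A\wedge(b^{\leftarrow}_{C,B,D}\circ(c_{B,C}\wedge\mathbf 1_D)\circ b^{\rightarrow}_{B,C,D}))\circ b^{\leftarrow}_{A,B,C\wedge D}.$$ The category $\mathrm{Br}$ has finite ordinals as objects. An arrow $n\to m$ is an equivalence relation on the disjoint union $n+m$ all of whose classes have exactly two elements. The composite of $R:n\to m$ and $P:m\to k$ is the equivalence relation generated by $R\cup P$ on $n+m+k$, restricted to $n+k$. The functor $G:\dot S_\equiv\to\mathrm{Br}$ sends a formula to the number of occurrences of variables in it, and an arrow to the diagram in which occurrences of variables in source and target are joined as follows. For $\mathbf 1,b^{\rightarrow},b^{\leftarrow},\delta^{\rightarrow},\delta^{\leftarrow},\sigma^{\rightarrow},\sigma^{\leftarrow}$ the $i$-th occurrence in the source is joined with the $i$-th in the target. For $c_{A,B}$ and $s_{x,y}$ the two blocks of occurrences cross, and for $a_{x,y,z,w}$ the blocks of $y$ and $z$ cross. For $r_x$ the $i$-th occurrence in the left copy of $x$ is joined with the $i$-th in the right copy. For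 $t_{x,y,z}$ the two copies of $y$ in the source are joined with each other in the same way, and $x$ and $z$ in the source are joined with $x$ and $z$ in the target. The operation $\wedge$ is juxtaposition of diagrams, and $\circ$ is composition in $\mathrm{Br}$. \textbf{Theorem (coherence of $\dot S_\equiv$).} The functor $G$ from $\dot S_\equiv$ to $\mathrm{Br}$ is faithful: if $f,g:A\vdash B$ are arrow terms with $Gf=Gg$, then $f=g$ in $\dot S_\equiv$. -/

import Mathlib

open CategoryTheory

namespace LinearEquality

/-! ## Brauerian split equivalences -/

/-- A Brauerian split equivalence between a source set `α` and a target set `β`: an equivalence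
relation on the disjoint union of `α` and `β` all of whose classes have exactly two elements. -/
@[ext]
structure Brauerian (α β : Type) where
  rel : Setoid (α ⊕ β)
  existsUnique_partner : ∀ x, ∃! y, y ≠ x ∧ rel x y

namespace Brauerian

variable {α β γ δ α' β' γ' : Type}

theorem eq_of_rel (R : Brauerian α β) {x y z : α ⊕ β} (hy : R.rel x y) (hz : R.rel x z)
    (hyx : y ≠ x) (hzx : z ≠ x) : y = z :=
  (R.existsUnique_partner x).unique ⟨hyx, hy⟩ ⟨hzx, hz⟩

/-- Inclusion between Brauerian split equivalences is equality. -/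
theorem eq_of_le {R S : Brauerian α β} (h : ∀ x y, R.rel x y → S.rel x y) : R = S := by
  ext x y
  refine ⟨h x y, fun hxy => ?_⟩
  by_cases e : y = x
  · subst e; exact R.rel.refl' _
  · obtain ⟨z, ⟨hzx, hz⟩, -⟩ := R.existsUnique_partner x
    rw [S.eq_of_rel hxy (h _ _ hz) e hzx]; exact hz

/-- The Brauerian split equivalence in which `x` is joined with `f x`, where `f` is an involution
without fixed points. -/
def ofInvolution (f : α ⊕ β → α ⊕ β) (hf : ∀ x, f (f x) = x) (hne : ∀ x, f x ≠ x) :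
    Brauerian α β where
  rel :=
    { r := fun x y => y = x ∨ y = f x
      iseqv :=
        { refl := fun _ => Or.inl rfl
          symm := by
            rintro x y (rfl | rfl)
            · exact Or.inl rfl
            · exact Or.inr (hf x).symm
          trans := by
            rintro x y z (rfl | rfl) (rfl | rfl)
            · exact Or.inl rfl
            · exact Or.inr rfl
            · exact Or.inr rfl
            · exact Or.inl (hf x) } }
  existsUnique_partner := fun x =>
    ⟨f x, ⟨hne x, Or.inr rfl⟩, fun _ hy => hy.2.resolve_left hy.1⟩

theorem ofInvolution_eq {f : α ⊕ β → α ⊕ β} {hf : ∀ x, f (f x) = x} {hne : ∀ x, f x ≠ x}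
    {S : Brauerian α β} (h : ∀ x, S.rel x (f x)) : ofInvolution f hf hne = S := by
  apply eq_of_le
  rintro x y (rfl | rfl)
  · exact S.rel.refl' _
  · exact h x

theorem ofInvolution_rel {f : α ⊕ β → α ⊕ β} {hf : ∀ x, f (f x) = x} {hne : ∀ x, f x ≠ x}
    (x : α ⊕ β) : (ofInvolution f hf hne).rel x (f x) := Or.inr rfl

/-- The lines of a bijection: each `a` in the source is joined with `e a` in the target. -/
def ofEquiv (e : α ≃ β) : Brauerian α β :=
  ofInvolution (Sum.elim (fun a => Sum.inr (e a)) (fun b => Sum.inl (e.symm b)))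
    (by rintro (a | b) <;> simp) (by rintro (a | b) <;> simp)

/-- Caps joining the `i`-th point of the left copy of `α` in the target with the `i`-th point of
the right copy; the source is empty. -/
def caps (α : Type) : Brauerian Empty (α ⊕ α) :=
  ofInvolution (Sum.elim Empty.elim (fun i => Sum.inr i.swap))
    (by rintro (a | a | a) <;> [exact a.elim; rfl; rfl])
    (by rintro (a | a | a) <;> [exact a.elim; simp; simp])

/-- Cups joining the two copies of `β` in the source `(α ⊕ β) ⊕ (β ⊕ γ)`, with straight lines
from `α` and `γ` in the source to `α` and `γ` in the target. -/
def cups (α β γ : Type) : Brauerian ((α ⊕ β) ⊕ (β ⊕ γ)) (α ⊕ γ) :=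
  ofInvolution
    (fun x => match x with
      | .inl (.inl (.inl a)) => .inr (.inl a)
      | .inl (.inl (.inr b)) => .inl (.inr (.inl b))
      | .inl (.inr (.inl b)) => .inl (.inl (.inr b))
      | .inl (.inr (.inr c)) => .inr (.inr c)
      | .inr (.inl a) => .inl (.inl (.inl a))
      | .inr (.inr c) => .inl (.inr (.inr c)))
    (by rintro (((a | b) | (b | c)) | (a | c)) <;> rfl)
    (by rintro (((a | b) | (b | c)) | (a | c)) <;> simp)

/-- Renaming of the source and of the target. -/
def reindex (e : α ≃ α') (e' : β ≃ β') (R : Brauerian α β) : Brauerian α' β' where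
  rel := R.rel.comap (Equiv.sumCongr e e').symm
  existsUnique_partner := fun x => by
    obtain ⟨y, ⟨hne, hy⟩, hu⟩ := R.existsUnique_partner ((Equiv.sumCongr e e').symm x)
    refine ⟨Equiv.sumCongr e e' y, ⟨?_, ?_⟩, ?_⟩
    · rintro rfl
      exact hne (Equiv.symm_apply_apply _ _).symm
    · rw [Setoid.comap_rel, Equiv.symm_apply_apply]; exact hy
    · rintro z ⟨hz, hz'⟩
      rw [Setoid.comap_rel] at hz'
      rw [← hu _ ⟨fun h => hz ((Equiv.sumCongr e e').symm.injective h), hz'⟩,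
        Equiv.apply_symm_apply]

/-! ### Horizontal composition -/

/-- Points of `ρ` are related by `ρ`, points of `σ` by `σ`, and there are no other relations. -/
def sumSetoid {X Y : Type} (ρ : Setoid X) (σ : Setoid Y) : Setoid (X ⊕ Y) where
  r := Sum.LiftRel ρ σ
  iseqv :=
    { refl := by
        rintro (u | u)
        · exact .inl (ρ.refl' u)
        · exact .inr (σ.refl' u)
      symm := by
        rintro _ _ (h | h)
        · exact .inl (ρ.symm' h)
        · exact .inr (σ.symm' h)
      trans := by
        rintro _ _ _ (h | h) (h' | h')
        · exact .inl (ρ.trans' h h')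
        · exact .inr (σ.trans' h h') }

/-- Horizontal composition: the two diagrams are put side by side. -/
def tensor (R : Brauerian α β) (S : Brauerian α' β') : Brauerian (α ⊕ α') (β ⊕ β') where
  rel := (sumSetoid R.rel S.rel).comap (Equiv.sumSumSumComm α α' β β')
  existsUnique_partner := fun x => by
    have key : ∀ w : (α ⊕ β) ⊕ (α' ⊕ β'), ∃! v, v ≠ w ∧ Sum.LiftRel R.rel S.rel w v := by
      rintro (u | u)
      · obtain ⟨v, ⟨hne, hv⟩, hu⟩ := R.existsUnique_partner u
        refine ⟨.inl v, ⟨by simpa using hne, .inl hv⟩, ?_⟩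
        rintro _ ⟨hz, (h | h)⟩
        rw [hu _ ⟨by simpa using hz, h⟩]
      · obtain ⟨v, ⟨hne, hv⟩, hu⟩ := S.existsUnique_partner u
        refine ⟨.inr v, ⟨by simpa using hne, .inr hv⟩, ?_⟩
        rintro _ ⟨hz, (h | h)⟩
        rw [hu _ ⟨by simpa using hz, h⟩]
    obtain ⟨v, ⟨hne, hv⟩, hu⟩ := key (Equiv.sumSumSumComm α α' β β' x)
    refine ⟨(Equiv.sumSumSumComm α α' β β').symm v, ⟨?_, ?_⟩, ?_⟩
    · rintro rfl
      exact hne (Equiv.apply_symm_apply _ _).symm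
    · change Sum.LiftRel _ _ _ (Equiv.sumSumSumComm α α' β β' _)
      rw [Equiv.apply_symm_apply]; exact hv
    · rintro z ⟨hz, hz'⟩
      rw [← hu _ ⟨fun h => hz ((Equiv.sumSumSumComm α α' β β').injective h), hz'⟩,
        Equiv.symm_apply_apply]

/-- The two obvious inclusions of the points of `R` into the points of the tensor. -/
theorem tensor_inl {R : Brauerian α β} {S : Brauerian α' β'} {x y : α ⊕ β} (h : R.rel x y) :
    (R.tensor S).rel (Sum.map .inl .inl x) (Sum.map .inl .inl y) := by
  rcases x with x | x <;> rcases y with y | y <;> exact Sum.LiftRel.inl h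

theorem tensor_inr {R : Brauerian α β} {S : Brauerian α' β'} {x y : α' ⊕ β'} (h : S.rel x y) :
    (R.tensor S).rel (Sum.map .inr .inr x) (Sum.map .inr .inr y) := by
  rcases x with x | x <;> rcases y with y | y <;> exact Sum.LiftRel.inr h

theorem tensor_le {R : Brauerian α β} {S : Brauerian α' β'}
    {K : (α ⊕ α') ⊕ (β ⊕ β') → (α ⊕ α') ⊕ (β ⊕ β') → Prop}
    (h1 : ∀ x y, R.rel x y → K (Sum.map .inl .inl x) (Sum.map .inl .inl y))
    (h2 : ∀ x y, S.rel x y → K (Sum.map .inr .inr x) (Sum.map .inr .inr y))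
    (x y) (h : (R.tensor S).rel x y) : K x y := by
  change Sum.LiftRel R.rel S.rel _ _ at h
  have e : ∀ u v, Sum.LiftRel R.rel S.rel u v →
      K ((Equiv.sumSumSumComm α α' β β').symm u) ((Equiv.sumSumSumComm α α' β β').symm v) := by
    rintro _ _ (h | h)
    · rename_i u v
      have := h1 _ _ h
      rcases u with u | u <;> rcases v with v | v <;> exact this
    · rename_i u v
      have := h2 _ _ h
      rcases u with u | u <;> rcases v with v | v <;> exact this
  have := e _ _ h
  rwa [Equiv.symm_apply_apply, Equiv.symm_apply_apply] at this

/-! ### Vertical composition -/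

/-- One step in the stacked diagram with top row `α`, middle row `β` and bottom row `γ`. -/
inductive GlueStep (R : Brauerian α β) (S : Brauerian β γ) :
    α ⊕ (β ⊕ γ) → α ⊕ (β ⊕ γ) → Prop
  | upper {x y : α ⊕ β} (h : R.rel x y) : GlueStep R S (Sum.map id .inl x) (Sum.map id .inl y)
  | lower {x y : β ⊕ γ} (h : S.rel x y) : GlueStep R S (.inr x) (.inr y)

/-- The equivalence relation generated by `R` and `S` on the three rows. -/
def glue (R : Brauerian α β) (S : Brauerian β γ) : Setoid (α ⊕ (β ⊕ γ)) :=
  Relation.EqvGen.setoid (GlueStep R S)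

/-- The equivalence relation generated by `R` and `S`, restricted to the outer rows. -/
def compRel (R : Brauerian α β) (S : Brauerian β γ) : Setoid (α ⊕ γ) :=
  (glue R S).comap (Sum.map id .inr)

theorem glue_upper {R : Brauerian α β} (S : Brauerian β γ) {x y : α ⊕ β} (h : R.rel x y) :
    glue R S (Sum.map id .inl x) (Sum.map id .inl y) :=
  .rel _ _ (.upper h)

theorem glue_lower (R : Brauerian α β) {S : Brauerian β γ} {x y : β ⊕ γ} (h : S.rel x y) :
    glue R S (.inr x) (.inr y) :=
  .rel _ _ (.lower h)

theorem glue_le {R : Brauerian α β} {S : Brauerian β γ} {K : Setoid (α ⊕ (β ⊕ γ))}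
    (h1 : ∀ x y, R.rel x y → K (Sum.map id .inl x) (Sum.map id .inl y))
    (h2 : ∀ x y, S.rel x y → K (.inr x) (.inr y)) {x y} (h : glue R S x y) : K x y := by
  refine Setoid.eqvGen_le (s := K) ?_ h
  rintro _ _ (h | h)
  · exact h1 _ _ h
  · exact h2 _ _ h

/-- An orbit of the group generated by two involutions of a finite set without common fixed point,
if it contains a point fixed by one of them, contains exactly two such points. -/
theorem existsUnique_end_aux {W : Type} [Finite W] (r p : Equiv.Perm W) (hr : r * r = 1)
    (hp : p * p = 1) (hne : ∀ w, ¬ (r w = w ∧ p w = w)) (E : Setoid W)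
    (hE : E = Relation.EqvGen.setoid (fun u v => v = r u ∨ v = p u)) (x : W) (hx : p x = x) :
    ∃! y, y ≠ x ∧ E x y ∧ (r y = y ∨ p y = y) := by
  set ρ : Equiv.Perm W := p * r with hρ
  have hri : r⁻¹ = r := inv_eq_of_mul_eq_one_left hr
  have hpi : p⁻¹ = p := inv_eq_of_mul_eq_one_left hp
  have hρi : ρ⁻¹ = r * p := by rw [hρ, mul_inv_rev, hri, hpi]
  have hconj : ∀ i : ℤ, p * ρ ^ i = ρ ^ (-i) * p := by
    intro i
    have h1 : p * ρ * p⁻¹ = ρ⁻¹ := by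
      rw [hρi, hρ, hpi, ← mul_assoc, hp, one_mul]
    have h2 := conj_zpow (a := p) (b := ρ) (i := i)
    rw [h1] at h2
    rw [zpow_neg, ← inv_zpow, h2, inv_mul_cancel_right]
  have hpo : ∀ i : ℤ, p ((ρ ^ i) x) = (ρ ^ (-i)) x := by
    intro i
    rw [← Equiv.Perm.mul_apply, hconj, Equiv.Perm.mul_apply, hx]
  have hrp : r = p * ρ := by rw [hρ, ← mul_assoc, hp, one_mul]
  have hro : ∀ i : ℤ, r ((ρ ^ i) x) = (ρ ^ (-i - 1)) x := by
    intro i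
    have : r ((ρ ^ i) x) = p ((ρ ^ (i + 1)) x) := by
      rw [← Equiv.Perm.mul_apply, ← Equiv.Perm.mul_apply, hrp, mul_assoc, ← zpow_one_add, add_comm]
    rw [this, hpo, neg_add']
  have hrE : ∀ w, E w (r w) := fun w => by rw [hE]; exact .rel _ _ (.inl rfl)
  have hpE : ∀ w, E w (p w) := fun w => by rw [hE]; exact .rel _ _ (.inr rfl)
  have horb : ∀ y, E x y → ∃ i : ℤ, y = (ρ ^ i) x := by
    have key : ∀ u v, E u v → ((∃ i : ℤ, u = (ρ ^ i) x) ↔ ∃ i : ℤ, v = (ρ ^ i) x) := by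
      intro u v h
      rw [hE] at h
      induction h with
      | refl => rfl
      | symm _ _ _ ih => exact ih.symm
      | trans _ _ _ _ _ ih ih' => exact ih.trans ih'
      | rel u v h =>
        rcases h with rfl | rfl
        · constructor
          · rintro ⟨i, rfl⟩; exact ⟨_, hro i⟩
          · rintro ⟨i, hi⟩
            refine ⟨-i - 1, ?_⟩
            rw [← hro, ← hi, ← Equiv.Perm.mul_apply, hr, Equiv.Perm.one_apply]
        · constructor
          · rintro ⟨i, rfl⟩; exact ⟨_, hpo i⟩
          · rintro ⟨i, hi⟩
            refine ⟨-i, ?_⟩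
            rw [← hpo, ← hi, ← Equiv.Perm.mul_apply, hp, Equiv.Perm.one_apply]
    intro y hy
    exact (key x y hy).1 ⟨0, by simp⟩
  have hEρ : ∀ i : ℤ, E x ((ρ ^ i) x) := by
    have hst : ∀ w, E w (ρ w) := fun w => E.trans' (hrE w) (hpE _)
    intro i
    induction i with
    | zero => simp
    | succ i ih =>
      rw [add_comm, zpow_add, zpow_one, Equiv.Perm.mul_apply]
      exact E.trans' ih (hst _)
    | pred i ih =>
      refine E.trans' ih (E.symm' ?_)
      have h := hst ((ρ ^ (-(i : ℤ) - 1)) x)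
      rwa [← Equiv.Perm.mul_apply, ← zpow_one_add, show (1 + (-(i : ℤ) - 1)) = -(i : ℤ) by ring]
        at h
  set N := Function.minimalPeriod (ρ • ·) x with hN
  have hNpos : 0 < N := Function.minimalPeriod_pos_of_mem_periodicPts
    ((Function.Injective.mem_periodicPts (f := (ρ • ·)) (MulAction.injective ρ)) x)
  have hdvd : ∀ i : ℤ, (ρ ^ i) x = x ↔ (N : ℤ) ∣ i := fun i =>
    MulAction.zpow_smul_eq_iff_minimalPeriod_dvd (a := ρ) (b := x)
  have hij : ∀ i j : ℤ, (ρ ^ i) x = (ρ ^ j) x ↔ (N : ℤ) ∣ i - j := by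
    intro i j
    rw [← hdvd, sub_eq_neg_add, zpow_add, Equiv.Perm.mul_apply, zpow_neg, Equiv.Perm.inv_eq_iff_eq,
      eq_comm]
  have hN1 : N ≠ 1 := by
    intro h1
    have h2 := (hdvd (-0 - 1)).2 (by rw [h1]; simp)
    have h3 := hro 0
    rw [h2] at h3
    exact hne x ⟨by simpa using h3, hx⟩
  refine ⟨(ρ ^ ((N / 2 : ℕ) : ℤ)) x, ⟨?_, hEρ _, ?_⟩, ?_⟩
  · rw [Ne, hdvd, Int.natCast_dvd_natCast]
    intro h
    have := Nat.le_of_dvd (by omega) h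
    omega
  · rw [hpo, hro, hij, hij]
    rcases Nat.even_or_odd' N with ⟨k, hk | hk⟩
    · right
      exact ⟨-1, by omega⟩
    · left
      exact ⟨-1, by omega⟩
  · rintro y ⟨hyx, hy, hfix⟩
    obtain ⟨i, rfl⟩ := horb y hy
    rw [Ne, hdvd] at hyx
    rw [hpo, hro, hij, hij] at hfix
    rw [hij]
    rcases Nat.even_or_odd' N with ⟨k, hk | hk⟩
    · have hk2 : N / 2 = k := by omega
      rw [hk2]
      rcases hfix with ⟨q, hq⟩ | ⟨q, hq⟩
      · exfalso
        rw [hk] at hq; push_cast at hq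
        have : 2 * (k * q + i) = -1 := by linarith
        omega
      · rw [hk] at hq hyx ⊢; push_cast at hq hyx ⊢
        have hi : i = -(k * q) := by linarith
        rcases Int.even_or_odd' q with ⟨m, rfl | rfl⟩
        · exact absurd ⟨-m, by rw [hi]; ring⟩ hyx
        · exact ⟨-m - 1, by rw [hi]; ring⟩
    · have hk2 : N / 2 = k := by omega
      rw [hk2]
      rcases hfix with ⟨q, hq⟩ | ⟨q, hq⟩
      · rw [hk] at hq ⊢; push_cast at hq ⊢
        rcases Int.even_or_odd' q with ⟨m, rfl | rfl⟩
        · exfalso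
          have : 2 * ((2 * k + 1) * m + i) = -1 := by linarith
          omega
        · exact ⟨-m - 1, by linarith⟩
      · exfalso
        rw [hk] at hq hyx; push_cast at hq hyx
        rcases Int.even_or_odd' q with ⟨m, rfl | rfl⟩
        · exact hyx ⟨-m, by linarith⟩
        · have : 2 * ((2 * k + 1) * m + k + i) = -1 := by linarith
          omega

/-- The point joined with a given point. -/
noncomputable def partner (R : Brauerian α β) (x : α ⊕ β) : α ⊕ β :=
  (R.existsUnique_partner x).choose

theorem partner_ne (R : Brauerian α β) (x : α ⊕ β) : R.partner x ≠ x :=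
  (R.existsUnique_partner x).choose_spec.1.1

theorem rel_partner (R : Brauerian α β) (x : α ⊕ β) : R.rel x (R.partner x) :=
  (R.existsUnique_partner x).choose_spec.1.2

theorem eq_or_eq_partner (R : Brauerian α β) {x y : α ⊕ β} (h : R.rel x y) :
    y = x ∨ y = R.partner x := by
  by_cases e : y = x
  · exact .inl e
  · exact .inr (R.eq_of_rel h (R.rel_partner x) e (R.partner_ne x))

theorem partner_partner (R : Brauerian α β) (x : α ⊕ β) : R.partner (R.partner x) = x :=
  R.eq_of_rel (R.rel_partner _) (R.rel.symm' (R.rel_partner x)) (R.partner_ne _)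
    (R.partner_ne x).symm

theorem compRel_existsUnique [Finite α] [Finite β] [Finite γ] (R : Brauerian α β)
    (S : Brauerian β γ) (x : α ⊕ γ) : ∃! y, y ≠ x ∧ compRel R S x y := by
  let A : α ⊕ (β ⊕ γ) ≃ (α ⊕ β) ⊕ γ := (Equiv.sumAssoc α β γ).symm
  let rf : α ⊕ (β ⊕ γ) → α ⊕ (β ⊕ γ) := fun w => A.symm (Sum.map R.partner id (A w))
  let pf : α ⊕ (β ⊕ γ) → α ⊕ (β ⊕ γ) := Sum.map id S.partner
  have hrf : ∀ w, rf (rf w) = w := by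
    intro w
    change A.symm (Sum.map R.partner id (A (A.symm (Sum.map R.partner id (A w))))) = w
    rw [Equiv.apply_symm_apply, Equiv.symm_apply_eq]
    rcases A w with u | u
    · simp [partner_partner]
    · rfl
  have hpf : ∀ w, pf (pf w) = w := by
    rintro (a | y)
    · rfl
    · simp [pf, partner_partner]
  let r : Equiv.Perm (α ⊕ (β ⊕ γ)) := ⟨rf, rf, hrf, hrf⟩
  let p : Equiv.Perm (α ⊕ (β ⊕ γ)) := ⟨pf, pf, hpf, hpf⟩
  have hA : ∀ u : α ⊕ β, A.symm (.inl u) = Sum.map id .inl u := by rintro (u | u) <;> rfl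
  have hrfl : ∀ u : α ⊕ β, rf (Sum.map id .inl u) = Sum.map id .inl (R.partner u) := by
    intro u
    rw [← hA, ← hA]
    change A.symm (Sum.map R.partner id (A (A.symm _))) = _
    rw [Equiv.apply_symm_apply]; rfl
  have hinj : Function.Injective (Sum.map id .inl : α ⊕ β → α ⊕ (β ⊕ γ)) :=
    Function.injective_id.sumMap Sum.inl_injective
  have hrfix : ∀ w, rf w = w ↔ ∃ c, w = .inr (.inr c) := by
    intro w
    constructor
    · intro h
      rcases w with a | b | c
      · exact absurd (hinj (a₁ := R.partner (.inl a)) (a₂ := .inl a)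
          ((hrfl (.inl a)).symm.trans h)) (R.partner_ne _)
      · exact absurd (hinj (a₁ := R.partner (.inr b)) (a₂ := .inr b)
          ((hrfl (.inr b)).symm.trans h)) (R.partner_ne _)
      · exact ⟨c, rfl⟩
    · rintro ⟨c, rfl⟩; rfl
  have hpfix : ∀ w, pf w = w ↔ ∃ a, w = .inl a := by
    intro w
    constructor
    · intro h
      rcases w with a | y
      · exact ⟨a, rfl⟩
      · exact absurd (Sum.inr_injective h) (S.partner_ne _)
    · rintro ⟨c, rfl⟩; rfl
  have hne : ∀ w, ¬ (rf w = w ∧ pf w = w) := by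
    rintro w ⟨h1, h2⟩
    obtain ⟨c, rfl⟩ := (hrfix w).1 h1
    obtain ⟨a, h⟩ := (hpfix _).1 h2
    simp at h
  have hE : glue R S = Relation.EqvGen.setoid (fun u v => v = r u ∨ v = p u) := by
    apply le_antisymm
    · apply Setoid.eqvGen_le
      rintro _ _ (⟨h⟩ | ⟨h⟩)
      · rename_i x y
        rcases R.eq_or_eq_partner h with rfl | rfl
        · exact Setoid.refl' _ _
        · exact .rel _ _ (.inl (hrfl x).symm)
      · rename_i x y
        rcases S.eq_or_eq_partner h with rfl | rfl
        · exact Setoid.refl' _ _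
        · exact .rel _ _ (.inr rfl)
    · apply Setoid.eqvGen_le
      rintro u v (rfl | rfl)
      · change glue R S u (rf u)
        rcases u with a | b | c
        · have := glue_upper S (R.rel_partner (.inl a))
          rw [← hrfl] at this; exact this
        · have := glue_upper S (R.rel_partner (.inr b))
          rw [← hrfl] at this; exact this
        · exact Setoid.refl' _ _
      · change glue R S u (pf u)
        rcases u with a | y
        · exact Setoid.refl' _ _
        · exact glue_lower R (S.rel_partner y)
  have hr2 : r * r = 1 := Equiv.ext hrf
  have hp2 : p * p = 1 := Equiv.ext hpf
  have main : ∃! y, y ≠ Sum.map id .inr x ∧ glue R S (Sum.map id .inr x) y ∧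
      (rf y = y ∨ pf y = y) := by
    rcases x with a | c
    · exact existsUnique_end_aux r p hr2 hp2 hne _ hE _ rfl
    · have := existsUnique_end_aux p r hp2 hr2 (fun w h => hne w h.symm) (glue R S)
        (by rw [hE]; simp only [or_comm]) (.inr (.inr c)) rfl
      simp only [or_comm] at this ⊢
      exact this
  obtain ⟨y, ⟨hyx, hy, hfix⟩, hu⟩ := main
  have hend : ∀ z : α ⊕ γ, rf (Sum.map id .inr z) = Sum.map id .inr z ∨
      pf (Sum.map id .inr z) = Sum.map id .inr z := by
    rintro (a | c)
    · exact .inr rfl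
    · exact .inl rfl
  have hinj' : Function.Injective (Sum.map id .inr : α ⊕ γ → α ⊕ (β ⊕ γ)) :=
    Function.injective_id.sumMap Sum.inr_injective
  obtain ⟨z, rfl⟩ : ∃ z : α ⊕ γ, y = Sum.map id .inr z := by
    rw [hrfix, hpfix] at hfix
    rcases hfix with ⟨c, rfl⟩ | ⟨a, rfl⟩
    · exact ⟨.inr c, rfl⟩
    · exact ⟨.inl a, rfl⟩
  refine ⟨z, ⟨fun h => hyx (by rw [h]), hy⟩, ?_⟩
  rintro z' ⟨hz', hr'⟩
  exact hinj' (hu _ ⟨fun h => hz' (hinj' h), hr', hend z'⟩)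

/-- Vertical composition: first `R`, then `S`. Circles in the middle row are forgotten. -/
def comp [Finite α] [Finite β] [Finite γ] (R : Brauerian α β) (S : Brauerian β γ) :
    Brauerian α γ where
  rel := compRel R S
  existsUnique_partner := compRel_existsUnique R S

theorem ofEquiv_le {e : α ≃ β} {K : α ⊕ β → α ⊕ β → Prop} (hrefl : ∀ x, K x x)
    (hsymm : ∀ x y, K x y → K y x) (h : ∀ a, K (.inl a) (.inr (e a))) (x y)
    (hxy : (ofEquiv e).rel x y) : K x y := by
  rcases hxy with rfl | rfl
  · exact hrefl _
  · rcases x with a | b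
    · exact h a
    · have := hsymm _ _ (h (e.symm b))
      rwa [Equiv.apply_symm_apply] at this

theorem ofEquiv_rel (e : α ≃ β) (a : α) : (ofEquiv e).rel (.inl a) (.inr (e a)) := .inr rfl

theorem ofEquiv_rel_symm (e : α ≃ β) (b : β) :
    (ofEquiv e).rel (.inr b) (.inl (e.symm b)) := .inr rfl

theorem caps_rel (x : α) : (caps α).rel (.inr (.inl x)) (.inr (.inr x)) := .inr rfl

theorem reindex_id (e : α ≃ α') :
    (ofEquiv (Equiv.refl α)).reindex e e = ofEquiv (Equiv.refl α') := by
  symm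
  apply ofInvolution_eq
  rintro (a | a)
  · exact ofEquiv_rel (Equiv.refl α) (e.symm a)
  · exact Setoid.symm' _ (ofEquiv_rel (Equiv.refl α) (e.symm a))

theorem ofEquiv_tensor_ofEquiv (e : α ≃ β) (e' : α' ≃ β') :
    (ofEquiv e).tensor (ofEquiv e') = ofEquiv (Equiv.sumCongr e e') := by
  symm
  apply ofInvolution_eq
  rintro ((a | a') | (b | b'))
  · exact tensor_inl (ofEquiv_rel e a)
  · exact tensor_inr (ofEquiv_rel e' a')
  · exact tensor_inl (ofEquiv_rel_symm e b)
  · exact tensor_inr (ofEquiv_rel_symm e' b')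

section Comp

variable [Finite α] [Finite β] [Finite γ] [Finite δ] [Finite α'] [Finite β'] [Finite γ']

theorem comp_rel (R : Brauerian α β) (S : Brauerian β γ) (x y : α ⊕ γ) :
    (R.comp S).rel x y ↔ glue R S (Sum.map id .inr x) (Sum.map id .inr y) := Iff.rfl

theorem comp_le {R : Brauerian α β} {S : Brauerian β γ} (K : Setoid (α ⊕ (β ⊕ γ)))
    {T : Brauerian α γ}
    (h1 : ∀ x y, R.rel x y → K (Sum.map id .inl x) (Sum.map id .inl y))
    (h2 : ∀ x y, S.rel x y → K (.inr x) (.inr y))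
    (h3 : ∀ x y, K (Sum.map id .inr x) (Sum.map id .inr y) → T.rel x y) : R.comp S = T :=
  eq_of_le fun x y h => h3 x y (glue_le h1 h2 h)

theorem comp_eq_of_label {L : Type} {R : Brauerian α β} {S : Brauerian β γ} {T : Brauerian α γ}
    (l : α ⊕ (β ⊕ γ) → L)
    (h1 : ∀ x y, R.rel x y → l (Sum.map id .inl x) = l (Sum.map id .inl y))
    (h2 : ∀ x y, S.rel x y → l (.inr x) = l (.inr y))
    (h3 : ∀ x y, l (Sum.map id .inr x) = l (Sum.map id .inr y) → T.rel x y) : R.comp S = T :=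
  comp_le (Setoid.ker l) h1 h2 h3

theorem ofEquiv_comp_rel (e : α ≃ β) (R : Brauerian β γ) (x y : α ⊕ γ) :
    ((ofEquiv e).comp R).rel x y ↔ R.rel (Sum.map e id x) (Sum.map e id y) := by
  have h : ∀ x : α ⊕ γ, glue (ofEquiv e) R (Sum.map id .inr x) (.inr (Sum.map e id x)) := by
    rintro (a | c)
    · exact glue_upper R (ofEquiv_rel e a)
    · exact Setoid.refl' _ _
  have key : (ofEquiv e).comp R = reindex e.symm (Equiv.refl γ) R := by
    symm
    apply eq_of_le
    intro x y hxy
    have hxy' : R.rel (Sum.map e id x) (Sum.map e id y) := hxy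
    let F := glue (ofEquiv e) R
    exact F.trans' (h x) (F.trans' (glue_lower _ hxy') (F.symm' (h y)))
  rw [key]; rfl

theorem comp_ofEquiv_rel (e : β ≃ γ) (R : Brauerian α β) (x y : α ⊕ γ) :
    (R.comp (ofEquiv e)).rel x y ↔ R.rel (Sum.map id e.symm x) (Sum.map id e.symm y) := by
  have h : ∀ x : α ⊕ γ, glue R (ofEquiv e) (Sum.map id .inr x)
      (Sum.map id .inl (Sum.map id e.symm x)) := by
    rintro (a | c)
    · exact Setoid.refl' _ _
    · have := Setoid.symm' _ (glue_lower R (ofEquiv_rel e (e.symm c)))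
      rwa [Equiv.apply_symm_apply] at this
  have key : R.comp (ofEquiv e) = reindex (Equiv.refl α) e R := by
    symm
    apply eq_of_le
    intro x y hxy
    have hxy' : R.rel (Sum.map id e.symm x) (Sum.map id e.symm y) := hxy
    let F := glue R (ofEquiv e)
    exact F.trans' (h x) (F.trans' (glue_upper _ hxy') (F.symm' (h y)))
  rw [key]; rfl

theorem id_comp (R : Brauerian α β) : (ofEquiv (Equiv.refl α)).comp R = R := by
  ext x y
  rw [ofEquiv_comp_rel]
  simp

theorem comp_id (R : Brauerian α β) : R.comp (ofEquiv (Equiv.refl β)) = R := by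
  ext x y
  rw [comp_ofEquiv_rel]
  simp

theorem comp_assoc (R : Brauerian α β) (S : Brauerian β γ) (T : Brauerian γ δ) :
    (R.comp S).comp T = R.comp (S.comp T) := by
  let i : α ⊕ (β ⊕ γ) → α ⊕ (β ⊕ (γ ⊕ δ)) := Sum.map id (Sum.map id .inl)
  let step : α ⊕ (β ⊕ (γ ⊕ δ)) → α ⊕ (β ⊕ (γ ⊕ δ)) → Prop := fun u v =>
    (∃ x y, glue R S x y ∧ u = i x ∧ v = i y) ∨
      ∃ x y, T.rel x y ∧ u = .inr (.inr x) ∧ v = .inr (.inr y)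
  let E : Setoid (α ⊕ (β ⊕ (γ ⊕ δ))) := Relation.EqvGen.setoid step
  have hRS : ∀ x y, glue R S x y → E (i x) (i y) := fun x y h =>
    .rel _ _ (.inl ⟨x, y, h, rfl, rfl⟩)
  have hT : ∀ x y, T.rel x y → E (.inr (.inr x)) (.inr (.inr y)) := fun x y h =>
    .rel _ _ (.inr ⟨x, y, h, rfl, rfl⟩)
  have hleft : ∀ x y : α ⊕ δ, ((R.comp S).comp T).rel x y ↔
      E (Sum.map id (Sum.inr ∘ Sum.inr) x) (Sum.map id (Sum.inr ∘ Sum.inr) y) := by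
    let j : α ⊕ (γ ⊕ δ) → α ⊕ (β ⊕ (γ ⊕ δ)) := Sum.map id .inr
    have hj : ∀ x : α ⊕ γ, j (Sum.map id .inl x) = i (Sum.map id .inr x) := by
      rintro (a | c) <;> rfl
    intro x y
    constructor
    · intro h
      have : E.comap j (Sum.map id .inr x) (Sum.map id .inr y) := by
        refine glue_le (R := R.comp S) (S := T) (K := E.comap j) ?_ ?_ h
        · intro x y h
          rw [Setoid.comap_rel, hj, hj]
          exact hRS _ _ h
        · intro x y h
          exact hT _ _ h
      rcases x with x | x <;> rcases y with y | y <;> exact this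
    · intro h
      let F := glue (R.comp S) T
      let q : α ⊕ (β ⊕ (γ ⊕ δ)) → α ⊕ (γ ⊕ δ) → Prop := fun u w =>
        (∃ x e, u = i x ∧ glue R S x (Sum.map id .inr e) ∧ F (Sum.map id .inl e) w) ∨
          ∃ x, u = .inr (.inr x) ∧ F (.inr x) w
      have hi : Function.Injective i :=
        Function.injective_id.sumMap (Function.injective_id.sumMap Sum.inl_injective)
      have hqi : ∀ x w, q (i x) w ↔
          ∃ e, glue R S x (Sum.map id .inr e) ∧ F (Sum.map id .inl e) w := by
        intro x w
        constructor
        · rintro (⟨x', e, hx, h1, h2⟩ | ⟨z, hx, h1⟩)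
          · rw [hi hx]; exact ⟨e, h1, h2⟩
          · rcases z with c | d
            · have hxc : x = .inr (.inr c) := hi hx
              subst hxc
              exact ⟨.inr c, Setoid.refl' _ _, h1⟩
            · rcases x with a | b | c <;> simp [i] at hx
        · rintro ⟨e, h1, h2⟩
          exact .inl ⟨x, e, rfl, h1, h2⟩
      have hqT : ∀ x w, q (.inr (.inr x)) w ↔ F (.inr x) w := by
        intro x w
        constructor
        · rintro (⟨x', e, hx, h1, h2⟩ | ⟨z, hx, h1⟩)
          · rcases x' with a | b | c
            · simp [i] at hx
            · simp [i] at hx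
            · have hxc : x = .inl c := by simpa [i] using hx
              subst hxc
              have h3 : F (Sum.map id .inl (.inr c)) (Sum.map id .inl e) :=
                glue_upper T (R := R.comp S) (x := .inr c) h1
              exact F.trans' h3 h2
          · have hzx : z = x := by simpa using hx.symm
            rw [← hzx]; exact h1
        · intro h
          exact .inr ⟨x, rfl, h⟩
      have hq : ∀ u v, E u v → ∀ w, q u w ↔ q v w := by
        intro u v h
        refine Setoid.eqvGen_le (r := step) (s := ⟨fun u v => ∀ w, q u w ↔ q v w,
          fun _ _ => Iff.rfl, fun h w => (h w).symm, fun h h' w => (h w).trans (h' w)⟩) ?_ h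
        rintro _ _ (⟨x, y, h, rfl, rfl⟩ | ⟨x, y, h, rfl, rfl⟩) w
        · rw [hqi, hqi]
          exact ⟨fun ⟨e, h1, h2⟩ => ⟨e, Setoid.trans' _ (Setoid.symm' _ h) h1, h2⟩,
            fun ⟨e, h1, h2⟩ => ⟨e, Setoid.trans' _ h h1, h2⟩⟩
        · rw [hqT, hqT]
          have := glue_lower (R.comp S) h
          exact ⟨fun h1 => F.trans' (F.symm' this) h1, fun h1 => F.trans' this h1⟩
      have hq0 : ∀ z : α ⊕ δ, ∀ w, q (Sum.map id (Sum.inr ∘ Sum.inr) z) w ↔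
          F (Sum.map id .inr z) w := by
        rintro (a | d) w
        · have := hqi (.inl a) w
          refine this.trans ⟨?_, ?_⟩
          · rintro ⟨e, h1, h2⟩
            have h3 : F (Sum.map id .inl (.inl a)) (Sum.map id .inl e) :=
              glue_upper T (R := R.comp S) (x := .inl a) h1
            exact F.trans' h3 h2
          · intro h
            exact ⟨.inl a, Setoid.refl' _ _, h⟩
        · exact hqT (.inr d) w
      have := (hq _ _ h (Sum.map id .inr y)).2 ((hq0 _ _).2 (F.refl' _))
      exact (hq0 _ _).1 this
  symm
  apply eq_of_le
  intro x y h
  rw [hleft]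
  let j : α ⊕ (β ⊕ δ) → α ⊕ (β ⊕ (γ ⊕ δ)) := Sum.map id (Sum.map id .inr)
  have hR : ∀ x y, R.rel x y → E (j (Sum.map id .inl x)) (j (Sum.map id .inl y)) := by
    intro x y h
    have := hRS _ _ (glue_upper S h)
    rcases x with x | x <;> rcases y with y | y <;> exact this
  have hST : ∀ x y : β ⊕ δ, (S.comp T).rel x y → E (j (.inr x)) (j (.inr y)) := by
    intro x y h
    have : E.comap Sum.inr (Sum.map id .inr x) (Sum.map id .inr y) := by
      refine glue_le (R := S) (S := T) (K := E.comap Sum.inr) ?_ ?_ h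
      · intro x y h
        have := hRS _ _ (glue_lower R h)
        rcases x with x | x <;> rcases y with y | y <;> exact this
      · intro x y h
        exact hT _ _ h
    rcases x with x | x <;> rcases y with y | y <;> exact this
  have : E.comap j (Sum.map id .inr x) (Sum.map id .inr y) :=
    glue_le (R := R) (S := S.comp T) (K := E.comap j) hR hST h
  rcases x with x | x <;> rcases y with y | y <;> exact this

theorem ofEquiv_comp_ofEquiv (e : α ≃ β) (e' : β ≃ γ) :
    (ofEquiv e).comp (ofEquiv e') = ofEquiv (e.trans e') := by
  symm
  apply ofInvolution_eq
  rintro (a | c)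
  · rw [ofEquiv_comp_rel]
    exact ofEquiv_rel e' (e a)
  · rw [ofEquiv_comp_rel]
    have := Setoid.symm' _ (ofEquiv_rel e' (e'.symm c))
    rw [Equiv.apply_symm_apply] at this
    simpa using this

theorem tensor_comp_tensor (R : Brauerian α β) (S : Brauerian β γ) (R' : Brauerian α' β')
    (S' : Brauerian β' γ') :
    (R.comp S).tensor (R'.comp S') = (R.tensor R').comp (S.tensor S') := by
  apply eq_of_le
  apply tensor_le
  · let j : α ⊕ (β ⊕ γ) → (α ⊕ α') ⊕ ((β ⊕ β') ⊕ (γ ⊕ γ')) := Sum.map .inl (Sum.map .inl .inl)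
    intro x y h
    have : (glue (R.tensor R') (S.tensor S')).comap j (Sum.map id .inr x) (Sum.map id .inr y) := by
      refine glue_le (R := R) (S := S) ?_ ?_ h
      · intro x y h
        have := glue_upper (S.tensor S') (tensor_inl (S := R') h)
        rcases x with x | x <;> rcases y with y | y <;> exact this
      · intro x y h
        exact glue_lower (R.tensor R') (tensor_inl (S := S') h)
    rcases x with x | x <;> rcases y with y | y <;> exact this
  · let j : α' ⊕ (β' ⊕ γ') → (α ⊕ α') ⊕ ((β ⊕ β') ⊕ (γ ⊕ γ')) := Sum.map .inr (Sum.map .inr .inr)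
    intro x y h
    have : (glue (R.tensor R') (S.tensor S')).comap j (Sum.map id .inr x) (Sum.map id .inr y) := by
      refine glue_le (R := R') (S := S') ?_ ?_ h
      · intro x y h
        have := glue_upper (S.tensor S') (tensor_inr (R := R) h)
        rcases x with x | x <;> rcases y with y | y <;> exact this
      · intro x y h
        exact glue_lower (R.tensor R') (tensor_inr (R := S) h)
    rcases x with x | x <;> rcases y with y | y <;> exact this

theorem reindex_comp (e : α ≃ α') (e' : β ≃ β') (e'' : γ ≃ γ') (R : Brauerian α β)
    (S : Brauerian β γ) :
    (R.comp S).reindex e e'' = (R.reindex e e').comp (S.reindex e' e'') := by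
  apply eq_of_le
  let j : α ⊕ (β ⊕ γ) → α' ⊕ (β' ⊕ γ') := Sum.map e (Sum.map e' e'')
  have key : ∀ x y, (R.comp S).rel x y →
      ((R.reindex e e').comp (S.reindex e' e'')).rel (Sum.map e e'' x) (Sum.map e e'' y) := by
    intro x y h
    have : (glue (R.reindex e e') (S.reindex e' e'')).comap j
        (Sum.map id .inr x) (Sum.map id .inr y) := by
      refine glue_le (R := R) (S := S) ?_ ?_ h
      · intro x y h
        have h' : (R.reindex e e').rel (Sum.map e e' x) (Sum.map e e' y) := by
          change R.rel (Sum.map e.symm e'.symm _) (Sum.map e.symm e'.symm _)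
          simpa using h
        have := glue_upper (S.reindex e' e'') h'
        rcases x with x | x <;> rcases y with y | y <;> exact this
      · intro x y h
        have h' : (S.reindex e' e'').rel (Sum.map e' e'' x) (Sum.map e' e'' y) := by
          change S.rel (Sum.map e'.symm e''.symm _) (Sum.map e'.symm e''.symm _)
          simpa using h
        exact glue_lower (R.reindex e e') h'
    rcases x with x | x <;> rcases y with y | y <;> exact this
  intro x y h
  have := key _ _ (show (R.comp S).rel (Sum.map e.symm e''.symm x) (Sum.map e.symm e''.symm y)
    from h)
  simpa using this

/-! ### Equations between diagrams -/

theorem assoc_nat (R : Brauerian α α') (S : Brauerian β β') (T : Brauerian γ γ') :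
    (ofEquiv (Equiv.sumAssoc α β γ).symm).comp ((R.tensor S).tensor T) =
      (R.tensor (S.tensor T)).comp (ofEquiv (Equiv.sumAssoc α' β' γ').symm) := by
  symm
  apply eq_of_le
  intro x y h
  rw [comp_ofEquiv_rel] at h
  rw [ofEquiv_comp_rel]
  have e : ∀ u v, (R.tensor (S.tensor T)).rel u v → ((R.tensor S).tensor T).rel
      (Sum.map (Equiv.sumAssoc α β γ).symm (Equiv.sumAssoc α' β' γ').symm u)
      (Sum.map (Equiv.sumAssoc α β γ).symm (Equiv.sumAssoc α' β' γ').symm v) := by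
    apply tensor_le
    · intro x y h
      have := tensor_inl (S := T) (tensor_inl (S := S) h)
      rcases x with x | x <;> rcases y with y | y <;> exact this
    · intro x y h
      refine tensor_le (K := fun x y => ((R.tensor S).tensor T).rel
        (Sum.map (Equiv.sumAssoc α β γ).symm (Equiv.sumAssoc α' β' γ').symm
          (Sum.map .inr .inr x))
        (Sum.map (Equiv.sumAssoc α β γ).symm (Equiv.sumAssoc α' β' γ').symm
          (Sum.map .inr .inr y))) ?_ ?_ x y h
      · intro x y h
        have := tensor_inl (S := T) (tensor_inr (R := R) h)
        rcases x with x | x <;> rcases y with y | y <;> exact this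
      · intro x y h
        have := tensor_inr (R := R.tensor S) h
        rcases x with x | x <;> rcases y with y | y <;> exact this
  have := e _ _ h
  simpa using this

theorem sumEmpty_nat (R : Brauerian α β) :
    (ofEquiv (Equiv.sumEmpty α Empty)).comp R =
      (R.tensor (ofEquiv (Equiv.refl Empty))).comp (ofEquiv (Equiv.sumEmpty β Empty)) := by
  apply eq_of_le
  intro x y h
  rw [ofEquiv_comp_rel] at h
  rw [comp_ofEquiv_rel]
  have := tensor_inl (S := ofEquiv (Equiv.refl Empty)) h
  rcases x with (x | x) | x <;> rcases y with (y | y) | y <;>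
    first | exact x.elim | exact y.elim | exact this

theorem emptySum_nat (R : Brauerian α β) :
    (ofEquiv (Equiv.emptySum Empty α)).comp R =
      ((ofEquiv (Equiv.refl Empty)).tensor R).comp (ofEquiv (Equiv.emptySum Empty β)) := by
  apply eq_of_le
  intro x y h
  rw [ofEquiv_comp_rel] at h
  rw [comp_ofEquiv_rel]
  have := tensor_inr (R := ofEquiv (Equiv.refl Empty)) h
  rcases x with (x | x) | x <;> rcases y with (y | y) | y <;>
    first | exact x.elim | exact y.elim | exact this

theorem swap_nat (R : Brauerian α α') (S : Brauerian β β') :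
    (ofEquiv (Equiv.sumComm α β)).comp (S.tensor R) =
      (R.tensor S).comp (ofEquiv (Equiv.sumComm α' β')) := by
  symm
  apply eq_of_le
  intro x y h
  rw [comp_ofEquiv_rel] at h
  rw [ofEquiv_comp_rel]
  have e : ∀ u v, (R.tensor S).rel u v → (S.tensor R).rel
      (Sum.map (Equiv.sumComm α β) (Equiv.sumComm α' β') u)
      (Sum.map (Equiv.sumComm α β) (Equiv.sumComm α' β') v) := by
    apply tensor_le
    · intro x y h
      have := tensor_inr (R := S) h
      rcases x with x | x <;> rcases y with y | y <;> exact this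
    · intro x y h
      have := tensor_inl (S := R) h
      rcases x with x | x <;> rcases y with y | y <;> exact this
  have := e _ _ h
  rcases x with (x | x) | (x | x) <;> rcases y with (y | y) | (y | y) <;> exact this

theorem caps_cups_right :
    ((ofEquiv (Equiv.refl (α ⊕ β))).tensor (caps β)).comp (cups α β β) =
      ofEquiv (Equiv.sumEmpty (α ⊕ β) Empty) := by
  let l : ((α ⊕ β) ⊕ Empty) ⊕ (((α ⊕ β) ⊕ (β ⊕ β)) ⊕ (α ⊕ β)) → α ⊕ β := fun x =>
    match x with
    | .inl (.inl u) => u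
    | .inr (.inl (.inl u)) => u
    | .inr (.inl (.inr u)) => .inr (u.elim id id)
    | .inr (.inr u) => u
  refine comp_eq_of_label l ?_ ?_ ?_
  · apply tensor_le
    · rintro x y (rfl | rfl)
      · rfl
      · rcases x with x | x <;> rfl
    · rintro x y (rfl | rfl)
      · rfl
      · rcases x with x | x | x <;> first | exact x.elim | rfl
  · rintro x y (rfl | rfl)
    · rfl
    · rcases x with ((x | x) | (x | x)) | (x | x) <;> rfl
  · rintro ((x | x) | x) ((y | y) | y) h <;> first | exact x.elim | exact y.elim | skip
    all_goals cases h
    · exact .inl rfl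
    · exact .inr rfl
    · exact .inr rfl
    · exact .inl rfl

theorem caps_cups_left :
    ((caps β).tensor (ofEquiv (Equiv.refl (β ⊕ α)))).comp (cups β β α) =
      ofEquiv (Equiv.emptySum Empty (β ⊕ α)) := by
  let l : (Empty ⊕ (β ⊕ α)) ⊕ (((β ⊕ β) ⊕ (β ⊕ α)) ⊕ (β ⊕ α)) → β ⊕ α := fun x =>
    match x with
    | .inl (.inr u) => u
    | .inr (.inl (.inl u)) => .inl (u.elim id id)
    | .inr (.inl (.inr u)) => u
    | .inr (.inr u) => u
  refine comp_eq_of_label l ?_ ?_ ?_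
  · apply tensor_le
    · rintro x y (rfl | rfl)
      · rfl
      · rcases x with x | x | x <;> first | exact x.elim | rfl
    · rintro x y (rfl | rfl)
      · rfl
      · rcases x with x | x <;> rfl
  · rintro x y (rfl | rfl)
    · rfl
    · rcases x with ((x | x) | (x | x)) | (x | x) <;> rfl
  · rintro ((x | x) | x) ((y | y) | y) h <;> first | exact x.elim | exact y.elim | skip
    all_goals cases h
    · exact .inl rfl
    · exact .inr rfl
    · exact .inr rfl
    · exact .inl rfl

theorem cups_cups :
    ((ofEquiv (Equiv.refl (α ⊕ β))).tensor (cups β γ δ)).comp (cups α β δ) =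
      (ofEquiv (Equiv.sumAssoc (α ⊕ β) (β ⊕ γ) (γ ⊕ δ)).symm).comp
        (((cups α β γ).tensor (ofEquiv (Equiv.refl (γ ⊕ δ)))).comp (cups α γ δ)) := by
  let M : Brauerian ((α ⊕ β) ⊕ ((β ⊕ γ) ⊕ (γ ⊕ δ))) (α ⊕ δ) :=
    ofInvolution
      (fun x => match x with
        | .inl (.inl (.inl a)) => .inr (.inl a)
        | .inl (.inl (.inr b)) => .inl (.inr (.inl (.inl b)))
        | .inl (.inr (.inl (.inl b))) => .inl (.inl (.inr b))
        | .inl (.inr (.inl (.inr c))) => .inl (.inr (.inr (.inl c)))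
        | .inl (.inr (.inr (.inl c))) => .inl (.inr (.inl (.inr c)))
        | .inl (.inr (.inr (.inr d))) => .inr (.inr d)
        | .inr (.inl a) => .inl (.inl (.inl a))
        | .inr (.inr d) => .inl (.inr (.inr (.inr d))))
      (by rintro (((a | b) | ((b | c) | (c | d))) | (a | d)) <;> rfl)
      (by rintro (((a | b) | ((b | c) | (c | d))) | (a | d)) <;> simp)
  have h1 : ((ofEquiv (Equiv.refl (α ⊕ β))).tensor (cups β γ δ)).comp (cups α β δ) = M := by
    let l : ((α ⊕ β) ⊕ ((β ⊕ γ) ⊕ (γ ⊕ δ))) ⊕ (((α ⊕ β) ⊕ (β ⊕ δ)) ⊕ (α ⊕ δ)) →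
        (α ⊕ β) ⊕ (γ ⊕ δ) := fun x =>
      match x with
      | .inl (.inl u) => .inl u
      | .inl (.inr (.inl (.inl b))) => .inl (.inr b)
      | .inl (.inr (.inl (.inr c))) => .inr (.inl c)
      | .inl (.inr (.inr u)) => .inr u
      | .inr (.inl (.inl u)) => .inl u
      | .inr (.inl (.inr (.inl b))) => .inl (.inr b)
      | .inr (.inl (.inr (.inr d))) => .inr (.inr d)
      | .inr (.inr (.inl a)) => .inl (.inl a)
      | .inr (.inr (.inr d)) => .inr (.inr d)
    refine comp_eq_of_label l ?_ ?_ ?_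
    · apply tensor_le
      · rintro x y (rfl | rfl)
        · rfl
        · rcases x with x | x <;> rfl
      · rintro x y (rfl | rfl)
        · rfl
        · rcases x with ((x | x) | (x | x)) | (x | x) <;> rfl
    · rintro x y (rfl | rfl)
      · rfl
      · rcases x with ((x | x) | (x | x)) | (x | x) <;> rfl
    · rintro (((x | x) | ((x | x) | (x | x))) | (x | x))
        (((y | y) | ((y | y) | (y | y))) | (y | y)) h <;>
      (cases h <;> first | exact .inl rfl | exact .inr rfl)
  have h2 : ((cups α β γ).tensor (ofEquiv (Equiv.refl (γ ⊕ δ)))).comp (cups α γ δ) =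
      (ofEquiv (Equiv.sumAssoc (α ⊕ β) (β ⊕ γ) (γ ⊕ δ))).comp M := by
    let l : (((α ⊕ β) ⊕ (β ⊕ γ)) ⊕ (γ ⊕ δ)) ⊕ (((α ⊕ γ) ⊕ (γ ⊕ δ)) ⊕ (α ⊕ δ)) →
        (α ⊕ β) ⊕ (γ ⊕ δ) := fun x =>
      match x with
      | .inl (.inl (.inl u)) => .inl u
      | .inl (.inl (.inr (.inl b))) => .inl (.inr b)
      | .inl (.inl (.inr (.inr c))) => .inr (.inl c)
      | .inl (.inr u) => .inr u
      | .inr (.inl (.inl (.inl a))) => .inl (.inl a)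
      | .inr (.inl (.inl (.inr c))) => .inr (.inl c)
      | .inr (.inl (.inr u)) => .inr u
      | .inr (.inr (.inl a)) => .inl (.inl a)
      | .inr (.inr (.inr d)) => .inr (.inr d)
    refine comp_eq_of_label l ?_ ?_ ?_
    · apply tensor_le
      · rintro x y (rfl | rfl)
        · rfl
        · rcases x with ((x | x) | (x | x)) | (x | x) <;> rfl
      · rintro x y (rfl | rfl)
        · rfl
        · rcases x with x | x <;> rfl
    · rintro x y (rfl | rfl)
      · rfl
      · rcases x with ((x | x) | (x | x)) | (x | x) <;> rfl
    · simp only [ofEquiv_comp_rel]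
      rintro ((((x | x) | (x | x)) | (x | x)) | (x | x))
        ((((y | y) | (y | y)) | (y | y)) | (y | y)) h <;>
      (cases h <;> first | exact .inl rfl | exact .inr rfl)
  rw [h1, h2, ← comp_assoc, ofEquiv_comp_ofEquiv, Equiv.symm_trans_self, id_comp]

theorem caps_swap : (caps α).comp (ofEquiv (Equiv.sumComm α α)) = caps α := by
  symm
  apply ofInvolution_eq
  intro x
  rw [comp_ofEquiv_rel]
  rcases x with x | x | x
  · exact x.elim
  · exact .inr rfl
  · exact .inr rfl

theorem cups_swap :
    (cups α β γ).comp (ofEquiv (Equiv.sumComm α γ)) =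
      (ofEquiv (Equiv.sumComm (α ⊕ β) (β ⊕ γ))).comp
        ((ofEquiv (Equiv.sumCongr (Equiv.sumComm β γ) (Equiv.sumComm α β))).comp
          (cups γ β α)) := by
  rw [← comp_assoc, ofEquiv_comp_ofEquiv]
  apply eq_of_le
  intro x y h
  rw [comp_ofEquiv_rel] at h
  rw [ofEquiv_comp_rel]
  have e : ∀ u v, (cups α β γ).rel u v → (cups γ β α).rel
      (Sum.map ((Equiv.sumComm (α ⊕ β) (β ⊕ γ)).trans
        (Equiv.sumCongr (Equiv.sumComm β γ) (Equiv.sumComm α β))) (Equiv.sumComm α γ) u)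
      (Sum.map ((Equiv.sumComm (α ⊕ β) (β ⊕ γ)).trans
        (Equiv.sumCongr (Equiv.sumComm β γ) (Equiv.sumComm α β))) (Equiv.sumComm α γ) v) := by
    rintro x y (rfl | rfl)
    · exact .inl rfl
    · rcases x with ((x | x) | (x | x)) | (x | x) <;> exact .inr rfl
  have := e _ _ h
  simpa using this

theorem caps_shuffle :
    (ofEquiv (Equiv.sumEmpty Empty Empty).symm).comp
        (((caps α).tensor (caps β)).comp (ofEquiv (Equiv.sumSumSumComm α α β β))) =
      caps (α ⊕ β) := by
  symm
  apply ofInvolution_eq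
  intro x
  rw [ofEquiv_comp_rel, comp_ofEquiv_rel]
  rcases x with x | (x | x) | (x | x)
  · exact x.elim
  · exact tensor_inl (caps_rel x)
  · exact tensor_inr (caps_rel x)
  · exact tensor_inl ((caps α).rel.symm' (caps_rel x))
  · exact tensor_inr ((caps β).rel.symm' (caps_rel x))

theorem cups_shuffle :
    ((cups α β γ).tensor (cups α' β' γ')).comp (ofEquiv (Equiv.sumSumSumComm α γ α' γ')) =
      (ofEquiv ((Equiv.sumSumSumComm (α ⊕ β) (β ⊕ γ) (α' ⊕ β') (β' ⊕ γ')).trans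
        (Equiv.sumCongr (Equiv.sumSumSumComm α β α' β') (Equiv.sumSumSumComm β γ β' γ')))).comp
          (cups (α ⊕ α') (β ⊕ β') (γ ⊕ γ')) := by
  apply eq_of_le
  intro x y h
  rw [comp_ofEquiv_rel] at h
  rw [ofEquiv_comp_rel]
  set E := (Equiv.sumSumSumComm (α ⊕ β) (β ⊕ γ) (α' ⊕ β') (β' ⊕ γ')).trans
        (Equiv.sumCongr (Equiv.sumSumSumComm α β α' β') (Equiv.sumSumSumComm β γ β' γ')) with hE
  have e : ∀ u v, ((cups α β γ).tensor (cups α' β' γ')).rel u v →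
      (cups (α ⊕ α') (β ⊕ β') (γ ⊕ γ')).rel
        (Sum.map E (Equiv.sumSumSumComm α γ α' γ') u)
        (Sum.map E (Equiv.sumSumSumComm α γ α' γ') v) := by
    apply tensor_le
    · rintro x y (rfl | rfl)
      · exact .inl rfl
      · rcases x with ((x | x) | (x | x)) | (x | x) <;> exact .inr rfl
    · rintro x y (rfl | rfl)
      · exact .inl rfl
      · rcases x with ((x | x) | (x | x)) | (x | x) <;> exact .inr rfl
  have := e _ _ h
  rwa [Sum.map_map, Sum.map_map, Equiv.self_comp_symm, Function.comp_id] at this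

end Comp

end Brauerian

/-! ## The category `Br` -/

/-- An object of `Br`: the finite ordinal `card`. -/
structure Br : Type where
  card : ℕ

/-- The category `Br`: its arrows are the Brauerian split equivalences between finite ordinals. -/
noncomputable instance : Category Br where
  Hom n m := Brauerian (Fin n.card) (Fin m.card)
  id n := Brauerian.ofEquiv (Equiv.refl (Fin n.card))
  comp f g := Brauerian.comp f g
  id_comp f := Brauerian.id_comp f
  comp_id f := Brauerian.comp_id f
  assoc f g h := Brauerian.comp_assoc f g h

/-! ## Formulae and arrow terms -/

universe u

/-- Formulae; terms are the elements of the free magma on the set `V` of variables, `p * q` being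
the term written `p · q`. -/
inductive Formula (V : Type u) : Type u
  | top : Formula V
  | eqv (p q : FreeMagma V) : Formula V
  | and (A B : Formula V) : Formula V

infix:60 " ≗ " => Formula.eqv
infixr:55 " ⋏ " => Formula.and

/-- Arrow terms, indexed by their types: `ArrowTerm A B` holds the arrow terms `f : A ⊢ B`. -/
inductive ArrowTerm {V : Type u} : Formula V → Formula V → Type u
  | id (A : Formula V) : ArrowTerm A A
  | bRight (A B C : Formula V) : ArrowTerm (A ⋏ (B ⋏ C)) ((A ⋏ B) ⋏ C)
  | bLeft (A B C : Formula V) : ArrowTerm ((A ⋏ B) ⋏ C) (A ⋏ (B ⋏ C))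
  | deltaRight (A : Formula V) : ArrowTerm (A ⋏ .top) A
  | deltaLeft (A : Formula V) : ArrowTerm A (A ⋏ .top)
  | sigmaRight (A : Formula V) : ArrowTerm (.top ⋏ A) A
  | sigmaLeft (A : Formula V) : ArrowTerm A (.top ⋏ A)
  | c (A B : Formula V) : ArrowTerm (A ⋏ B) (B ⋏ A)
  | r (x : FreeMagma V) : ArrowTerm .top (x ≗ x)
  | t (x y z : FreeMagma V) : ArrowTerm ((x ≗ y) ⋏ (y ≗ z)) (x ≗ z)
  | s (x y : FreeMagma V) : ArrowTerm (x ≗ y) (y ≗ x)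
  | a (x y z w : FreeMagma V) : ArrowTerm ((x ≗ y) ⋏ (z ≗ w)) (x * z ≗ y * w)
  | tensor {A B C D : Formula V} (f : ArrowTerm A B) (g : ArrowTerm C D) :
      ArrowTerm (A ⋏ C) (B ⋏ D)
  | comp {A B C : Formula V} (g : ArrowTerm B C) (f : ArrowTerm A B) : ArrowTerm A C

infixr:75 " ⩕ " => ArrowTerm.tensor
infixr:70 " ∘ₐ " => ArrowTerm.comp

namespace ArrowTerm

/-- The middle-interchange arrow term
`(A ⋏ B) ⋏ (C ⋏ D) ⊢ (A ⋏ C) ⋏ (B ⋏ D)`. -/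
def cm {V : Type u} (A B C D : Formula V) :
    ArrowTerm ((A ⋏ B) ⋏ (C ⋏ D)) ((A ⋏ C) ⋏ (B ⋏ D)) :=
  bRight A C (B ⋏ D) ∘ₐ (id A ⩕ (bLeft C B D ∘ₐ (c B C ⩕ id D) ∘ₐ bRight B C D)) ∘ₐ
    bLeft A B (C ⋏ D)

/-- Equality of arrow terms: the smallest equivalence relation that satisfies the equations of
the category and is preserved by `∘ₐ` and `⩕`. -/
inductive Eqn {V : Type u} : ∀ {A B : Formula V}, ArrowTerm A B → ArrowTerm A B → Prop
  -- equivalence relation and congruence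
  | refl {A B} (f : ArrowTerm A B) : Eqn f f
  | symm {A B} {f g : ArrowTerm A B} (h : Eqn f g) : Eqn g f
  | trans {A B} {f g h : ArrowTerm A B} (h1 : Eqn f g) (h2 : Eqn g h) : Eqn f h
  | tensor_congr {A B C D} {f1 g1 : ArrowTerm A B} {f2 g2 : ArrowTerm C D}
      (h1 : Eqn f1 g1) (h2 : Eqn f2 g2) : Eqn (f1 ⩕ f2) (g1 ⩕ g2)
  | comp_congr {A B C} {f1 g1 : ArrowTerm A B} {f2 g2 : ArrowTerm B C}
      (h1 : Eqn f1 g1) (h2 : Eqn f2 g2) : Eqn (f2 ∘ₐ f1) (g2 ∘ₐ g1)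
  -- categorial equations
  | id_comp {A B} (f : ArrowTerm A B) : Eqn (id B ∘ₐ f) f
  | comp_id {A B} (f : ArrowTerm A B) : Eqn (f ∘ₐ id A) f
  | assoc {A B C D} (f : ArrowTerm A B) (g : ArrowTerm B C) (h : ArrowTerm C D) :
      Eqn ((h ∘ₐ g) ∘ₐ f) (h ∘ₐ (g ∘ₐ f))
  -- bifunctoriality equations
  | tensor_id (A B) : Eqn (id A ⩕ id B) (id (A ⋏ B))
  | tensor_comp {A1 B1 C1 A2 B2 C2} (f1 : ArrowTerm A1 B1) (g1 : ArrowTerm B1 C1)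
      (f2 : ArrowTerm A2 B2) (g2 : ArrowTerm B2 C2) :
      Eqn ((g1 ∘ₐ f1) ⩕ (g2 ∘ₐ f2)) ((g1 ⩕ g2) ∘ₐ (f1 ⩕ f2))
  -- naturality equations
  | b_nat {A B C D E F} (f : ArrowTerm A D) (g : ArrowTerm B E) (h : ArrowTerm C F) :
      Eqn (((f ⩕ g) ⩕ h) ∘ₐ bRight A B C) (bRight D E F ∘ₐ (f ⩕ (g ⩕ h)))
  | delta_nat {A D} (f : ArrowTerm A D) :
      Eqn (f ∘ₐ deltaRight A) (deltaRight D ∘ₐ (f ⩕ id .top))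
  | sigma_nat {A D} (f : ArrowTerm A D) :
      Eqn (f ∘ₐ sigmaRight A) (sigmaRight D ∘ₐ (id .top ⩕ f))
  | c_nat {A B D E} (f : ArrowTerm A D) (g : ArrowTerm B E) :
      Eqn ((g ⩕ f) ∘ₐ c A B) (c D E ∘ₐ (f ⩕ g))
  -- specific equations of symmetric monoidal categories
  | bb_left (A B C) : Eqn (bLeft A B C ∘ₐ bRight A B C) (id (A ⋏ (B ⋏ C)))
  | bb_right (A B C) : Eqn (bRight A B C ∘ₐ bLeft A B C) (id ((A ⋏ B) ⋏ C))
  | b5 (A B C D) :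
      Eqn (bRight (A ⋏ B) C D ∘ₐ bRight A B (C ⋏ D))
        ((bRight A B C ⩕ id D) ∘ₐ bRight A (B ⋏ C) D ∘ₐ (id A ⩕ bRight B C D))
  | dd_left (A) : Eqn (deltaLeft A ∘ₐ deltaRight A) (id (A ⋏ .top))
  | dd_right (A) : Eqn (deltaRight A ∘ₐ deltaLeft A) (id A)
  | ss_left (A) : Eqn (sigmaLeft A ∘ₐ sigmaRight A) (id (.top ⋏ A))
  | ss_right (A) : Eqn (sigmaRight A ∘ₐ sigmaLeft A) (id A)
  | bds (A C) : Eqn (bRight A .top C) ((deltaLeft A ⩕ id C) ∘ₐ (id A ⩕ sigmaRight C))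
  | cc (A B) : Eqn (c B A ∘ₐ c A B) (id (A ⋏ B))
  | bc (A B C) :
      Eqn (c A (B ⋏ C))
        (bRight B C A ∘ₐ (id B ⩕ c A C) ∘ₐ bLeft B A C ∘ₐ (c A B ⩕ id C) ∘ₐ bRight A B C)
  -- reflexivity and transitivity
  | rt_delta (x y) : Eqn (t x y y ∘ₐ (id (x ≗ y) ⩕ r y)) (deltaRight (x ≗ y))
  | rt_sigma (x y) : Eqn (t y y x ∘ₐ (r y ⩕ id (y ≗ x))) (sigmaRight (y ≗ x))
  | tb (x y z u) :
      Eqn (t x y u ∘ₐ (id (x ≗ y) ⩕ t y z u))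
        (t x z u ∘ₐ (t x y z ⩕ id (z ≗ u)) ∘ₐ bRight (x ≗ y) (y ≗ z) (z ≗ u))
  -- symmetry
  | ss (x y) : Eqn (s y x ∘ₐ s x y) (id (x ≗ y))
  | rs (x) : Eqn (s x x ∘ₐ r x) (r x)
  | ts (x y z) :
      Eqn (s x z ∘ₐ t x y z) (t z y x ∘ₐ (s y z ⩕ s x y) ∘ₐ c (x ≗ y) (y ≗ z))
  -- congruence with respect to the binary operation
  | ra (x y) : Eqn (a x x y y ∘ₐ (r x ⩕ r y) ∘ₐ deltaLeft .top) (r (x * y))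
  | ta (x1 y1 z1 x2 y2 z2) :
      Eqn (a x1 z1 x2 z2 ∘ₐ (t x1 y1 z1 ⩕ t x2 y2 z2))
        (t (x1 * x2) (y1 * y2) (z1 * z2) ∘ₐ (a x1 y1 x2 y2 ⩕ a y1 z1 y2 z2) ∘ₐ
          cm (x1 ≗ y1) (y1 ≗ z1) (x2 ≗ y2) (y2 ≗ z2))
  | sa (x1 y1 x2 y2) :
      Eqn (s (x1 * x2) (y1 * y2) ∘ₐ a x1 y1 x2 y2) (a y1 x1 y2 x2 ∘ₐ (s x1 y1 ⩕ s x2 y2))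

instance setoid {V : Type u} (A B : Formula V) : Setoid (ArrowTerm A B) where
  r := Eqn
  iseqv := ⟨Eqn.refl, Eqn.symm, Eqn.trans⟩

end ArrowTerm

/-- The category whose objects are formulae and whose arrows are arrow terms modulo the
equations. -/
def DotSEqv (V : Type u) : Type u := Formula V

instance (V : Type u) : Category (DotSEqv V) where
  Hom A B := Quotient (ArrowTerm.setoid (V := V) A B)
  id A := Quotient.mk _ (ArrowTerm.id (V := V) A)
  comp {A B C} f g := Quotient.map₂ (fun (f : ArrowTerm (V := V) A B) (g : ArrowTerm B C) => g ∘ₐ f)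
    (fun _ _ h1 _ _ h2 => .comp_congr h1 h2) f g
  id_comp := by
    rintro A B ⟨f⟩
    exact Quotient.sound (.comp_id f)
  comp_id := by
    rintro A B ⟨f⟩
    exact Quotient.sound (.id_comp f)
  assoc := by
    rintro A B C D ⟨f⟩ ⟨g⟩ ⟨h⟩
    exact Quotient.sound (.symm (.assoc f g h))

/-! ## The functor `G` -/

/-- Occurrences of variables in a term. -/
def TermOcc {V : Type u} : FreeMagma V → Type
  | .of _ => Unit
  | .mul p q => TermOcc p ⊕ TermOcc q

/-- Occurrences of variables in a formula. -/
def Occ {V : Type u} : Formula V → Type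
  | .top => Empty
  | .eqv p q => TermOcc p ⊕ TermOcc q
  | .and A B => Occ A ⊕ Occ B

/-- The number of occurrences of variables in a formula. -/
def Formula.size {V : Type u} : Formula V → ℕ
  | .top => 0
  | .eqv p q => p.length + q.length
  | .and A B => A.size + B.size

/-- Enumeration from left to right of the occurrences of variables in a term. -/
def termOccEquiv {V : Type u} : ∀ p : FreeMagma V, TermOcc p ≃ Fin p.length
  | .of _ => (Equiv.ofUnique Unit (Fin 1))
  | .mul p q => (Equiv.sumCongr (termOccEquiv p) (termOccEquiv q)).trans finSumFinEquiv

/-- Enumeration from left to right of the occurrences of variables in a formula. -/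
def occEquiv {V : Type u} : ∀ A : Formula V, Occ A ≃ Fin A.size
  | .top => (Equiv.equivOfIsEmpty Empty (Fin 0))
  | .eqv p q => (Equiv.sumCongr (termOccEquiv p) (termOccEquiv q)).trans finSumFinEquiv
  | .and A B => (Equiv.sumCongr (occEquiv A) (occEquiv B)).trans finSumFinEquiv

instance {V : Type u} (p : FreeMagma V) : Finite (TermOcc p) := .of_equiv _ (termOccEquiv p).symm

instance {V : Type u} (A : Formula V) : Finite (Occ A) := .of_equiv _ (occEquiv A).symm

open Brauerian in
/-- The diagram of an arrow term, joining occurrences of variables in its source and target. -/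
noncomputable def diagram {V : Type u} : ∀ {A B : Formula V}, ArrowTerm A B →
    Brauerian (Occ A) (Occ B)
  | _, _, .id A => ofEquiv (Equiv.refl (Occ A))
  | _, _, .bRight A B C => ofEquiv (Equiv.sumAssoc (Occ A) (Occ B) (Occ C)).symm
  | _, _, .bLeft A B C => ofEquiv (Equiv.sumAssoc (Occ A) (Occ B) (Occ C))
  | _, _, .deltaRight A => ofEquiv (Equiv.sumEmpty (Occ A) Empty)
  | _, _, .deltaLeft A => ofEquiv (Equiv.sumEmpty (Occ A) Empty).symm
  | _, _, .sigmaRight A => ofEquiv (Equiv.emptySum Empty (Occ A))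
  | _, _, .sigmaLeft A => ofEquiv (Equiv.emptySum Empty (Occ A)).symm
  | _, _, .c A B => ofEquiv (Equiv.sumComm (Occ A) (Occ B))
  | _, _, .r x => caps (TermOcc x)
  | _, _, .t x y z => cups (TermOcc x) (TermOcc y) (TermOcc z)
  | _, _, .s x y => ofEquiv (Equiv.sumComm (TermOcc x) (TermOcc y))
  | _, _, .a x y z w =>
      ofEquiv (Equiv.sumSumSumComm (TermOcc x) (TermOcc y) (TermOcc z) (TermOcc w))
  | _, _, .tensor f g => Brauerian.tensor (diagram f) (diagram g)
  | _, _, .comp g f => Brauerian.comp (diagram f) (diagram g)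

open Brauerian in
theorem diagram_cm {V : Type u} (A B C D : Formula V) :
    diagram (ArrowTerm.cm A B C D) =
      ofEquiv (Equiv.sumSumSumComm (Occ A) (Occ B) (Occ C) (Occ D)) := by
  change ((ofEquiv (Equiv.sumAssoc (Occ A) (Occ B) (Occ C ⊕ Occ D))).comp
    ((ofEquiv (Equiv.refl (Occ A))).tensor
      (((ofEquiv (Equiv.sumAssoc (Occ B) (Occ C) (Occ D)).symm).comp
        ((ofEquiv (Equiv.sumComm (Occ B) (Occ C))).tensor (ofEquiv (Equiv.refl (Occ D))))).comp
          (ofEquiv (Equiv.sumAssoc (Occ C) (Occ B) (Occ D)))))).comp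
    (ofEquiv (Equiv.sumAssoc (Occ A) (Occ C) (Occ B ⊕ Occ D)).symm) = _
  simp only [ofEquiv_comp_ofEquiv, ofEquiv_tensor_ofEquiv]
  congr 1
  ext x
  rcases x with (x | x) | (x | x) <;> rfl

open Brauerian in
/-- The diagrams respect the equations. -/
theorem diagram_eq {V : Type u} {A B : Formula V} {f g : ArrowTerm A B}
    (h : ArrowTerm.Eqn f g) : diagram f = diagram g := by
  induction h with
  | refl => rfl
  | symm _ ih => exact ih.symm
  | trans _ _ ih1 ih2 => exact ih1.trans ih2
  | tensor_congr _ _ ih1 ih2 => exact congrArg₂ Brauerian.tensor ih1 ih2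
  | comp_congr _ _ ih1 ih2 => simp only [diagram, ih1, ih2]
  | id_comp f => exact Brauerian.comp_id _
  | comp_id f => exact Brauerian.id_comp _
  | assoc f g h => exact (Brauerian.comp_assoc _ _ _).symm
  | tensor_id A B =>
    refine (ofEquiv_tensor_ofEquiv _ _).trans ?_
    exact congrArg ofEquiv (Equiv.sumCongr_refl)
  | tensor_comp f1 g1 f2 g2 => exact tensor_comp_tensor _ _ _ _
  | b_nat f g h => exact assoc_nat _ _ _
  | delta_nat f => exact sumEmpty_nat _
  | sigma_nat f => exact emptySum_nat _
  | c_nat f g => exact swap_nat _ _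
  | bb_left A B C =>
    exact (ofEquiv_comp_ofEquiv _ _).trans (congrArg ofEquiv (Equiv.symm_trans_self _))
  | bb_right A B C =>
    exact (ofEquiv_comp_ofEquiv _ _).trans (congrArg ofEquiv (Equiv.self_trans_symm _))
  | b5 A B C D =>
    simp only [diagram]
    erw [ofEquiv_tensor_ofEquiv, ofEquiv_tensor_ofEquiv, ofEquiv_comp_ofEquiv,
      ofEquiv_comp_ofEquiv, ofEquiv_comp_ofEquiv]
    congr 1
    ext x
    rcases x with x | x | x | x <;> rfl
  | dd_left A =>
    exact (ofEquiv_comp_ofEquiv _ _).trans (congrArg ofEquiv (Equiv.self_trans_symm _))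
  | dd_right A =>
    exact (ofEquiv_comp_ofEquiv _ _).trans (congrArg ofEquiv (Equiv.symm_trans_self _))
  | ss_left A =>
    exact (ofEquiv_comp_ofEquiv _ _).trans (congrArg ofEquiv (Equiv.self_trans_symm _))
  | ss_right A =>
    exact (ofEquiv_comp_ofEquiv _ _).trans (congrArg ofEquiv (Equiv.symm_trans_self _))
  | bds A C =>
    simp only [diagram]
    erw [ofEquiv_tensor_ofEquiv, ofEquiv_tensor_ofEquiv, ofEquiv_comp_ofEquiv]
    congr 1
    ext x
    rcases x with x | x | x
    · rfl
    · exact x.elim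
    · rfl
  | cc A B =>
    refine (ofEquiv_comp_ofEquiv _ _).trans (congrArg ofEquiv ?_)
    ext x
    rcases x with x | x <;> rfl
  | bc A B C =>
    simp only [diagram]
    erw [ofEquiv_tensor_ofEquiv, ofEquiv_tensor_ofEquiv, ofEquiv_comp_ofEquiv,
      ofEquiv_comp_ofEquiv, ofEquiv_comp_ofEquiv, ofEquiv_comp_ofEquiv]
    congr 1
    ext x
    rcases x with x | x | x <;> rfl
  | rt_delta x y => exact caps_cups_right
  | rt_sigma x y => exact caps_cups_left
  | tb x y z u =>
    refine (cups_cups (α := TermOcc x) (β := TermOcc y) (γ := TermOcc z)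
      (δ := TermOcc u)).trans ?_
    exact (Brauerian.comp_assoc _ _ _).symm
  | ss x y =>
    refine (ofEquiv_comp_ofEquiv _ _).trans (congrArg ofEquiv ?_)
    ext x
    rcases x with x | x <;> rfl
  | rs x => exact caps_swap
  | ts x y z =>
    refine (cups_swap (α := TermOcc x) (β := TermOcc y) (γ := TermOcc z)).trans ?_
    rw [← ofEquiv_tensor_ofEquiv]
    exact (Brauerian.comp_assoc _ _ _).symm
  | ra x y =>
    refine Eq.trans ?_ (caps_shuffle (α := TermOcc x) (β := TermOcc y))
    exact Brauerian.comp_assoc _ _ _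
  | ta x1 y1 z1 x2 y2 z2 =>
    refine (cups_shuffle (α := TermOcc x1) (β := TermOcc y1) (γ := TermOcc z1)
      (α' := TermOcc x2) (β' := TermOcc y2) (γ' := TermOcc z2)).trans ?_
    rw [← ofEquiv_comp_ofEquiv, ← ofEquiv_tensor_ofEquiv]
    have := diagram_cm (x1 ≗ y1) (y1 ≗ z1) (x2 ≗ y2) (y2 ≗ z2)
    simp only [diagram] at this ⊢
    rw [this]
    rfl
  | sa x1 y1 x2 y2 =>
    simp only [diagram]
    erw [ofEquiv_tensor_ofEquiv, ofEquiv_comp_ofEquiv, ofEquiv_comp_ofEquiv]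
    congr 1
    ext x
    rcases x with (x | x) | (x | x) <;> rfl

/-- The arrow of `Br` that corresponds to the diagram of an arrow term, the occurrences of
variables being numbered from left to right. -/
noncomputable def ordinalDiagram {V : Type u} {A B : Formula V} (f : ArrowTerm A B) :
    Brauerian (Fin A.size) (Fin B.size) :=
  (diagram f).reindex (occEquiv A) (occEquiv B)

theorem ordinalDiagram_eq {V : Type u} {A B : Formula V} (f g : ArrowTerm A B)
    (h : ArrowTerm.Eqn f g) : ordinalDiagram f = ordinalDiagram g :=
  congrArg (Brauerian.reindex (occEquiv A) (occEquiv B)) (diagram_eq h)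

theorem ordinalDiagram_id {V : Type u} (A : Formula V) :
    ordinalDiagram (ArrowTerm.id A) = Brauerian.ofEquiv (Equiv.refl (Fin A.size)) :=
  Brauerian.reindex_id (occEquiv A)

theorem ordinalDiagram_comp {V : Type u} {A B C : Formula V} (f : ArrowTerm A B)
    (g : ArrowTerm B C) :
    ordinalDiagram (g ∘ₐ f) = (ordinalDiagram f).comp (ordinalDiagram g) :=
  Brauerian.reindex_comp (occEquiv A) (occEquiv B) (occEquiv C) (diagram f) (diagram g)

/-- The functor `G`: a formula is sent to the number of occurrences of variables in it, and an
arrow to its diagram. -/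
noncomputable def G (V : Type u) : DotSEqv V ⥤ Br where
  obj A := ⟨Formula.size (V := V) A⟩
  map f := Quotient.lift ordinalDiagram ordinalDiagram_eq f
  map_id A := ordinalDiagram_id (V := V) A
  map_comp := by
    rintro A B C ⟨f⟩ ⟨g⟩
    exact ordinalDiagram_comp f g

end LinearEquality

/-! The proof reduces to a linear situation by relabelling. Given `f : A ⊢ B`, label each occurrence
of a variable in `A` and `B` by its class in the diagram of `f`, and replace a variable `v` by the
pair (label, `v`). Joined occurrences carry equal labels, so `f` lifts to an arrow term between the
relabelled formulae and is recovered from it by the substitution `Prod.snd` (`exists_lift`). Classes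
have two elements, so every new variable occurs at most twice in source and target together
(`count_relabel_le`). If `g` has the same diagram, it lifts to the same relabelled source and
target. Substitution preserves equality of arrow terms, so it suffices that between such linear
formulae there is at most one arrow (`hom_subsingleton`).

That uniqueness comes from a normal form. Read backwards, an equation `u ≗ v` in the source rewrites
one occurrence of `u`, in the left side of some equation of the target, into `v`; symmetry allows
both directions of use. Every arrow consumes the equations of its source one by one in this way,
until the source contains only `⊤` and every equation of the target is reflexive (`normal`).
Existence is a form of cut elimination: the arrows that split into chains of rewriting steps along
the target are closed under composition with every arrow term (`Decomp.comp_toHom`).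

The normal form is unique under linearity because of an exchange argument (`Normal.peel`): if some
equation of the source can be used for some rewriting step of the target, then every arrow can be
rearranged to begin with that step. Compare it with the first step in a normal form of the arrow. If
both use the same equation, linearity forces the same direction and the same place. Otherwise the
two rewritten occurrences are disjoint and the steps commute (`Ins.diamond`, `FStep.diamond`). The
essential case of commutation, steps in the two factors of a product of terms, is an Eckmann–Hilton
argument from the equation relating `t` and `a` (`mulL_mulR`, `mulR_mulL`). -/

namespace LinearEquality

open MonoidalCategory BraidedCategory

/-! ### Actions on one factor of a tensor product. -/

section Symmetric

universe w v

variable {C : Type w} [Category.{v} C] [MonoidalCategory C]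

/-- An action of `X` on the left factor of `A ⊗ B`. -/
def actL {X A' A : C} (f : X ⊗ A' ⟶ A) (B : C) : X ⊗ (A' ⊗ B) ⟶ A ⊗ B :=
  (α_ X A' B).inv ≫ f ▷ B

/-- This and the similar statements below about `actL` and `actR` pull a structural arrow back
through an action on one factor. They supply the cases of `Ins.transport`. -/
theorem actL_assoc {X A' A : C} (f : X ⊗ A' ⟶ A) (B D : C) :
    actL (actL f B) D ≫ (α_ A B D).hom = X ◁ (α_ A' B D).hom ≫ actL f (B ⊗ D) := by
  simp [actL]

theorem actL_rightUnitor {X A' A : C} (f : X ⊗ A' ⟶ A) :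
    actL f (𝟙_ C) ≫ (ρ_ A).hom = X ◁ (ρ_ A').hom ≫ f := by
  simp [actL]

theorem actL_tensor {X A' A B D' D : C} (f : X ⊗ A' ⟶ A) (g : X ⊗ D' ⟶ D) (h : A ⟶ D)
    (h' : A' ⟶ D') (H : f ≫ h = X ◁ h' ≫ g) {E : C} (k : B ⟶ E) :
    actL f B ≫ (h ⊗ₘ k) = X ◁ (h' ⊗ₘ k) ≫ actL g E := by
  rw [actL, actL, Category.assoc, MonoidalCategory.tensorHom_def, ← comp_whiskerRight_assoc, H]
  simp only [comp_whiskerRight, Category.assoc, MonoidalCategory.tensorHom_def, whiskerLeft_comp]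
  rw [← whisker_exchange]
  simp

variable [SymmetricCategory C]

/-- Exchange of the first two factors. -/
def exch (X Y A : C) : X ⊗ (Y ⊗ A) ⟶ Y ⊗ (X ⊗ A) :=
  (α_ X Y A).inv ≫ (β_ X Y).hom ▷ A ≫ (α_ Y X A).hom

/-- An action of `X` on the right factor of `B ⊗ A`. -/
def actR {X A' A : C} (f : X ⊗ A' ⟶ A) (B : C) : X ⊗ (B ⊗ A') ⟶ B ⊗ A :=
  exch X B A' ≫ B ◁ f

theorem braiding_braiding_whiskerRight (X Y A : C) {Z : C} (f : (X ⊗ Y) ⊗ A ⟶ Z) :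
    (β_ X Y).hom ▷ A ≫ (β_ Y X).hom ▷ A ≫ f = f := by
  rw [← comp_whiskerRight_assoc, SymmetricCategory.symmetry, id_whiskerRight, Category.id_comp]

theorem braiding_braiding_whiskerRight₂ (X Y A B : C) {Z : C} (f : ((X ⊗ Y) ⊗ A) ⊗ B ⟶ Z) :
    (β_ X Y).hom ▷ A ▷ B ≫ (β_ Y X).hom ▷ A ▷ B ≫ f = f := by
  rw [← comp_whiskerRight_assoc, ← comp_whiskerRight, SymmetricCategory.symmetry,
    id_whiskerRight, id_whiskerRight, Category.id_comp]

theorem exch_exch (X Y A : C) : exch X Y A ≫ exch Y X A = 𝟙 _ := by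
  simp [exch, braiding_braiding_whiskerRight]

theorem exch_nat {X X' Y Y' A A' : C} (f : X ⟶ X') (g : Y ⟶ Y') (h : A ⟶ A') :
    (f ⊗ₘ (g ⊗ₘ h)) ≫ exch X' Y' A' = exch X Y A ≫ (g ⊗ₘ (f ⊗ₘ h)) := by
  simp only [exch, Category.assoc, associator_inv_naturality_assoc]
  rw [← associator_naturality, ← tensorHom_id, ← tensorHom_id,
    tensorHom_comp_tensorHom_assoc, tensorHom_comp_tensorHom_assoc]
  simp

/-- Two actions on `A` that commute with each other. -/
def Comm {X Y A A1 A2 A3 : C} (f : X ⊗ A1 ⟶ A) (g : Y ⊗ A2 ⟶ A) (f' : X ⊗ A3 ⟶ A2)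
    (g' : Y ⊗ A3 ⟶ A1) : Prop :=
  X ◁ g' ≫ f = exch X Y A3 ≫ Y ◁ f' ≫ g

theorem Comm.symm {X Y A A1 A2 A3 : C} {f : X ⊗ A1 ⟶ A} {g : Y ⊗ A2 ⟶ A} {f' : X ⊗ A3 ⟶ A2}
    {g' : Y ⊗ A3 ⟶ A1} (h : Comm f g f' g') : Comm g f g' f' := by
  unfold Comm at *
  rw [h, ← Category.assoc (exch _ _ _), exch_exch, Category.id_comp]

/-- Naturality of the exchange. In `Normal.peel` the arrows `e` and `e'` are the orientations of the
two equations being consumed. -/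
theorem Comm.precomp {X Y A A1 A2 A3 X' Y' : C} {f : X ⊗ A1 ⟶ A} {g : Y ⊗ A2 ⟶ A}
    {f' : X ⊗ A3 ⟶ A2} {g' : Y ⊗ A3 ⟶ A1} (h : Comm f g f' g') (e : X' ⟶ X) (e' : Y' ⟶ Y) :
    Comm (e ▷ A1 ≫ f) (e' ▷ A2 ≫ g) (e ▷ A3 ≫ f') (e' ▷ A3 ≫ g') := by
  unfold Comm at *
  have key : ∀ {X Y X' Y' A1 : C} (g' : Y ⊗ A3 ⟶ A1) (f : X ⊗ A1 ⟶ A) (e : X' ⟶ X)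
      (e' : Y' ⟶ Y), X' ◁ (e' ▷ A3 ≫ g') ≫ e ▷ A1 ≫ f = (e ⊗ₘ (e' ⊗ₘ 𝟙 A3)) ≫ X ◁ g' ≫ f := by
    intro X Y X' Y' A1 g' f e e'
    rw [MonoidalCategory.tensorHom_def', tensorHom_id, whiskerLeft_comp, Category.assoc,
      Category.assoc, whisker_exchange_assoc]
  rw [key, key, h, ← Category.assoc, exch_nat, Category.assoc]

theorem Comm.left {X Y A A1 A2 A3 : C} {f : X ⊗ A1 ⟶ A} {g : Y ⊗ A2 ⟶ A}
    {f' : X ⊗ A3 ⟶ A2} {g' : Y ⊗ A3 ⟶ A1} (h : Comm f g f' g') (B : C) :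
    Comm (actL f B) (actL g B) (actL f' B) (actL g' B) := by
  unfold Comm at *
  have key : ∀ {X Y A A1 A3 : C} (f : X ⊗ A1 ⟶ A) (g' : Y ⊗ A3 ⟶ A1),
      X ◁ actL g' B ≫ actL f B =
        X ◁ (α_ Y A3 B).inv ≫ (α_ X (Y ⊗ A3) B).inv ≫ (X ◁ g' ≫ f) ▷ B := by
    intros; simp [actL]
  rw [key, key, h]
  simp [exch]

/-- Each side moves both `X` and `Y` past `B` before acting on the other factor. The two ways of
doing so, one followed by the exchange of `X` and `Y`, agree by the Yang–Baxter equation. -/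
theorem Comm.right {X Y A A1 A2 A3 : C} {f : X ⊗ A1 ⟶ A} {g : Y ⊗ A2 ⟶ A}
    {f' : X ⊗ A3 ⟶ A2} {g' : Y ⊗ A3 ⟶ A1} (h : Comm f g f' g') (B : C) :
    Comm (actR f B) (actR g B) (actR f' B) (actR g' B) := by
  unfold Comm at *
  have key : ∀ {X Y A A1 A3 : C} (f : X ⊗ A1 ⟶ A) (g' : Y ⊗ A3 ⟶ A1),
      X ◁ actR g' B ≫ actR f B =
        (X ◁ exch Y B A3 ≫ exch X B (Y ⊗ A3)) ≫ B ◁ (X ◁ g' ≫ f) := by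
    intro X Y A A1 A3 f g'
    have := exch_nat (𝟙 X) (𝟙 B) g'
    simp only [id_tensorHom] at this
    simp [actR, reassoc_of% this]
  rw [key, key, h, whiskerLeft_comp, ← Category.assoc, ← Category.assoc, ← Category.assoc]
  congr 1
  -- The Yang–Baxter equation for `X`, `Y`, `B`, whiskered by `A3` and surrounded by the associators
  -- that turn it into a statement about `exch`.
  have yb := congrArg (fun k => (X ◁ Y ◁ (𝟙 (B ⊗ A3)) ≫ (α_ X Y (B ⊗ A3)).inv ≫
    (α_ (X ⊗ Y) B A3).inv ≫ (α_ X Y B).hom ▷ A3) ≫ k ▷ A3 ≫ (α_ B (Y ⊗ X) A3).hom ≫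
      B ◁ (α_ Y X A3).hom) (yang_baxter X Y B)
  simp only [comp_whiskerRight, whisker_assoc] at yb
  simp [exch] at yb ⊢
  exact yb.symm

/-- Actions on different factors commute without any assumption: naturality of the exchange moves
one past the other, and the braidings left over cancel because the braiding is symmetric. -/
theorem Comm.left_right {X Y A A' B B' : C} (f : X ⊗ A' ⟶ A) (g : Y ⊗ B' ⟶ B) :
    Comm (actL f B) (actR g A) (actL f B') (actR g A') := by
  unfold Comm
  have := exch_nat (𝟙 Y) f (𝟙 B')
  simp only [id_tensorHom, tensorHom_id] at this
  simp only [actL, actR, whiskerLeft_comp, Category.assoc, reassoc_of% this]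
  rw [id_whiskerRight, tensorHom_id, ← whisker_exchange]
  simp [exch, braiding_braiding_whiskerRight₂]

theorem actL_actR_assoc {X A' A : C} (f : X ⊗ A' ⟶ A) (B D : C) :
    actL (actR f B) D ≫ (α_ B A D).hom = X ◁ (α_ B A' D).hom ≫ actR (actL f D) B := by
  simp [actL, actR, exch]

theorem actR_assoc {X A' A : C} (f : X ⊗ A' ⟶ A) (B D : C) :
    actR f (B ⊗ D) ≫ (α_ B D A).hom = X ◁ (α_ B D A').hom ≫ actR (actR f D) B := by
  simp [actR, exch]

theorem actL_braid {X A' A : C} (f : X ⊗ A' ⟶ A) (B : C) :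
    actL f B ≫ (β_ A B).hom = X ◁ (β_ A' B).hom ≫ actR f B := by
  simp [actL, actR, exch]

theorem actR_braid {X A' A : C} (f : X ⊗ A' ⟶ A) (B : C) :
    actR f B ≫ (β_ B A).hom = X ◁ (β_ B A').hom ≫ actL f B := by
  simp [actL, actR, exch, braiding_braiding_whiskerRight]

theorem actR_leftUnitor {X A' A : C} (f : X ⊗ A' ⟶ A) :
    actR f (𝟙_ C) ≫ (λ_ A).hom = X ◁ (λ_ A').hom ≫ f := by
  simp [actR, exch]

theorem actR_tensor {X A' A B D' D : C} (f : X ⊗ A' ⟶ A) (g : X ⊗ D' ⟶ D) (h : A ⟶ D)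
    (h' : A' ⟶ D') (H : f ≫ h = X ◁ h' ≫ g) {E : C} (k : B ⟶ E) :
    actR f B ≫ (k ⊗ₘ h) = X ◁ (k ⊗ₘ h') ≫ actR g E := by
  have := exch_nat (𝟙 X) k h'
  simp only [id_tensorHom] at this
  rw [actR, actR, Category.assoc, reassoc_of% this, MonoidalCategory.tensorHom_def',
    ← whiskerLeft_comp_assoc, H]
  simp [MonoidalCategory.tensorHom_def', whisker_exchange]

end Symmetric

end LinearEquality

namespace LinearEquality

open MonoidalCategory BraidedCategory

universe u

/-! ### The term category as a symmetric monoidal category. -/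

section Instances

variable {V : Type u}

/-- The arrow given by an arrow term. -/
def ArrowTerm.toHom {A B : Formula V} (f : ArrowTerm A B) :
    @Quiver.Hom (DotSEqv V) _ A B :=
  Quotient.mk (ArrowTerm.setoid A B) f

theorem toHom_eq {A B : Formula V} {f g : ArrowTerm A B} (h : ArrowTerm.Eqn f g) :
    f.toHom = g.toHom :=
  Quotient.sound h

instance : MonoidalCategoryStruct (DotSEqv V) where
  tensorObj A B := Formula.and (V := V) A B
  whiskerLeft A {_ _} f := Quotient.map (fun g => ArrowTerm.tensor (ArrowTerm.id (V := V) A) g)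
    (fun _ _ h => .tensor_congr (.refl _) h) f
  whiskerRight {_ _} f B := Quotient.map (fun g => ArrowTerm.tensor g (ArrowTerm.id (V := V) B))
    (fun _ _ h => .tensor_congr h (.refl _)) f
  tensorHom f g := Quotient.map₂ (fun f g => ArrowTerm.tensor (V := V) f g)
    (fun _ _ h1 _ _ h2 => .tensor_congr h1 h2) f g
  tensorUnit := Formula.top (V := V)
  associator A B D :=
    { hom := (ArrowTerm.bLeft (V := V) A B D).toHom
      inv := (ArrowTerm.bRight (V := V) A B D).toHom
      hom_inv_id := toHom_eq (.bb_right A B D)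
      inv_hom_id := toHom_eq (.bb_left A B D) }
  leftUnitor A :=
    { hom := (ArrowTerm.sigmaRight (V := V) A).toHom
      inv := (ArrowTerm.sigmaLeft (V := V) A).toHom
      hom_inv_id := toHom_eq (.ss_left A)
      inv_hom_id := toHom_eq (.ss_right A) }
  rightUnitor A :=
    { hom := (ArrowTerm.deltaRight (V := V) A).toHom
      inv := (ArrowTerm.deltaLeft (V := V) A).toHom
      hom_inv_id := toHom_eq (.dd_left A)
      inv_hom_id := toHom_eq (.dd_right A) }

theorem tensorHom_comp_aux {A1 B1 C1 A2 B2 C2 : DotSEqv V} (f1 : A1 ⟶ B1) (f2 : A2 ⟶ B2)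
    (g1 : B1 ⟶ C1) (g2 : B2 ⟶ C2) :
    (f1 ⊗ₘ f2) ≫ (g1 ⊗ₘ g2) = (f1 ≫ g1) ⊗ₘ (f2 ≫ g2) := by
  induction f1 using Quotient.inductionOn
  induction f2 using Quotient.inductionOn
  induction g1 using Quotient.inductionOn
  induction g2 using Quotient.inductionOn
  exact Quotient.sound (.symm (.tensor_comp _ _ _ _))

theorem associator_inv_nat_aux {A B D A' B' D' : DotSEqv V} (f : A ⟶ A') (g : B ⟶ B')
    (h : D ⟶ D') : (α_ A B D).inv ≫ ((f ⊗ₘ g) ⊗ₘ h) = (f ⊗ₘ (g ⊗ₘ h)) ≫ (α_ A' B' D').inv := by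
  induction f using Quotient.inductionOn
  induction g using Quotient.inductionOn
  induction h using Quotient.inductionOn
  exact Quotient.sound (.b_nat _ _ _)

theorem whiskerLeft_comp_aux (A : DotSEqv V) {B D E : DotSEqv V} (f : B ⟶ D) (g : D ⟶ E) :
    A ◁ f ≫ A ◁ g = A ◁ (f ≫ g) := by
  induction f using Quotient.inductionOn
  induction g using Quotient.inductionOn
  exact Quotient.sound
    (.trans (.symm (.tensor_comp _ _ _ _)) (.tensor_congr (.id_comp _) (.refl _)))

theorem whiskerRight_comp_aux {B D E : DotSEqv V} (f : B ⟶ D) (g : D ⟶ E) (A : DotSEqv V) :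
    f ▷ A ≫ g ▷ A = (f ≫ g) ▷ A := by
  induction f using Quotient.inductionOn
  induction g using Quotient.inductionOn
  exact Quotient.sound
    (.trans (.symm (.tensor_comp _ _ _ _)) (.tensor_congr (.refl _) (.id_comp _)))

theorem whiskerLeft_id_aux (A B : DotSEqv V) : A ◁ 𝟙 B = 𝟙 (A ⊗ B) :=
  Quotient.sound (.tensor_id _ _)

theorem id_whiskerRight_aux (A B : DotSEqv V) : 𝟙 A ▷ B = 𝟙 (A ⊗ B) :=
  Quotient.sound (.tensor_id _ _)

/-- The equation `b5` is the pentagon for the inverse associators, so the usual form is reached by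
cancelling inverses. This precedes the monoidal instance, hence the separate auxiliary laws for
whiskering. -/
theorem pentagon_aux (A B D E : DotSEqv V) :
    (α_ A B D).hom ▷ E ≫ (α_ A (B ⊗ D) E).hom ≫ A ◁ (α_ B D E).hom =
      (α_ (A ⊗ B) D E).hom ≫ (α_ A B (D ⊗ E)).hom := by
  have h : (α_ A B (D ⊗ E)).inv ≫ (α_ (A ⊗ B) D E).inv =
      (A ◁ (α_ B D E).inv ≫ (α_ A (B ⊗ D) E).inv) ≫ (α_ A B D).inv ▷ E :=
    toHom_eq (.b5 (V := V) A B D E)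
  rw [← Category.comp_id ((α_ A B D).hom ▷ E ≫ _ ≫ _)]
  have h1 : 𝟙 _ = ((α_ A B (D ⊗ E)).inv ≫ (α_ (A ⊗ B) D E).inv) ≫
      (α_ (A ⊗ B) D E).hom ≫ (α_ A B (D ⊗ E)).hom := by simp
  rw [h1, h]
  simp only [Category.assoc]
  slice_lhs 3 4 => rw [whiskerLeft_comp_aux, Iso.hom_inv_id, whiskerLeft_id_aux]
  slice_lhs 2 4 => rw [Category.id_comp, Iso.hom_inv_id]
  rw [Category.id_comp]
  slice_lhs 1 2 => rw [whiskerRight_comp_aux, Iso.hom_inv_id, id_whiskerRight_aux]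
  simp

theorem triangle_aux (A B : DotSEqv V) :
    (α_ A (𝟙_ (DotSEqv V)) B).hom ≫ A ◁ (λ_ B).hom = (ρ_ A).hom ▷ B := by
  have h : (α_ A (𝟙_ (DotSEqv V)) B).inv = A ◁ (λ_ B).hom ≫ (ρ_ A).inv ▷ B :=
    toHom_eq (.bds (V := V) A B)
  rw [← Iso.eq_inv_comp, h, Category.assoc, whiskerRight_comp_aux, Iso.inv_hom_id,
    id_whiskerRight_aux, Category.comp_id]

instance : MonoidalCategory (DotSEqv V) where
  tensorHom_def f g := by
    induction f using Quotient.inductionOn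
    induction g using Quotient.inductionOn
    refine Quotient.sound (.trans ?_ (.tensor_comp _ _ _ _))
    exact .tensor_congr (.symm (.id_comp _)) (.symm (.comp_id _))
  id_tensorHom_id A B := Quotient.sound (.tensor_id _ _)
  tensorHom_comp_tensorHom := tensorHom_comp_aux
  whiskerLeft_id A B := Quotient.sound (.tensor_id _ _)
  id_whiskerRight A B := Quotient.sound (.tensor_id _ _)
  associator_naturality f g h := by
    rw [← Iso.inv_comp_eq, ← Category.assoc, associator_inv_nat_aux, Category.assoc,
      Iso.inv_hom_id, Category.comp_id]
  leftUnitor_naturality f := by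
    induction f using Quotient.inductionOn
    exact Quotient.sound (.symm (.sigma_nat _))
  rightUnitor_naturality f := by
    induction f using Quotient.inductionOn
    exact Quotient.sound (.symm (.delta_nat _))
  pentagon := pentagon_aux
  triangle := triangle_aux

/-- The arrow of the exchange `c`. -/
def braid (A B : DotSEqv V) : A ⊗ B ⟶ B ⊗ A := (ArrowTerm.c (V := V) A B).toHom

theorem braid_braid (A B : DotSEqv V) : braid A B ≫ braid B A = 𝟙 (A ⊗ B) :=
  toHom_eq (.cc (V := V) A B)

theorem braid_tensor (A B D : DotSEqv V) :
    braid A (B ⊗ D) =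
      (α_ A B D).inv ≫ braid A B ▷ D ≫ (α_ B A D).hom ≫ B ◁ braid A D ≫ (α_ B D A).inv := by
  have h : braid A (B ⊗ D) =
      ((((α_ A B D).inv ≫ braid A B ▷ D) ≫ (α_ B A D).hom) ≫ B ◁ braid A D) ≫ (α_ B D A).inv :=
    toHom_eq (.bc (V := V) A B D)
  simpa only [Category.assoc] using h

/-- Only one hexagon is postulated. The other follows because its right side, composed with `braid D
(A ⊗ B)` as expanded by the first hexagon, collapses to the identity. -/
theorem tensor_braid (A B D : DotSEqv V) :
    braid (A ⊗ B) D =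
      (α_ A B D).hom ≫ A ◁ braid B D ≫ (α_ A D B).inv ≫ braid A D ▷ B ≫ (α_ D A B).hom := by
  have h : ((α_ A B D).hom ≫ A ◁ braid B D ≫ (α_ A D B).inv ≫ braid A D ▷ B ≫
      (α_ D A B).hom) ≫ braid D (A ⊗ B) = 𝟙 _ := by
    rw [braid_tensor]
    simp only [Category.assoc, Iso.hom_inv_id_assoc]
    rw [← comp_whiskerRight_assoc, braid_braid]
    simp only [id_whiskerRight, Category.id_comp, Iso.inv_hom_id_assoc]
    rw [← whiskerLeft_comp_assoc, braid_braid]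
    simp
  rw [← Category.comp_id (braid (A ⊗ B) D), ← Category.id_comp (braid (A ⊗ B) D), ← h]
  simp only [Category.assoc, braid_braid, Category.comp_id]

instance : BraidedCategory (DotSEqv V) where
  braiding A B :=
    { hom := (ArrowTerm.c (V := V) A B).toHom
      inv := (ArrowTerm.c (V := V) B A).toHom
      hom_inv_id := toHom_eq (.cc A B)
      inv_hom_id := toHom_eq (.cc B A) }
  braiding_naturality_right A B D f := by
    induction f using Quotient.inductionOn
    exact Quotient.sound (.symm (.c_nat _ _))
  braiding_naturality_left f D := by
    induction f using Quotient.inductionOn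
    exact Quotient.sound (.symm (.c_nat _ _))
  hexagon_forward A B D := by
    change (α_ A B D).hom ≫ braid A (B ⊗ D) ≫ _ = braid A B ▷ D ≫ _ ≫ B ◁ braid A D
    rw [braid_tensor]
    simp
  hexagon_reverse A B D := by
    change (α_ A B D).inv ≫ braid (A ⊗ B) D ≫ _ = A ◁ braid B D ≫ _ ≫ braid A D ▷ B
    rw [tensor_braid]
    simp

instance : SymmetricCategory (DotSEqv V) where
  symmetry A B := toHom_eq (.cc A B)

end Instances

end LinearEquality

namespace LinearEquality

open MonoidalCategory BraidedCategory

universe u w v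

/-! ### The middle interchange when two of its factors are units. -/

section Units

variable {C : Type w} [Category.{v} C] [MonoidalCategory C] [SymmetricCategory C]

/-- The two factors that are exchanged are both the unit, so nothing happens. -/
theorem tensorμ_unit_inner (A B : C) :
    ((ρ_ A).inv ⊗ₘ (λ_ B).inv) ≫ tensorμ A (𝟙_ C) (𝟙_ C) B = (ρ_ A).inv ⊗ₘ (λ_ B).inv := by
  simp only [tensorμ, braiding_tensorUnit_left]
  monoidal

/-- Here the exchanged factors are `A` and `B` themselves, so the interchange becomes the braiding.
The contrast with `tensorμ_unit_inner` drives the Eckmann–Hilton argument for `mulL` and `mulR`. -/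
theorem tensorμ_unit_outer (A B : C) :
    ((λ_ A).inv ⊗ₘ (ρ_ B).inv) ≫ tensorμ (𝟙_ C) A B (𝟙_ C) =
      (β_ A B).hom ≫ ((λ_ B).inv ⊗ₘ (ρ_ A).inv) := by
  simp only [tensorμ]
  monoidal

theorem tensorμ_unit_right (A B : C) :
    (ρ_ (A ⊗ B)).inv ≫ (A ⊗ B) ◁ (λ_ (𝟙_ C)).inv ≫ tensorμ A B (𝟙_ C) (𝟙_ C) =
      (ρ_ A).inv ⊗ₘ (ρ_ B).inv := by
  rw [Iso.inv_comp_eq, tensor_right_unitality]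
  simp

theorem tensorμ_unit_left (A B : C) :
    (λ_ (A ⊗ B)).inv ≫ (λ_ (𝟙_ C)).inv ▷ (A ⊗ B) ≫ tensorμ (𝟙_ C) (𝟙_ C) A B =
      (λ_ A).inv ⊗ₘ (λ_ B).inv := by
  rw [Iso.inv_comp_eq, tensor_left_unitality]
  simp

end Units

/-! ### The calculus of concatenation, inversion and multiplication of equality proofs. -/

section EqualityArrows

variable {V : Type u} {A B D E : DotSEqv V} {x y z w x' y' : FreeMagma V}

/-- Equations as objects. -/
abbrev eqn (x y : FreeMagma V) : DotSEqv V := Formula.eqv x y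

/-- The arrow of reflexivity. -/
def reflHom (x : FreeMagma V) : 𝟙_ (DotSEqv V) ⟶ eqn x x := (ArrowTerm.r x).toHom

/-- The arrow of symmetry. -/
def symmHom (x y : FreeMagma V) : eqn x y ⟶ eqn y x := (ArrowTerm.s x y).toHom

/-- The arrow of transitivity. -/
def transHom (x y z : FreeMagma V) : eqn x y ⊗ eqn y z ⟶ eqn x z := (ArrowTerm.t x y z).toHom

/-- The arrow of congruence. -/
def congrHom (x y z w : FreeMagma V) : eqn x y ⊗ eqn z w ⟶ eqn (x * z) (y * w) :=
  (ArrowTerm.a x y z w).toHom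

/-- Concatenation of generalized elements of equations. -/
def cat (f : A ⟶ eqn x y) (g : B ⟶ eqn y z) : A ⊗ B ⟶ eqn x z := (f ⊗ₘ g) ≫ transHom x y z

/-- Multiplication of generalized elements of equations. -/
def mul (f : A ⟶ eqn x y) (g : B ⟶ eqn z w) : A ⊗ B ⟶ eqn (x * z) (y * w) :=
  (f ⊗ₘ g) ≫ congrHom x y z w

/-- Multiplication by a reflexive equation on the right. -/
def mulL (f : A ⟶ eqn x y) (z : FreeMagma V) : A ⟶ eqn (x * z) (y * z) :=
  (ρ_ A).inv ≫ mul f (reflHom z)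

/-- Multiplication by a reflexive equation on the left. -/
def mulR (z : FreeMagma V) (f : A ⟶ eqn x y) : A ⟶ eqn (z * x) (z * y) :=
  (λ_ A).inv ≫ mul (reflHom z) f

theorem cat_precomp (σ : D ⟶ A) (τ : E ⟶ B) (f : A ⟶ eqn x y) (g : B ⟶ eqn y z) :
    cat (σ ≫ f) (τ ≫ g) = (σ ⊗ₘ τ) ≫ cat f g := by
  rw [cat, cat, ← Category.assoc, tensorHom_comp_tensorHom]

theorem mul_precomp (σ : D ⟶ A) (τ : E ⟶ B) (f : A ⟶ eqn x y) (g : B ⟶ eqn z w) :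
    mul (σ ≫ f) (τ ≫ g) = (σ ⊗ₘ τ) ≫ mul f g := by
  rw [mul, mul, ← Category.assoc, tensorHom_comp_tensorHom]

theorem mulL_precomp (σ : D ⟶ A) (f : A ⟶ eqn x y) (z : FreeMagma V) :
    mulL (σ ≫ f) z = σ ≫ mulL f z := by
  have := mul_precomp σ (𝟙 _) f (reflHom z)
  rw [Category.id_comp, tensorHom_id] at this
  rw [mulL, mulL, this, rightUnitor_inv_naturality_assoc]

theorem mulR_precomp (σ : D ⟶ A) (f : A ⟶ eqn x y) (z : FreeMagma V) :
    mulR z (σ ≫ f) = σ ≫ mulR z f := by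
  have := mul_precomp (𝟙 _) σ (reflHom z) f
  rw [Category.id_comp, id_tensorHom] at this
  rw [mulR, mulR, this, leftUnitor_inv_naturality_assoc]

theorem cat_reflHom (f : A ⟶ eqn x y) : cat f (reflHom y) = (ρ_ A).hom ≫ f := by
  have h : (𝟙 (eqn x y) ⊗ₘ reflHom y) ≫ transHom x y y = (ρ_ (eqn x y)).hom :=
    toHom_eq (.rt_delta x y)
  rw [← rightUnitor_naturality, ← h, ← tensorHom_id, tensorHom_comp_tensorHom_assoc]
  simp [cat]

theorem reflHom_cat (f : A ⟶ eqn x y) : cat (reflHom x) f = (λ_ A).hom ≫ f := by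
  have h : (reflHom x ⊗ₘ 𝟙 (eqn x y)) ≫ transHom x x y = (λ_ (eqn x y)).hom :=
    toHom_eq (.rt_sigma y x)
  rw [← leftUnitor_naturality, ← h, ← id_tensorHom, tensorHom_comp_tensorHom_assoc]
  simp [cat]

theorem cat_assoc (f : A ⟶ eqn x y) (g : B ⟶ eqn y z) (h : D ⟶ eqn z w) :
    cat f (cat g h) = (α_ A B D).inv ≫ cat (cat f g) h := by
  have e : (𝟙 (eqn x y) ⊗ₘ transHom y z w) ≫ transHom x y w =
      ((α_ (eqn x y) (eqn y z) (eqn z w)).inv ≫ (transHom x y z ⊗ₘ 𝟙 (eqn z w))) ≫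
        transHom x z w :=
    toHom_eq (.tb x y z w)
  have h1 : cat f (cat g h) =
      (f ⊗ₘ (g ⊗ₘ h)) ≫ (𝟙 (eqn x y) ⊗ₘ transHom y z w) ≫ transHom x y w := by
    rw [tensorHom_comp_tensorHom_assoc, Category.comp_id]; rfl
  have h2 : cat (cat f g) h =
      ((f ⊗ₘ g) ⊗ₘ h) ≫ (transHom x y z ⊗ₘ 𝟙 (eqn z w)) ≫ transHom x z w := by
    rw [tensorHom_comp_tensorHom_assoc, Category.comp_id]; rfl
  rw [h1, h2, e, Category.assoc, associator_inv_naturality_assoc]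

theorem symmHom_symmHom (x y : FreeMagma V) : symmHom x y ≫ symmHom y x = 𝟙 _ :=
  toHom_eq (.ss x y)

theorem reflHom_symmHom (x : FreeMagma V) : reflHom x ≫ symmHom x x = reflHom x :=
  toHom_eq (.rs x)

theorem cat_symmHom (f : A ⟶ eqn x y) (g : B ⟶ eqn y z) :
    cat f g ≫ symmHom x z = (β_ A B).hom ≫ cat (g ≫ symmHom y z) (f ≫ symmHom x y) := by
  have e : transHom x y z ≫ symmHom x z =
      ((β_ (eqn x y) (eqn y z)).hom ≫ (symmHom y z ⊗ₘ symmHom x y)) ≫ transHom z y x :=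
    toHom_eq (.ts x y z)
  rw [cat, Category.assoc, e, cat_precomp, cat]
  simp only [Category.assoc, braiding_naturality_assoc]

theorem mul_symmHom (f : A ⟶ eqn x y) (g : B ⟶ eqn z w) :
    mul f g ≫ symmHom (x * z) (y * w) = mul (f ≫ symmHom x y) (g ≫ symmHom z w) := by
  have e : congrHom x y z w ≫ symmHom (x * z) (y * w) =
      (symmHom x y ⊗ₘ symmHom z w) ≫ congrHom y x w z :=
    toHom_eq (.sa x y z w)
  rw [mul, Category.assoc, e, tensorHom_comp_tensorHom_assoc, mul]

theorem mul_reflHom (x y : FreeMagma V) :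
    mul (reflHom x) (reflHom y) = (λ_ (𝟙_ (DotSEqv V))).hom ≫ reflHom (x * y) := by
  have e : ((ρ_ (𝟙_ (DotSEqv V))).inv ≫ (reflHom x ⊗ₘ reflHom y)) ≫ congrHom x x y y =
      reflHom (x * y) :=
    toHom_eq (.ra x y)
  rw [← e, unitors_equal, Category.assoc, Iso.hom_inv_id_assoc, mul]

theorem toHom_cm (A B D E : DotSEqv V) : (ArrowTerm.cm A B D E).toHom = tensorμ A B D E := by
  have h : (ArrowTerm.cm A B D E).toHom =
      ((α_ A B (D ⊗ E)).hom ≫ (𝟙 A ⊗ₘ (((α_ B D E).inv ≫ ((β_ B D).hom ⊗ₘ 𝟙 E)) ≫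
        (α_ D B E).hom))) ≫ (α_ A D (B ⊗ E)).inv := rfl
  rw [h]
  simp [tensorμ]

theorem mul_cat {x1 y1 z1 x2 y2 z2 : FreeMagma V} (f : A ⟶ eqn x1 y1) (f' : B ⟶ eqn y1 z1)
    (g : D ⟶ eqn x2 y2) (g' : E ⟶ eqn y2 z2) :
    mul (cat f f') (cat g g') = tensorμ A B D E ≫ cat (mul f g) (mul f' g') := by
  have e : (transHom x1 y1 z1 ⊗ₘ transHom x2 y2 z2) ≫ congrHom x1 z1 x2 z2 =
      tensorμ _ _ _ _ ≫ (congrHom x1 y1 x2 y2 ⊗ₘ congrHom y1 z1 y2 z2) ≫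
        transHom (x1 * x2) (y1 * y2) (z1 * z2) := by
    refine (toHom_eq (.ta x1 y1 z1 x2 y2 z2)).trans ?_
    rw [← toHom_cm]
    exact Category.assoc (ArrowTerm.cm (eqn x1 y1) (eqn y1 z1) (eqn x2 y2) (eqn y2 z2)).toHom
      (congrHom x1 y1 x2 y2 ⊗ₘ congrHom y1 z1 y2 z2) (transHom (x1 * x2) (y1 * y2) (z1 * z2))
  rw [mul, cat, cat, ← tensorHom_comp_tensorHom, Category.assoc, e, tensorμ_natural_assoc,
    tensorHom_comp_tensorHom_assoc]
  rfl

theorem mulL_reflHom (x z : FreeMagma V) : mulL (reflHom x) z = reflHom (x * z) := by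
  rw [mulL, mul_reflHom, unitors_equal, Iso.inv_hom_id_assoc]

theorem mulR_reflHom (x z : FreeMagma V) : mulR z (reflHom x) = reflHom (z * x) := by
  rw [mulR, mul_reflHom, Iso.inv_hom_id_assoc]

theorem mulL_symmHom (f : A ⟶ eqn x y) (z : FreeMagma V) :
    mulL f z ≫ symmHom _ _ = mulL (f ≫ symmHom x y) z := by
  rw [mulL, Category.assoc, mul_symmHom, reflHom_symmHom, mulL]

theorem mulR_symmHom (f : A ⟶ eqn x y) (z : FreeMagma V) :
    mulR z f ≫ symmHom _ _ = mulR z (f ≫ symmHom x y) := by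
  rw [mulR, Category.assoc, mul_symmHom, reflHom_symmHom, mulR]

/-- Write reflexivity at `w` as its own concatenation with itself, up to the unit isomorphism, and
apply the interchange law `mul_cat`. -/
theorem mulL_cat (f : A ⟶ eqn x y) (g : B ⟶ eqn y z) (w : FreeMagma V) :
    mulL (cat f g) w = cat (mulL f w) (mulL g w) := by
  have h := mul_precomp (𝟙 _) (λ_ (𝟙_ (DotSEqv V))).inv (cat f g) (cat (reflHom w) (reflHom w))
  rw [Category.id_comp, reflHom_cat, Iso.inv_hom_id_assoc, ← reflHom_cat, id_tensorHom,
    mul_cat] at h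
  rw [mulL, h, reassoc_of% tensorμ_unit_right, mulL, mulL, cat_precomp]

theorem mulR_cat (f : A ⟶ eqn x y) (g : B ⟶ eqn y z) (w : FreeMagma V) :
    mulR w (cat f g) = cat (mulR w f) (mulR w g) := by
  have h := mul_precomp (λ_ (𝟙_ (DotSEqv V))).inv (𝟙 _) (cat (reflHom w) (reflHom w)) (cat f g)
  rw [Category.id_comp, reflHom_cat, Iso.inv_hom_id_assoc, ← reflHom_cat, tensorHom_id,
    mul_cat] at h
  rw [mulR, h, reassoc_of% tensorμ_unit_left, mulR, mulR, cat_precomp]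

/-- Eckmann–Hilton: expand both multiplications, apply the interchange law `mul_cat`, and cancel the
reflexivities, which sit in the two inner places. -/
theorem mulL_mulR (f : A ⟶ eqn x y) (g : B ⟶ eqn z w) :
    cat (mulL f z) (mulR y g) = mul f g := by
  rw [mulL, mulR, cat_precomp, ← tensorμ_unit_inner, Category.assoc, ← mul_cat, ← mul_precomp,
    cat_reflHom, reflHom_cat, Iso.inv_hom_id_assoc, Iso.inv_hom_id_assoc]

/-- The same argument with the reflexivities in the outer places, which costs a braiding. Together
with `mulL_mulR` it shows that rewriting in the two factors of a product can be done in either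
order. -/
theorem mulR_mulL (f : A ⟶ eqn x y) (g : B ⟶ eqn z w) :
    cat (mulR x g) (mulL f w) = (β_ B A).hom ≫ mul f g := by
  have : (β_ A B).hom ≫ cat (mulR x g) (mulL f w) = mul f g := by
    rw [mulL, mulR, cat_precomp, ← Category.assoc, ← tensorμ_unit_outer, Category.assoc,
      ← mul_cat, ← mul_precomp, cat_reflHom, reflHom_cat, Iso.inv_hom_id_assoc,
      Iso.inv_hom_id_assoc]
  rw [← this, SymmetricCategory.symmetry_assoc]

end EqualityArrows

end LinearEquality

namespace LinearEquality

open MonoidalCategory BraidedCategory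

universe u

/-! ### Rewriting steps, removal of equations from a formula, and counts of variables. -/

section Steps

variable {V : Type u}

/-- `Step u v x x'`: the term `x'` is `x` with an occurrence of the subterm `u` replaced by `v`. -/
inductive Step (u v : FreeMagma V) : FreeMagma V → FreeMagma V → Type u
  | here : Step u v u v
  | left {x x' : FreeMagma V} (s : Step u v x x') (z : FreeMagma V) : Step u v (.mul x z) (.mul x' z)
  | right {x x' : FreeMagma V} (s : Step u v x x') (z : FreeMagma V) :
      Step u v (.mul z x) (.mul z x')

/-- The arrow of a step. -/
def Step.hom {u v : FreeMagma V} : ∀ {x x' : FreeMagma V}, Step u v x x' → (eqn u v ⟶ eqn x x')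
  | _, _, .here => 𝟙 _
  | _, _, .left s z => mulL s.hom z
  | _, _, .right s z => mulR z s.hom

/-- `FStep u v A A'`: the formula `A'` is `A` with an occurrence of the term `u` in the left side
of an equation replaced by `v`. -/
inductive FStep (u v : FreeMagma V) : DotSEqv V → DotSEqv V → Type u
  | eqv {x x' : FreeMagma V} (s : Step u v x x') (y : FreeMagma V) : FStep u v (.eqv x y) (.eqv x' y)
  | left {A A' : DotSEqv V} (s : FStep u v A A') (B : DotSEqv V) : FStep u v (.and A B) (.and A' B)
  | right {A A' : DotSEqv V} (s : FStep u v A A') (B : DotSEqv V) : FStep u v (.and B A) (.and B A')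

/-- The arrow of a step in a formula. -/
def FStep.act {u v : FreeMagma V} : ∀ {A A' : DotSEqv V}, FStep u v A A' → (eqn u v ⊗ A' ⟶ A)
  | _, _, .eqv s y => cat s.hom (𝟙 (eqn _ y))
  | _, _, .left s B => actL s.act B
  | _, _, .right s B => actR s.act B

/-- `Ins E A' A`: the formula `A'` is `A` with an occurrence of `E` replaced by `⊤`. -/
inductive Ins (E : DotSEqv V) : DotSEqv V → DotSEqv V → Type u
  | here : Ins E .top E
  | left {A A' : DotSEqv V} (i : Ins E A' A) (B : DotSEqv V) : Ins E (.and A' B) (.and A B)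
  | right {A A' : DotSEqv V} (i : Ins E A' A) (B : DotSEqv V) : Ins E (.and B A') (.and B A)

/-- The isomorphism that puts `E` into its place. -/
def Ins.hom {E : DotSEqv V} : ∀ {A' A : DotSEqv V}, Ins E A' A → (E ⊗ A' ⟶ A)
  | _, _, .here => (ρ_ E).hom
  | _, _, .left i B => actL i.hom B
  | _, _, .right i B => actR i.hom B

instance Ins.isIso_hom {E A' A : DotSEqv V} (i : Ins E A' A) : IsIso i.hom := by
  induction i with
  | here => exact inferInstanceAs (IsIso (ρ_ E).hom)
  | left i B ih => change IsIso (actL i.hom B); unfold actL; infer_instance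
  | right i B ih => change IsIso (actR i.hom B); unfold actR exch; infer_instance

open Classical in
/-- The number of occurrences of a variable in a term. -/
noncomputable def tcount (z : V) : FreeMagma V → ℕ
  | .of w => if z = w then 1 else 0
  | .mul x y => tcount z x + tcount z y

/-- The number of occurrences of a variable in left sides of equations in a formula. -/
noncomputable def lcount (z : V) : DotSEqv V → ℕ
  | .top => 0
  | .eqv x _ => tcount z x
  | .and A B => lcount z A + lcount z B

/-- The number of occurrences of a variable in right sides of equations in a formula. -/
noncomputable def rcount (z : V) : DotSEqv V → ℕ
  | .top => 0
  | .eqv _ y => tcount z y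
  | .and A B => rcount z A + rcount z B

/-- There are no closed terms, so the presence of any subterm is detected by counting a suitable
variable. This is what lets linearity control whole terms. -/
theorem exists_tcount_pos (x : FreeMagma V) : ∃ z, 1 ≤ tcount z x := by
  induction x with
  | ih1 w => exact ⟨w, by simp [tcount]⟩
  | ih2 x y ih _ =>
    obtain ⟨z, hz⟩ := ih
    exact ⟨z, hz.trans (Nat.le_add_right _ _)⟩

theorem Step.tcount_eq {u v x x' : FreeMagma V} (s : Step u v x x') (z : V) :
    tcount z u ≤ tcount z x ∧ tcount z x + tcount z v = tcount z x' + tcount z u := by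
  induction s with
  | here => omega
  | left s w ih => simp only [tcount]; omega
  | right s w ih => simp only [tcount]; omega

/-- Balance of variables, written without subtraction. Right sides never change, since steps act on
left sides only. -/
theorem FStep.count_eq {u v : FreeMagma V} {A A' : DotSEqv V} (s : FStep u v A A') (z : V) :
    tcount z u ≤ lcount z A ∧ lcount z A + tcount z v = lcount z A' + tcount z u ∧
      rcount z A = rcount z A' := by
  induction s with
  | eqv s y =>
    exact ⟨(s.tcount_eq z).1, (s.tcount_eq z).2, rfl⟩
  | left s B ih => simp only [lcount, rcount]; omega
  | right s B ih => simp only [lcount, rcount]; omega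

theorem Ins.count_eq {E A' A : DotSEqv V} (i : Ins E A' A) (z : V) :
    lcount z A = lcount z A' + lcount z E ∧ rcount z A = rcount z A' + rcount z E := by
  induction i with
  | here => simp [lcount, rcount]
  | left i B ih => simp only [lcount, rcount]; omega
  | right i B ih => simp only [lcount, rcount]; omega

/-- As `u` and `w` share no variable, neither occurrence lies inside the other. Descending along the
term, the two paths must therefore part at some product, where `mulL_mulR` and `mulR_mulL` give the
exchange. -/
theorem Step.diamond {u v w w' x x1 x2 : FreeMagma V} (s1 : Step u v x x1) (s2 : Step w w' x x2)
    (h : ∀ z, 1 ≤ tcount z u → tcount z w = 0) :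
    ∃ (x3 : FreeMagma V) (s1' : Step u v x2 x3) (s2' : Step w w' x1 x3),
      cat s1.hom s2'.hom = (β_ _ _).hom ≫ cat s2.hom s1'.hom := by
  induction s1 generalizing x2 with
  | here =>
    -- Here `w` would be a subterm of `u`, and any variable of `w` would be common to both.
    obtain ⟨z, hz⟩ := exists_tcount_pos w
    have := s2.tcount_eq z
    have := h z
    omega
  | left s1 y ih =>
    cases s2 with
    | here =>
      obtain ⟨z, hz⟩ := exists_tcount_pos u
      have := (s1.left y).tcount_eq z
      have := h z hz
      omega
    | left s2 =>
      obtain ⟨x3, s1', s2', e⟩ := ih s2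
      refine ⟨_, s1'.left y, s2'.left y, ?_⟩
      refine (mulL_cat _ _ _).symm.trans ?_
      rw [e, mulL_precomp, mulL_cat]
      rfl
    | right s2 =>
      refine ⟨_, s1.left _, s2.right _, ?_⟩
      refine (mulL_mulR s1.hom s2.hom).trans ?_
      exact ((congrArg _ (mulR_mulL s1.hom s2.hom)).trans
        (SymmetricCategory.symmetry_assoc _ _ _)).symm
  | right s1 y ih =>
    cases s2 with
    | here =>
      obtain ⟨z, hz⟩ := exists_tcount_pos u
      have := (s1.right y).tcount_eq z
      have := h z hz
      omega
    | left s2 =>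
      refine ⟨_, s1.right _, s2.left _, ?_⟩
      refine (mulR_mulL s2.hom s1.hom).trans ?_
      exact congrArg _ (mulL_mulR s2.hom s1.hom).symm
    | right s2 =>
      obtain ⟨x3, s1', s2', e⟩ := ih s2
      refine ⟨_, s1'.right y, s2'.right y, ?_⟩
      refine (mulR_cat _ _ _).symm.trans ?_
      rw [e, mulR_precomp, mulR_cat]
      rfl

/-- Steps in different conjuncts always commute. Steps in the same equation reduce to
`Step.diamond`, since both act on its left side. -/
theorem FStep.diamond {u v w w' : FreeMagma V} {A A1 A2 : DotSEqv V} (s1 : FStep u v A A1)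
    (s2 : FStep w w' A A2) (h : ∀ z, 1 ≤ tcount z u → tcount z w = 0) :
    ∃ (A3 : DotSEqv V) (s1' : FStep u v A2 A3) (s2' : FStep w w' A1 A3),
      Comm s1.act s2.act s1'.act s2'.act := by
  induction s1 generalizing A2 with
  | eqv s1 y =>
    cases s2 with
    | eqv s2 =>
      obtain ⟨x3, s1', s2', e⟩ := s1.diamond s2 h
      refine ⟨_, FStep.eqv s1' y, FStep.eqv s2' y, ?_⟩
      -- Associativity of `cat` gathers two successive steps into one concatenation, to which the
      -- equation from `Step.diamond` applies directly.
      have key : ∀ {u v w w' x x' x'' : FreeMagma V} (s : Step u v x x') (s' : Step w w' x' x''),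
          eqn u v ◁ (FStep.eqv s' y).act ≫ (FStep.eqv s y).act =
            (α_ _ _ _).inv ≫ cat (cat s.hom s'.hom) (𝟙 (eqn x'' y)) := by
        intro u v w w' x x' x'' s s'
        rw [← cat_assoc]
        have := cat_precomp (𝟙 (eqn u v)) (FStep.eqv s' y).act s.hom (𝟙 (eqn x' y))
        rw [Category.id_comp] at this
        exact ((congrArg _ (Category.comp_id _)).symm.trans
          (this.trans (congrArg (· ≫ _) (id_tensorHom _ _)))).symm
      unfold Comm
      rw [key, key, e]
      have := cat_precomp (β_ (eqn u v) (eqn w w')).hom (𝟙 _) (cat s2.hom s1'.hom)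
        (𝟙 (eqn x3 y))
      rw [Category.id_comp] at this
      rw [this, tensorHom_id]
      refine Eq.trans ?_ (Category.assoc _ _ _).symm
      refine congrArg _ (Eq.trans ?_ (Category.assoc _ _ _).symm)
      refine congrArg _ ?_
      exact (Iso.hom_inv_id_assoc (α_ _ _ _) _).symm
  | left s1 B ih =>
    cases s2 with
    | left s2 =>
      obtain ⟨A3, s1', s2', e⟩ := ih s2
      exact ⟨_, s1'.left B, s2'.left B, e.left B⟩
    | right s2 => exact ⟨_, s1.left _, s2.right _, Comm.left_right s1.act s2.act⟩
  | right s1 B ih =>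
    cases s2 with
    | left s2 => exact ⟨_, s1.right _, s2.left _, (Comm.left_right s2.act s1.act).symm⟩
    | right s2 =>
      obtain ⟨A3, s1', s2', e⟩ := ih s2
      exact ⟨_, s1'.right B, s2'.right B, e.right B⟩

/-- Equations are atomic formulae, so two occurrences of equations either coincide or lie in
different factors of some conjunction, where their insertions commute. -/
theorem Ins.diamond {p q p' q' : FreeMagma V} {A A1 A2 : DotSEqv V} (i : Ins (eqn p q) A1 A)
    (j : Ins (eqn p' q') A2 A) :
    (eqn p q = eqn p' q' ∧ A1 = A2 ∧ HEq i j) ∨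
    ∃ (A3 : DotSEqv V) (i' : Ins (eqn p q) A3 A2) (j' : Ins (eqn p' q') A3 A1),
      Comm i.hom j.hom i'.hom j'.hom := by
  induction i generalizing A2 with
  | here =>
    cases j with
    | here => exact .inl ⟨rfl, rfl, HEq.rfl⟩
  | left i B ih =>
    cases j with
    | left j =>
      rcases ih j with ⟨h, rfl, h'⟩ | ⟨A3, i', j', e⟩
      · cases h
        cases h'
        exact .inl ⟨rfl, rfl, HEq.rfl⟩
      · exact .inr ⟨_, i'.left B, j'.left B, e.left B⟩
    | right j => exact .inr ⟨_, i.left _, j.right _, Comm.left_right i.hom j.hom⟩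
  | right i B ih =>
    cases j with
    | left j => exact .inr ⟨_, i.right _, j.left _, (Comm.left_right j.hom i.hom).symm⟩
    | right j =>
      rcases ih j with ⟨h, rfl, h'⟩ | ⟨A3, i', j', e⟩
      · cases h
        cases h'
        exact .inl ⟨rfl, rfl, HEq.rfl⟩
      · exact .inr ⟨_, i'.right B, j'.right B, e.right B⟩

/-- Two occurrences of `u` in different factors would give a variable of `u` two occurrences in `x`.
Nested occurrences are impossible because `u` is not a proper subterm of itself. -/
theorem Step.unique {u v x x1 x2 : FreeMagma V} (s1 : Step u v x x1) (s2 : Step u v x x2)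
    (h : ∀ z, 1 ≤ tcount z u → tcount z x ≤ 1) : x1 = x2 ∧ HEq s1 s2 := by
  induction s1 generalizing x2 with
  | here =>
    cases s2 with
    | here => exact ⟨rfl, HEq.rfl⟩
    | left s2 y =>
      -- Here `u` would occur properly inside itself, next to the sibling `y`; counting a variable
      -- of `y` refutes this.
      obtain ⟨z, hz⟩ := exists_tcount_pos y
      have := s2.tcount_eq z
      simp only [tcount] at this
      omega
    | right s2 y =>
      obtain ⟨z, hz⟩ := exists_tcount_pos y
      have := s2.tcount_eq z
      simp only [tcount] at this
      omega
  | left s1 y ih =>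
    cases s2 with
    | here =>
      obtain ⟨z, hz⟩ := exists_tcount_pos y
      have := s1.tcount_eq z
      simp only [tcount] at this
      omega
    | left s2 =>
      obtain ⟨rfl, h'⟩ := ih s2 fun z hz => (Nat.le_add_right _ _).trans (h z hz)
      cases h'
      exact ⟨rfl, HEq.rfl⟩
    | right s2 =>
      obtain ⟨z, hz⟩ := exists_tcount_pos u
      have h1 := h z hz
      simp only [tcount] at h1
      have := s1.tcount_eq z
      have := s2.tcount_eq z
      omega
  | right s1 y ih =>
    cases s2 with
    | here =>
      obtain ⟨z, hz⟩ := exists_tcount_pos y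
      have := s1.tcount_eq z
      simp only [tcount] at this
      omega
    | right s2 =>
      obtain ⟨rfl, h'⟩ := ih s2 fun z hz => (Nat.le_add_left _ _).trans (h z hz)
      cases h'
      exact ⟨rfl, HEq.rfl⟩
    | left s2 =>
      obtain ⟨z, hz⟩ := exists_tcount_pos u
      have h1 := h z hz
      simp only [tcount] at h1
      have := s1.tcount_eq z
      have := s2.tcount_eq z
      omega

theorem FStep.unique {u v : FreeMagma V} {A A1 A2 : DotSEqv V} (s1 : FStep u v A A1)
    (s2 : FStep u v A A2) (h : ∀ z, 1 ≤ tcount z u → lcount z A ≤ 1) : A1 = A2 ∧ HEq s1 s2 := by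
  induction s1 generalizing A2 with
  | eqv s1 y =>
    cases s2 with
    | eqv s2 =>
      obtain ⟨rfl, h'⟩ := s1.unique s2 h
      cases h'
      exact ⟨rfl, HEq.rfl⟩
  | left s1 B ih =>
    cases s2 with
    | left s2 =>
      obtain ⟨rfl, h'⟩ := ih s2 fun z hz => (Nat.le_add_right _ _).trans (h z hz)
      cases h'
      exact ⟨rfl, HEq.rfl⟩
    | right s2 =>
      obtain ⟨z, hz⟩ := exists_tcount_pos u
      have h1 := h z hz
      simp only [lcount] at h1
      have := s1.count_eq z
      have := s2.count_eq z
      omega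
  | right s1 B ih =>
    cases s2 with
    | right s2 =>
      obtain ⟨rfl, h'⟩ := ih s2 fun z hz => (Nat.le_add_left _ _).trans (h z hz)
      cases h'
      exact ⟨rfl, HEq.rfl⟩
    | left s2 =>
      obtain ⟨z, hz⟩ := exists_tcount_pos u
      have h1 := h z hz
      simp only [lcount] at h1
      have := s1.count_eq z
      have := s2.count_eq z
      omega

end Steps

end LinearEquality

namespace LinearEquality

open MonoidalCategory BraidedCategory

universe u

/-! ### Structural arrows, and the decomposition of every arrow into chains of steps. -/

section NormalForms

variable {V : Type u}

/-- The arrows built from the symmetric monoidal structure alone. -/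
inductive IsSym : ∀ {A B : DotSEqv V}, (A ⟶ B) → Prop
  | id (A : DotSEqv V) : IsSym (𝟙 A)
  | comp {A B D : DotSEqv V} {f : A ⟶ B} {g : B ⟶ D} (hf : IsSym f) (hg : IsSym g) : IsSym (f ≫ g)
  | tensor {A B A' B' : DotSEqv V} {f : A ⟶ B} {g : A' ⟶ B'} (hf : IsSym f) (hg : IsSym g) :
      IsSym (f ⊗ₘ g)
  | assoc_hom (A B D : DotSEqv V) : IsSym (α_ A B D).hom
  | assoc_inv (A B D : DotSEqv V) : IsSym (α_ A B D).inv
  | left_hom (A : DotSEqv V) : IsSym (λ_ A).hom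
  | left_inv (A : DotSEqv V) : IsSym (λ_ A).inv
  | right_hom (A : DotSEqv V) : IsSym (ρ_ A).hom
  | right_inv (A : DotSEqv V) : IsSym (ρ_ A).inv
  | braid (A B : DotSEqv V) : IsSym (β_ A B).hom

/-- `Orient E u v`: the equation `E` is `u ≗ v` or `v ≗ u`. -/
inductive Orient : DotSEqv V → FreeMagma V → FreeMagma V → Type u
  | fwd (u v : FreeMagma V) : Orient (.eqv u v) u v
  | bwd (u v : FreeMagma V) : Orient (.eqv v u) u v

/-- The arrow of an orientation. -/
def Orient.hom {u v : FreeMagma V} : ∀ {E : DotSEqv V}, Orient E u v → (E ⟶ eqn u v)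
  | _, .fwd u v => 𝟙 (eqn u v)
  | _, .bwd u v => symmHom v u

theorem Orient.exists_eqn {E : DotSEqv V} {u v : FreeMagma V} (o : Orient E u v) :
    ∃ p q, E = eqn p q := by
  cases o <;> exact ⟨_, _, rfl⟩

/-! ### Decompositions of arrows along the target -/

/-- The arrows into an equation that are, up to the symmetric monoidal structure, concatenations
of steps. -/
inductive Chain : ∀ {A : DotSEqv V} {x y : FreeMagma V}, (A ⟶ eqn x y) → Prop
  | nil {A : DotSEqv V} {σ : A ⟶ 𝟙_ _} (hσ : IsSym σ) (x : FreeMagma V) : Chain (σ ≫ reflHom x)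
  | cons {A A' E : DotSEqv V} {u v x x' y : FreeMagma V} {σ : A ⟶ E ⊗ A'} (hσ : IsSym σ)
      (o : Orient E u v) (s : Step u v x x') {f : A' ⟶ eqn x' y} (hf : Chain f) :
      Chain (σ ≫ cat (o.hom ≫ s.hom) f)

namespace Chain

variable {A B : DotSEqv V} {x y z w : FreeMagma V}

theorem precomp {τ : B ⟶ A} (hτ : IsSym τ) {f : A ⟶ eqn x y} (hf : Chain f) :
    Chain (τ ≫ f) := by
  cases hf with
  | nil hσ => rw [← Category.assoc]; exact nil (hτ.comp hσ) _
  | cons hσ o s hf => rw [← Category.assoc]; exact cons (hτ.comp hσ) o s hf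

theorem single {E : DotSEqv V} {u v : FreeMagma V} (o : Orient E u v) (s : Step u v x y) :
    Chain (o.hom ≫ s.hom) := by
  have h := cons (.right_inv E) o s (nil (.id _) y)
  rwa [Category.id_comp, cat_reflHom, Iso.inv_hom_id_assoc] at h

/-- Appending of chains: the unit law disposes of the empty chain, and associativity moves `g` past
the first step. -/
theorem cat {f : A ⟶ eqn x y} (hf : Chain f) {g : B ⟶ eqn y z} (hg : Chain g) :
    Chain (LinearEquality.cat f g) := by
  induction hf with
  | @nil A σ hσ x =>
    have h := cat_precomp σ (𝟙 B) (reflHom x) g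
    rw [Category.id_comp, reflHom_cat] at h
    rw [h]
    exact precomp (hσ.tensor (.id B)) (precomp (.left_hom B) hg)
  | @cons A A' E u v x x' y σ hσ o s f hf ih =>
    have h := cat_precomp σ (𝟙 B) (LinearEquality.cat (o.hom ≫ s.hom) f) g
    rw [Category.id_comp] at h
    rw [h, ← Iso.hom_inv_id_assoc (α_ E A' B) (LinearEquality.cat _ g), ← cat_assoc]
    exact precomp (hσ.tensor (.id B)) (cons (.assoc_hom _ _ _) o s (ih hg))

/-- A chain is inverted by inverting every step and reversing the order. An inverted step replaces
`v` by `u` at the same place and uses the same equation with the other orientation; the former first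
step is appended at the end. -/
theorem symm {f : A ⟶ eqn x y} (hf : Chain f) : Chain (f ≫ symmHom x y) := by
  have hs : ∀ {u v x x' : FreeMagma V} (s : Step u v x x'),
      ∃ s' : Step v u x' x, s.hom ≫ symmHom x x' = symmHom u v ≫ s'.hom := by
    intro u v x x' s
    induction s with
    | here => exact ⟨.here, (Category.id_comp _).trans (Category.comp_id _).symm⟩
    | left s z ih =>
      obtain ⟨s', h⟩ := ih
      exact ⟨s'.left z, (mulL_symmHom s.hom z).trans
        ((congrArg (mulL · z) h).trans (mulL_precomp _ _ _))⟩
    | right s z ih =>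
      obtain ⟨s', h⟩ := ih
      exact ⟨s'.right z, (mulR_symmHom s.hom z).trans
        ((congrArg (mulR z) h).trans (mulR_precomp _ _ _))⟩
  have ho : ∀ {E : DotSEqv V} {u v : FreeMagma V} (o : Orient E u v),
      ∃ o' : Orient E v u, o.hom ≫ symmHom u v = o'.hom := by
    intro E u v o
    cases o with
    | fwd => exact ⟨.bwd _ _, Category.id_comp _⟩
    | bwd => exact ⟨.fwd _ _, symmHom_symmHom _ _⟩
  induction hf with
  | nil hσ x =>
    rw [Category.assoc, reflHom_symmHom]
    exact nil hσ x
  | cons hσ o s hf ih =>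
    obtain ⟨s', h⟩ := hs s
    obtain ⟨o', h'⟩ := ho o
    rw [Category.assoc, cat_symmHom, Category.assoc, h, ← Category.assoc o.hom, h']
    exact precomp hσ (precomp (.braid _ _) (ih.cat (single o' s')))

theorem mulL {f : A ⟶ eqn x y} (hf : Chain f) (z : FreeMagma V) :
    Chain (LinearEquality.mulL f z) := by
  induction hf with
  | nil hσ x =>
    rw [mulL_precomp, mulL_reflHom]
    exact nil hσ _
  | cons hσ o s hf ih =>
    rw [mulL_precomp, mulL_cat, mulL_precomp]
    exact cons hσ o (s.left z) ih

theorem mulR {f : A ⟶ eqn x y} (hf : Chain f) (z : FreeMagma V) :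
    Chain (LinearEquality.mulR z f) := by
  induction hf with
  | nil hσ x =>
    rw [mulR_precomp, mulR_reflHom]
    exact nil hσ _
  | cons hσ o s hf ih =>
    rw [mulR_precomp, mulR_cat, mulR_precomp]
    exact cons hσ o (s.right z) ih

/-- By `mulL_mulR`, congruence amounts to rewriting the left factor completely and then the right
one. -/
theorem mul {f : A ⟶ eqn x y} (hf : Chain f) {g : B ⟶ eqn z w} (hg : Chain g) :
    Chain (LinearEquality.mul f g) := by
  rw [← mulL_mulR]
  exact (hf.mulL z).cat (hg.mulR y)

end Chain

/-- The arrows that decompose, up to the symmetric monoidal structure, into concatenations of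
steps, one for each equation in the target. -/
def Decomp : ∀ (B : DotSEqv V) {A : DotSEqv V}, (A ⟶ B) → Prop
  | .top, _, f => IsSym f
  | .eqv _ _, _, f => Chain f
  | .and B₁ B₂, A, f => ∃ (A₁ A₂ : DotSEqv V) (σ : A ⟶ A₁ ⊗ A₂) (f₁ : A₁ ⟶ B₁) (f₂ : A₂ ⟶ B₂),
      IsSym σ ∧ Decomp B₁ f₁ ∧ Decomp B₂ f₂ ∧ f = σ ≫ (f₁ ⊗ₘ f₂)

theorem Decomp.precomp {A B D : DotSEqv V} {σ : A ⟶ B} (hσ : IsSym σ) {f : B ⟶ D}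
    (hf : Decomp D f) : Decomp D (σ ≫ f) := by
  cases D with
  | top => exact hσ.comp hf
  | eqv x y => exact Chain.precomp hσ hf
  | and D₁ D₂ =>
    obtain ⟨A₁, A₂, τ, f₁, f₂, hτ, h₁, h₂, rfl⟩ := hf
    exact ⟨A₁, A₂, σ ≫ τ, f₁, f₂, hσ.comp hτ, h₁, h₂, (Category.assoc _ _ _).symm⟩

theorem Decomp.tensor {A B A' B' : DotSEqv V} {f : A ⟶ B} {g : A' ⟶ B'} (hf : Decomp B f)
    (hg : Decomp B' g) : Decomp (B ⊗ B') (f ⊗ₘ g) :=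
  ⟨A, A', 𝟙 _, f, g, .id _, hf, hg, (Category.id_comp _).symm⟩

/-- The identity of an equation is a single step that rewrites the whole left side, the source
equation being the one consumed. -/
theorem Decomp.id (A : DotSEqv V) : Decomp A (𝟙 A) := by
  induction A with
  | top => exact IsSym.id _
  | eqv x y =>
    have h := Chain.single (.fwd x y) Step.here
    exact (Category.id_comp (𝟙 (eqn x y))) ▸ h
  | and A B hA hB => exact (id_tensorHom_id (C := DotSEqv V) A B) ▸ hA.tensor hB

theorem Decomp.exists_tensor {A B₁ B₂ : DotSEqv V} {f : A ⟶ B₁ ⊗ B₂} (hf : Decomp (B₁ ⊗ B₂) f) :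
    ∃ (A₁ A₂ : DotSEqv V) (σ : A ⟶ A₁ ⊗ A₂) (f₁ : A₁ ⟶ B₁) (f₂ : A₂ ⟶ B₂),
      IsSym σ ∧ Decomp B₁ f₁ ∧ Decomp B₂ f₂ ∧ f = σ ≫ (f₁ ⊗ₘ f₂) := hf

namespace Decomp

variable {A B D B₁ B₂ B₃ : DotSEqv V}

theorem tensor_comp {D₁ D₂ : DotSEqv V} {f₁ : B₁ ⟶ D₁} {f₂ : B₂ ⟶ D₂}
    (H₁ : ∀ {A : DotSEqv V} {g : A ⟶ B₁}, Decomp B₁ g → Decomp D₁ (g ≫ f₁))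
    (H₂ : ∀ {A : DotSEqv V} {g : A ⟶ B₂}, Decomp B₂ g → Decomp D₂ (g ≫ f₂))
    {g : A ⟶ B₁ ⊗ B₂} (hg : Decomp (B₁ ⊗ B₂) g) : Decomp (D₁ ⊗ D₂) (g ≫ (f₁ ⊗ₘ f₂)) := by
  obtain ⟨A₁, A₂, σ, g₁, g₂, hσ, h₁, h₂, rfl⟩ := hg.exists_tensor
  refine ⟨A₁, A₂, σ, _, _, hσ, H₁ h₁, H₂ h₂, ?_⟩
  rw [Category.assoc, ← tensorHom_comp_tensorHom]

theorem assoc_inv {g : A ⟶ B₁ ⊗ (B₂ ⊗ B₃)} (hg : Decomp _ g) :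
    Decomp ((B₁ ⊗ B₂) ⊗ B₃) (g ≫ (α_ B₁ B₂ B₃).inv) := by
  obtain ⟨A₁, A₂, σ, g₁, g₂, hσ, h₁, h₂, rfl⟩ := hg.exists_tensor
  obtain ⟨A₃, A₄, τ, g₃, g₄, hτ, h₃, h₄, rfl⟩ := h₂.exists_tensor
  have e : (σ ≫ (g₁ ⊗ₘ (τ ≫ (g₃ ⊗ₘ g₄)))) ≫ (α_ _ _ _).inv =
      (σ ≫ (𝟙 _ ⊗ₘ τ)) ≫ (α_ _ _ _).inv ≫ ((g₁ ⊗ₘ g₃) ⊗ₘ g₄) := by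
    rw [← associator_inv_naturality, Category.assoc, Category.assoc,
      tensorHom_comp_tensorHom_assoc, Category.id_comp]
  rw [e]
  exact precomp (hσ.comp ((IsSym.id _).tensor hτ))
    (precomp (.assoc_inv _ _ _) ((h₁.tensor h₃).tensor h₄))

theorem assoc_hom {g : A ⟶ (B₁ ⊗ B₂) ⊗ B₃} (hg : Decomp _ g) :
    Decomp (B₁ ⊗ (B₂ ⊗ B₃)) (g ≫ (α_ B₁ B₂ B₃).hom) := by
  obtain ⟨A₁, A₂, σ, g₁, g₂, hσ, h₁, h₂, rfl⟩ := hg.exists_tensor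
  obtain ⟨A₃, A₄, τ, g₃, g₄, hτ, h₃, h₄, rfl⟩ := h₁.exists_tensor
  have e : (σ ≫ ((τ ≫ (g₃ ⊗ₘ g₄)) ⊗ₘ g₂)) ≫ (α_ _ _ _).hom =
      (σ ≫ (τ ⊗ₘ 𝟙 _)) ≫ (α_ _ _ _).hom ≫ (g₃ ⊗ₘ (g₄ ⊗ₘ g₂)) := by
    rw [← associator_naturality, Category.assoc, Category.assoc,
      tensorHom_comp_tensorHom_assoc, Category.id_comp]
  rw [e]
  exact precomp (hσ.comp (hτ.tensor (IsSym.id _)))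
    (precomp (.assoc_hom _ _ _) (h₃.tensor (h₄.tensor h₂)))

/-- The component into the unit is itself structural, by the definition of `Decomp` at `⊤`, so it
can be absorbed into the structural part. -/
theorem right_hom {g : A ⟶ B ⊗ 𝟙_ _} (hg : Decomp _ g) : Decomp B (g ≫ (ρ_ B).hom) := by
  obtain ⟨A₁, A₂, σ, g₁, g₂, hσ, h₁, h₂, rfl⟩ := hg.exists_tensor
  have e : (σ ≫ (g₁ ⊗ₘ g₂)) ≫ (ρ_ _).hom = (σ ≫ (𝟙 _ ⊗ₘ g₂)) ≫ (ρ_ _).hom ≫ g₁ := by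
    rw [← rightUnitor_naturality, Category.assoc, Category.assoc, ← tensorHom_id,
      tensorHom_comp_tensorHom_assoc, Category.id_comp, Category.comp_id]
  rw [e]
  exact precomp (hσ.comp ((IsSym.id _).tensor h₂)) (precomp (.right_hom _) h₁)

theorem right_inv {g : A ⟶ B} (hg : Decomp _ g) : Decomp (B ⊗ 𝟙_ _) (g ≫ (ρ_ B).inv) := by
  rw [rightUnitor_inv_naturality, ← tensorHom_id]
  exact precomp (.right_inv _) (hg.tensor (.id _))

theorem left_hom {g : A ⟶ 𝟙_ _ ⊗ B} (hg : Decomp _ g) : Decomp B (g ≫ (λ_ B).hom) := by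
  obtain ⟨A₁, A₂, σ, g₁, g₂, hσ, h₁, h₂, rfl⟩ := hg.exists_tensor
  have e : (σ ≫ (g₁ ⊗ₘ g₂)) ≫ (λ_ _).hom = (σ ≫ (g₁ ⊗ₘ 𝟙 _)) ≫ (λ_ _).hom ≫ g₂ := by
    rw [← leftUnitor_naturality, Category.assoc, Category.assoc, ← id_tensorHom,
      tensorHom_comp_tensorHom_assoc, Category.id_comp, Category.comp_id]
  rw [e]
  exact precomp (hσ.comp (IsSym.tensor h₁ (IsSym.id _))) (precomp (.left_hom _) h₂)

theorem left_inv {g : A ⟶ B} (hg : Decomp _ g) : Decomp (𝟙_ _ ⊗ B) (g ≫ (λ_ B).inv) := by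
  rw [leftUnitor_inv_naturality, ← id_tensorHom]
  exact precomp (.left_inv _) ((Decomp.id _).tensor hg)

theorem braid {g : A ⟶ B₁ ⊗ B₂} (hg : Decomp _ g) :
    Decomp (B₂ ⊗ B₁) (g ≫ (β_ B₁ B₂).hom) := by
  obtain ⟨A₁, A₂, σ, g₁, g₂, hσ, h₁, h₂, rfl⟩ := hg.exists_tensor
  rw [Category.assoc, braiding_naturality]
  exact precomp hσ (precomp (.braid _ _) (h₂.tensor h₁))

theorem trans {x y z : FreeMagma V} {g : A ⟶ eqn x y ⊗ eqn y z} (hg : Decomp _ g) :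
    Decomp (eqn x z) (g ≫ transHom x y z) := by
  obtain ⟨A₁, A₂, σ, g₁, g₂, hσ, h₁, h₂, rfl⟩ := hg.exists_tensor
  rw [Category.assoc]
  exact Chain.precomp hσ (Chain.cat h₁ h₂)

theorem congr {x y z w : FreeMagma V} {g : A ⟶ eqn x y ⊗ eqn z w} (hg : Decomp _ g) :
    Decomp (eqn (x * z) (y * w)) (g ≫ congrHom x y z w) := by
  obtain ⟨A₁, A₂, σ, g₁, g₂, hσ, h₁, h₂, rfl⟩ := hg.exists_tensor
  rw [Category.assoc]
  exact Chain.precomp hσ (Chain.mul h₁ h₂)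

theorem comp_comp {f₁ : B₁ ⟶ B₂} {f₂ : B₂ ⟶ B₃}
    (H₁ : ∀ {A : DotSEqv V} {g : A ⟶ B₁}, Decomp B₁ g → Decomp B₂ (g ≫ f₁))
    (H₂ : ∀ {A : DotSEqv V} {g : A ⟶ B₂}, Decomp B₂ g → Decomp B₃ (g ≫ f₂))
    {g : A ⟶ B₁} (hg : Decomp _ g) : Decomp B₃ (g ≫ f₁ ≫ f₂) := by
  rw [← Category.assoc]
  exact H₂ (H₁ hg)

theorem comp_id {g : A ⟶ B} (hg : Decomp _ g) : Decomp B (g ≫ 𝟙 B) := by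
  rwa [Category.comp_id]

end Decomp

/-- Cut elimination, by induction on the arrow term that is composed on the right. Quantifying over
all decomposed `g` makes the case of composition immediate; applied to the identity, the statement
decomposes every arrow. -/
theorem Decomp.comp_toHom {B D : Formula V} (f : ArrowTerm B D) :
    ∀ {A : DotSEqv V} {g : A ⟶ B}, Decomp B g →
      Decomp D (@CategoryStruct.comp (DotSEqv V) _ A B D g f.toHom) := by
  induction f with
  | id B => exact fun hg => comp_id hg
  | comp f g hf hg => exact fun hh => comp_comp hg hf hh
  | tensor f f' ih ih' => exact fun hg => tensor_comp ih ih' hg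
  | bRight => exact fun hg => assoc_inv hg
  | bLeft => exact fun hg => assoc_hom hg
  | deltaRight => exact fun hg => right_hom hg
  | deltaLeft => exact fun hg => right_inv hg
  | sigmaRight => exact fun hg => left_hom hg
  | sigmaLeft => exact fun hg => left_inv hg
  | c => exact fun hg => braid hg
  -- A decomposed arrow into `⊤` is structural, so followed by reflexivity it is an empty chain.
  | r x => exact fun hg => Chain.nil hg x
  | t => exact fun hg => trans hg
  | s => exact fun hg => Chain.symm hg
  | a => exact fun hg => congr hg

theorem decomp {A B : DotSEqv V} (f : A ⟶ B) : Decomp B f := by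
  induction f using Quotient.inductionOn with
  | _ f =>
    have h := Decomp.comp_toHom f (Decomp.id A)
    rwa [Category.id_comp] at h

end NormalForms

end LinearEquality

namespace LinearEquality

open MonoidalCategory BraidedCategory

universe u w v

/-! ### Exchange of two successive removals. -/

section Peel

variable {C : Type w} [Category.{v} C] [MonoidalCategory C] [SymmetricCategory C]

/-- If `g` splits off `Y`, and the remainder splits off `X`, then `g` also splits off `X` at once,
leaving an arrow that splits off `Y`. It is enough to test this after the epimorphism `X ◁ j'`,
where both commutation squares and both factorisations apply. -/
theorem Comm.peel {X Y A A₁ A₂ A₃ B B₁ B₂ B₃ : C} {i : X ⊗ A₁ ⟶ A} {j : Y ⊗ A₂ ⟶ A}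
    {i' : X ⊗ A₃ ⟶ A₂} {j' : Y ⊗ A₃ ⟶ A₁} [IsIso j'] (hij : Comm i j i' j')
    {s : X ⊗ B₁ ⟶ B} {t : Y ⊗ B₂ ⟶ B} {s' : X ⊗ B₃ ⟶ B₂} {t' : Y ⊗ B₃ ⟶ B₁}
    (hst : Comm s t s' t') {g : A ⟶ B} {g₂ : A₂ ⟶ B₂} {g₃ : A₃ ⟶ B₃}
    (h : j ≫ g = Y ◁ g₂ ≫ t) (h' : i' ≫ g₂ = X ◁ g₃ ≫ s') :
    i ≫ g = X ◁ (inv j' ≫ Y ◁ g₃ ≫ t') ≫ s := by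
  unfold Comm at hij hst
  rw [← cancel_epi (X ◁ j'), ← whiskerLeft_comp_assoc, IsIso.hom_inv_id_assoc, reassoc_of% hij, h,
    ← whiskerLeft_comp_assoc, h', whiskerLeft_comp, Category.assoc, whiskerLeft_comp,
    Category.assoc, hst]
  have := exch_nat (𝟙 X) (𝟙 Y) g₃
  simp only [id_tensorHom] at this
  rw [reassoc_of% this]

end Peel

/-! ### Normal arrows: existence, and uniqueness under linearity. -/

section NormalForms

variable {V : Type u}

/-- Formulae without equations. -/
inductive Bare : DotSEqv V → Type u
  | top : Bare .top
  | and {A B : DotSEqv V} (a : Bare A) (b : Bare B) : Bare (.and A B)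

/-- The isomorphism of a formula without equations with `⊤`. -/
def Bare.hom : ∀ {A : DotSEqv V}, Bare A → (A ⟶ 𝟙_ (DotSEqv V))
  | _, .top => 𝟙 (𝟙_ _)
  | _, .and a b => (a.hom ⊗ₘ b.hom) ≫ (λ_ (𝟙_ _)).hom

/-- Formulae in which all equations are reflexive. -/
inductive Reflexive : DotSEqv V → Type u
  | top : Reflexive .top
  | eqv (x : FreeMagma V) : Reflexive (.eqv x x)
  | and {A B : DotSEqv V} (a : Reflexive A) (b : Reflexive B) : Reflexive (.and A B)

/-- The proof of a formula in which all equations are reflexive. -/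
def Reflexive.hom : ∀ {A : DotSEqv V}, Reflexive A → (𝟙_ (DotSEqv V) ⟶ A)
  | _, .top => 𝟙 (𝟙_ _)
  | _, .eqv x => reflHom x
  | _, .and a b => (λ_ (𝟙_ _)).inv ≫ (a.hom ⊗ₘ b.hom)

theorem Bare.eq {A : DotSEqv V} (a b : Bare A) : a = b := by
  induction a with
  | top => cases b; rfl
  | and a a' ih ih' => cases b with | and b b' => rw [ih b, ih' b']

theorem Reflexive.eq {A : DotSEqv V} (a b : Reflexive A) : a = b := by
  induction a with
  | top => cases b; rfl
  | eqv => cases b; rfl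
  | and a a' ih ih' => cases b with | and b b' => rw [ih b, ih' b']

/-- Arrows that are concatenations of steps in the whole target, followed by reflexivity. -/
inductive Normal : ∀ {A B : DotSEqv V}, (A ⟶ B) → Prop
  | base {A B : DotSEqv V} (a : Bare A) (r : Reflexive B) : Normal (a.hom ≫ r.hom)
  | step {E A A' B B' : DotSEqv V} {u v : FreeMagma V} (i : Ins E A' A) (o : Orient E u v)
      (s : FStep u v B B') {f : A ⟶ B} {f' : A' ⟶ B'} (hf' : Normal f')
      (h : i.hom ≫ f = E ◁ f' ≫ o.hom ▷ B' ≫ s.act) : Normal f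

theorem Ins.cases_tensor {p q : FreeMagma V} {A B : DotSEqv V}
    {P : ∀ A', Ins (eqn p q) A' (A ⊗ B) → Prop}
    (left : ∀ A' (i : Ins (eqn p q) A' A), P (A' ⊗ B) (i.left B))
    (right : ∀ B' (i : Ins (eqn p q) B' B), P (A ⊗ B') (i.right A))
    {A' : DotSEqv V} (i : Ins (eqn p q) A' (A ⊗ B)) : P A' i := by
  change Ins (eqn p q) A' (Formula.and A B) at i
  cases i with
  | left i => exact left _ i
  | right i => exact right _ i

theorem Ins.unit_elim {p q : FreeMagma V} {A' : DotSEqv V}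
    (i : Ins (eqn p q) A' (𝟙_ (DotSEqv V))) : False := by
  change Ins (eqn p q) A' Formula.top at i
  cases i

/-- A structural arrow carries each equation of its target back to an equation of its source, and
restricts to a structural arrow between what remains. The cases are the naturality properties of
`actL` and `actR`. -/
theorem Ins.transport {p q : FreeMagma V} {Z A : DotSEqv V} {σ : Z ⟶ A} (hσ : IsSym σ) :
    ∀ {A' : DotSEqv V} (i : Ins (eqn p q) A' A),
      ∃ (Z' : DotSEqv V) (i' : Ins (eqn p q) Z' Z) (σ' : Z' ⟶ A'), IsSym σ' ∧
        i'.hom ≫ σ = eqn p q ◁ σ' ≫ i.hom := by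
  induction hσ with
  | id A => exact fun i => ⟨_, i, 𝟙 _, .id _, by simp⟩
  | comp hf hg ihf ihg =>
    intro A' i
    obtain ⟨Z', i', σ', hσ', h⟩ := ihg i
    obtain ⟨Z'', i'', σ'', hσ'', h'⟩ := ihf i'
    refine ⟨Z'', i'', σ'' ≫ σ', hσ''.comp hσ', ?_⟩
    rw [reassoc_of% h', h, whiskerLeft_comp, Category.assoc]
  | @tensor A B A' B' f g hf hg ihf ihg =>
    intro _ i
    cases i using Ins.cases_tensor with
    | left _ i =>
      obtain ⟨Z', i', σ', hσ', h⟩ := ihf i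
      exact ⟨_, i'.left _, σ' ⊗ₘ g, hσ'.tensor hg, actL_tensor _ _ _ _ h _⟩
    | right _ i =>
      obtain ⟨Z', i', σ', hσ', h⟩ := ihg i
      exact ⟨_, i'.right _, f ⊗ₘ σ', hf.tensor hσ', actR_tensor _ _ _ _ h _⟩
  | assoc_hom A B D =>
    intro _ i
    cases i using Ins.cases_tensor with
    | left _ i => exact ⟨_, (i.left B).left D, _, .assoc_hom _ _ _, actL_assoc i.hom B D⟩
    | right _ i =>
      cases i using Ins.cases_tensor with
      | left _ i => exact ⟨_, (i.right A).left D, _, .assoc_hom _ _ _, actL_actR_assoc i.hom A D⟩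
      | right _ i => exact ⟨_, i.right (A ⊗ B), _, .assoc_hom _ _ _, actR_assoc i.hom A B⟩
  | assoc_inv A B D =>
    -- The case of the inverse associator is obtained by inverting the squares already available for
    -- the associator.
    have key : ∀ {E X' X Y' Y : DotSEqv V} {f : E ⊗ X' ⟶ X} {g : E ⊗ Y' ⟶ Y} (e : X ≅ Y)
        (e' : X' ≅ Y'), f ≫ e.hom = E ◁ e'.hom ≫ g → g ≫ e.inv = E ◁ e'.inv ≫ f := by
      intro E X' X Y' Y f g e e' h
      rw [Iso.comp_inv_eq, Category.assoc, h, ← whiskerLeft_comp_assoc, Iso.inv_hom_id,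
        whiskerLeft_id, Category.id_comp]
    intro _ i
    cases i using Ins.cases_tensor with
    | left _ i =>
      cases i using Ins.cases_tensor with
      | left _ i =>
        exact ⟨_, i.left (B ⊗ D), _, .assoc_inv _ _ _,
          key (α_ _ _ _) (α_ _ _ _) (actL_assoc i.hom B D)⟩
      | right _ i =>
        exact ⟨_, (i.left D).right A, _, .assoc_inv _ _ _,
          key (α_ _ _ _) (α_ _ _ _) (actL_actR_assoc i.hom A D)⟩
    | right _ i =>
      exact ⟨_, (i.right B).right A, _, .assoc_inv _ _ _,
        key (α_ _ _ _) (α_ _ _ _) (actR_assoc i.hom A B)⟩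
  | left_hom A => exact fun i => ⟨_, i.right (𝟙_ _), _, .left_hom _, actR_leftUnitor i.hom⟩
  | left_inv A =>
    intro _ i
    cases i using Ins.cases_tensor with
    | left _ i => exact i.unit_elim.elim
    | right A' i =>
      refine ⟨_, i, _, .left_inv _, ?_⟩
      have h := actR_leftUnitor i.hom
      rw [Iso.comp_inv_eq, Category.assoc]
      refine Eq.trans ?_ (congrArg _ h.symm)
      simp
  | right_hom A => exact fun i => ⟨_, i.left (𝟙_ _), _, .right_hom _, actL_rightUnitor i.hom⟩
  | right_inv A =>
    intro _ i
    cases i using Ins.cases_tensor with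
    | left A' i =>
      refine ⟨_, i, _, .right_inv _, ?_⟩
      have h := actL_rightUnitor i.hom
      rw [Iso.comp_inv_eq, Category.assoc]
      refine Eq.trans ?_ (congrArg _ h.symm)
      simp
    | right _ i => exact i.unit_elim.elim
  | braid A B =>
    intro _ i
    cases i using Ins.cases_tensor with
    | left _ i => exact ⟨_, i.right A, _, .braid _ _, actR_braid i.hom A⟩
    | right _ i => exact ⟨_, i.left B, _, .braid _ _, actL_braid i.hom B⟩

/-- The tensor of formulae without equations. -/
def Bare.tensor {A B : DotSEqv V} (a : Bare A) (b : Bare B) : Bare (A ⊗ B) := a.and b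

/-- The unit as a formula without equations. -/
def Bare.unit : Bare (𝟙_ (DotSEqv V)) := .top

theorem Bare.tensor_hom {A B : DotSEqv V} (a : Bare A) (b : Bare B) :
    (a.tensor b).hom = (a.hom ⊗ₘ b.hom) ≫ (λ_ (𝟙_ _)).hom := rfl

theorem Bare.unit_hom : (Bare.unit (V := V)).hom = 𝟙 (𝟙_ _) := rfl

theorem Bare.exists_tensor {A B : DotSEqv V} (a : Bare (A ⊗ B)) :
    ∃ (a₁ : Bare A) (a₂ : Bare B), a = a₁.tensor a₂ := by
  change Bare (Formula.and A B) at a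
  cases a
  exact ⟨_, _, rfl⟩

theorem Bare.tensor_tensor_hom {A B D : DotSEqv V} (a : Bare A) (b : Bare B) (d : Bare D) :
    ((a.tensor b).tensor d).hom = (α_ A B D).hom ≫ (a.tensor (b.tensor d)).hom := by
  have h1 : ((a.tensor b).tensor d).hom = ((a.hom ⊗ₘ b.hom) ⊗ₘ d.hom) ≫
      (λ_ (𝟙_ (DotSEqv V))).hom ▷ 𝟙_ (DotSEqv V) ≫ (λ_ (𝟙_ (DotSEqv V))).hom := by
    rw [← tensorHom_id, tensorHom_comp_tensorHom_assoc, Category.comp_id]; rfl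
  have h2 : (a.tensor (b.tensor d)).hom = (a.hom ⊗ₘ (b.hom ⊗ₘ d.hom)) ≫
      𝟙_ (DotSEqv V) ◁ (λ_ (𝟙_ (DotSEqv V))).hom ≫ (λ_ (𝟙_ (DotSEqv V))).hom := by
    rw [← id_tensorHom, tensorHom_comp_tensorHom_assoc, Category.comp_id]; rfl
  rw [h1, h2, ← associator_naturality_assoc]
  congr 1
  monoidal

/-- A structural arrow creates and destroys no equations, and it is compatible with the canonical
isomorphisms to `⊤`. -/
theorem Bare.transport {Z A : DotSEqv V} {σ : Z ⟶ A} (hσ : IsSym σ) (a : Bare A) :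
    ∃ b : Bare Z, b.hom = σ ≫ a.hom := by
  induction hσ with
  | id A => exact ⟨a, by simp⟩
  | comp hf hg ihf ihg =>
    obtain ⟨b, hb⟩ := ihg a
    obtain ⟨b', hb'⟩ := ihf b
    exact ⟨b', by rw [hb', hb, Category.assoc]⟩
  | tensor hf hg ihf ihg =>
    obtain ⟨a₁, a₂, rfl⟩ := a.exists_tensor
    obtain ⟨b₁, h₁⟩ := ihf a₁
    obtain ⟨b₂, h₂⟩ := ihg a₂
    refine ⟨b₁.tensor b₂, ?_⟩
    rw [tensor_hom, tensor_hom, h₁, h₂, tensorHom_comp_tensorHom_assoc]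
  | assoc_hom A B D =>
    obtain ⟨a₁, a₂, rfl⟩ := a.exists_tensor
    obtain ⟨a₂, a₃, rfl⟩ := a₂.exists_tensor
    exact ⟨(a₁.tensor a₂).tensor a₃, tensor_tensor_hom _ _ _⟩
  | assoc_inv A B D =>
    obtain ⟨a₁, a₃, rfl⟩ := a.exists_tensor
    obtain ⟨a₁, a₂, rfl⟩ := a₁.exists_tensor
    exact ⟨a₁.tensor (a₂.tensor a₃), by rw [tensor_tensor_hom, Iso.inv_hom_id_assoc]⟩
  | left_hom A =>
    refine ⟨unit.tensor a, ?_⟩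
    rw [tensor_hom, unit_hom]
    simp
  | left_inv A =>
    obtain ⟨a₁, a₂, rfl⟩ := a.exists_tensor
    refine ⟨a₂, ?_⟩
    rw [Bare.eq a₁ unit, tensor_hom, unit_hom]
    simp
  | right_hom A =>
    refine ⟨a.tensor unit, ?_⟩
    rw [tensor_hom, unit_hom]
    simp [unitors_equal]
  | right_inv A =>
    obtain ⟨a₁, a₂, rfl⟩ := a.exists_tensor
    refine ⟨a₁, ?_⟩
    rw [Bare.eq a₂ unit, tensor_hom, unit_hom]
    simp [unitors_equal]
  | braid A B =>
    obtain ⟨a₁, a₂, rfl⟩ := a.exists_tensor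
    refine ⟨a₂.tensor a₁, ?_⟩
    rw [tensor_hom, tensor_hom, ← braiding_naturality_assoc, braiding_tensorUnit_left]
    simp [unitors_equal]

/-- The structural arrow is carried through the removals by `Ins.transport` and is finally absorbed
by `Bare.transport`. Normal forms thus need no structural component, and coherence for symmetric
monoidal categories need not be invoked separately. -/
theorem Normal.precomp {Z A B : DotSEqv V} {f : A ⟶ B} (hf : Normal f) {σ : Z ⟶ A}
    (hσ : IsSym σ) : Normal (σ ≫ f) := by
  induction hf generalizing Z with
  | base a r =>
    obtain ⟨b, hb⟩ := a.transport hσ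
    rw [← Category.assoc, ← hb]
    exact base b r
  | step i o s hf' h ih =>
    obtain ⟨p, q, rfl⟩ := o.exists_eqn
    obtain ⟨Z', i', σ', hσ', h'⟩ := i.transport hσ
    refine step i' o s (ih hσ') ?_
    rw [reassoc_of% h', h, whiskerLeft_comp, Category.assoc]

theorem FStep.precomp_left {E A A' : DotSEqv V} {u v : FreeMagma V} (e : E ⟶ eqn u v)
    (s : FStep u v A A') (B : DotSEqv V) :
    e ▷ (A' ⊗ B) ≫ (s.left B).act = actL (e ▷ A' ≫ s.act) B := by
  rw [actL, comp_whiskerRight, ← associator_inv_naturality_left_assoc]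
  rfl

theorem FStep.precomp_right {E A A' : DotSEqv V} {u v : FreeMagma V} (e : E ⟶ eqn u v)
    (s : FStep u v A A') (B : DotSEqv V) :
    e ▷ (B ⊗ A') ≫ (s.right B).act = actR (e ▷ A' ≫ s.act) B := by
  have h := exch_nat e (𝟙 B) (𝟙 A')
  simp only [id_tensorHom, tensorHom_id, id_whiskerRight] at h
  rw [actR, whiskerLeft_comp, ← reassoc_of% h]
  rfl

/-- The equations in the source of `f` are consumed first, then those in the source of `g`. -/
theorem Normal.tensor {A B A' B' : DotSEqv V} {f : A ⟶ B} (hf : Normal f) {g : A' ⟶ B'}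
    (hg : Normal g) : Normal (f ⊗ₘ g) := by
  induction hf with
  | base a r =>
    induction hg with
    | base b t =>
      have h : (a.hom ≫ r.hom) ⊗ₘ (b.hom ≫ t.hom) = (a.and b).hom ≫ (r.and t).hom := by
        change _ = ((a.hom ⊗ₘ b.hom) ≫ (λ_ (𝟙_ _)).hom) ≫ (λ_ (𝟙_ _)).inv ≫ (r.hom ⊗ₘ t.hom)
        simp
      rw [h]
      exact base (a.and b) (r.and t)
    | @step E A A' B B' u v i o s f f' hf' h ih =>
      refine step (i.right _) o (s.right _) ih ?_
      refine Eq.trans ?_ (congrArg _ (s.precomp_right _ _).symm)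
      exact actR_tensor _ _ _ _ h _
  | @step E A A' B B' u v i o s f f' hf' h ih =>
    refine step (i.left _) o (s.left _) ih ?_
    refine Eq.trans ?_ (congrArg _ (s.precomp_left _ _).symm)
    exact actL_tensor _ _ _ _ h _

theorem Chain.normal {A : DotSEqv V} {x y : FreeMagma V} {f : A ⟶ eqn x y} (hf : Chain f) :
    Normal f := by
  induction hf with
  | nil hσ x =>
    refine Normal.precomp ?_ hσ
    have := Normal.base (V := V) Bare.top (.eqv x)
    exact Category.id_comp (reflHom x) ▸ this
  | @cons A A' E u v x x' y σ hσ o s f hf ih =>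
    refine Normal.precomp ?_ hσ
    -- Consuming `E` turns the source `E ⊗ A'` into `⊤ ⊗ A'`, hence the left unitor in front of the
    -- remaining chain.
    refine Normal.step (Ins.here.left A') o (FStep.eqv s y) (ih.precomp (.left_hom _)) ?_
    have h1 : (Ins.here.left A').hom = E ◁ (λ_ A').hom := by
      change (α_ _ _ _).inv ≫ (ρ_ E).hom ▷ A' = _
      rw [Iso.inv_comp_eq, triangle]
    have h2 := cat_precomp o.hom f s.hom (𝟙 (eqn x' y))
    rw [Category.comp_id, MonoidalCategory.tensorHom_def', Category.assoc] at h2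
    have h3 : E ◁ ((λ_ A').hom ≫ f) ≫ o.hom ▷ eqn x' y ≫ LinearEquality.cat s.hom (𝟙 (eqn x' y)) =
        E ◁ (λ_ A').hom ≫ E ◁ f ≫ o.hom ▷ eqn x' y ≫ LinearEquality.cat s.hom (𝟙 (eqn x' y)) := by
      rw [whiskerLeft_comp, Category.assoc]
    exact (congrArg (· ≫ _) h1).trans ((congrArg _ h2).trans h3.symm)

theorem Decomp.normal {B : DotSEqv V} : ∀ {A : DotSEqv V} {f : A ⟶ B}, Decomp B f → Normal f := by
  induction B with
  | top =>
    intro A f hf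
    have h := (Normal.base (V := V) Bare.unit .top).precomp hf
    have e : f ≫ Bare.unit.hom ≫ Reflexive.top.hom = f :=
      (congrArg _ (Category.comp_id _)).trans (Category.comp_id _)
    exact e ▸ h
  | eqv x y => exact fun hf => Chain.normal hf
  | and B₁ B₂ ih₁ ih₂ =>
    intro A f hf
    obtain ⟨A₁, A₂, σ, g₁, g₂, hσ, h₁, h₂, rfl⟩ := hf
    exact ((ih₁ h₁).tensor (ih₂ h₂)).precomp hσ

theorem normal {A B : DotSEqv V} (f : A ⟶ B) : Normal f := (decomp f).normal

theorem Orient.count_eq {E : DotSEqv V} {u v : FreeMagma V} (o : Orient E u v) (z : V) :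
    lcount z E + rcount z E = tcount z u + tcount z v := by
  cases o
  · rfl
  · exact Nat.add_comm _ _

theorem Bare.count_eq {A : DotSEqv V} (a : Bare A) (z : V) : lcount z A = 0 ∧ rcount z A = 0 := by
  induction a with
  | top => exact ⟨rfl, rfl⟩
  | and a b ha hb => simp only [lcount, rcount]; omega

theorem Reflexive.count_eq {A : DotSEqv V} (r : Reflexive A) (z : V) :
    lcount z A = rcount z A := by
  induction r with
  | top => rfl
  | eqv => rfl
  | and a b ha hb => simp only [lcount, rcount]; omega

/-- At the end of a normal form left and right counts of the target agree, and each step alters the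
left count by at most what the consumed equation contains. So occurrences in left sides must be
covered by the source and the right sides. -/
theorem Normal.lcount_le {A B : DotSEqv V} {f : A ⟶ B} (hf : Normal f) (z : V) :
    lcount z B ≤ lcount z A + rcount z A + rcount z B := by
  induction hf with
  | base a r =>
    have := r.count_eq z
    omega
  | step i o s hf' h ih =>
    have h1 := i.count_eq z
    have h2 := o.count_eq z
    have h3 := s.count_eq z
    omega

theorem Bare.not_ins {E A A' : DotSEqv V} {u v : FreeMagma V} (a : Bare A) (i : Ins E A' A)
    (o : Orient E u v) : False := by
  obtain ⟨z, hz⟩ := exists_tcount_pos u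
  have h1 := i.count_eq z
  have h2 := o.count_eq z
  have h3 := a.count_eq z
  omega

theorem Orient.eq_or {E : DotSEqv V} {u v w w' : FreeMagma V} (o : Orient E u v)
    (o' : Orient E w w') : (u = w ∧ v = w' ∧ HEq o o') ∨ (u = w' ∧ v = w) := by
  cases o <;> cases o' <;> simp

/-- The exchange argument, by induction on the normal form of `g`: the prescribed removal is
compared with the first removal made by `g`, and is either equal to it or commutes with it. -/
theorem Normal.peel {A B : DotSEqv V} {g : A ⟶ B} (hg : Normal g) :
    ∀ {E A' B' : DotSEqv V} {u v : FreeMagma V} (i : Ins E A' A) (o : Orient E u v)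
      (s : FStep u v B B')
      (_ : ∀ z, lcount z A + rcount z A + (lcount z B + rcount z B) ≤ 2),
      ∃ g' : A' ⟶ B', i.hom ≫ g = E ◁ g' ≫ o.hom ▷ B' ≫ s.act := by
  induction hg with
  | base a r => exact fun i o => (a.not_ins i o).elim
  | @step F A A₂ B B₂ w w' j o₂ t g g₂ hg₂ h ih =>
    intro E A₁ B₁ u v i o s hc
    obtain ⟨p, q, rfl⟩ := o.exists_eqn
    obtain ⟨p', q', rfl⟩ := o₂.exists_eqn
    rcases i.diamond j with ⟨hE, rfl, hij⟩ | ⟨A₃, i', j', hij⟩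
    · cases hE
      cases hij
      rcases o.eq_or o₂ with ⟨rfl, rfl, ho⟩ | ⟨rfl, rfl⟩
      · cases ho
        -- Each variable of `u` already occurs in the consumed equation, so it occurs at most once
        -- in the target and the place of rewriting is determined.
        obtain ⟨rfl, ht⟩ := s.unique t fun z hz => by
          have h1 := i.count_eq z
          have h2 := o.count_eq z
          have h3 := hc z
          omega
        cases ht
        exact ⟨g₂, h⟩
      -- The equation is used in opposite directions. A variable `z` of `u` occurs once in the
      -- equation and once in the left sides of `B`, and nowhere else, so `v` does not contain it.
      -- After `t` replaces `v` by `u`, `z` occurs twice in left sides and no longer in the source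
      -- or in right sides, against `Normal.lcount_le`.
      · exfalso
        obtain ⟨z, hz⟩ := exists_tcount_pos u
        have h1 := i.count_eq z
        have h2 := o.count_eq z
        have h3 := hc z
        have h4 := s.count_eq z
        have h5 := t.count_eq z
        have h6 := hg₂.lcount_le z
        omega
    -- A variable common to `u` and `w` would occur in both source equations and again in the
    -- target, hence three times.
    · obtain ⟨B₃, s', t', hst⟩ := s.diamond t fun z hz => by
        have h1 := i'.count_eq z
        have h2 := o.count_eq z
        have h3 := hc z
        have h4 := s.count_eq z
        have h5 := j.count_eq z
        have h6 := o₂.count_eq z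
        omega
      obtain ⟨g₃, h₃⟩ := ih i' o s' fun z => by
        have h3 := hc z
        have h4 := t.count_eq z
        have h5 := j.count_eq z
        have h6 := o₂.count_eq z
        omega
      exact ⟨_, hij.peel (hst.precomp o.hom o₂.hom) h h₃⟩

/-- Induction on the normal form of `f`. At the end the source has no equations, so `g` too is a
base arrow, and the witnesses for `Bare` and `Reflexive` are unique. Otherwise `g` is rearranged to
begin with the same step as `f`. -/
theorem Normal.eq {A B : DotSEqv V} {f : A ⟶ B} (hf : Normal f) :
    ∀ (g : A ⟶ B) (_ : ∀ z, lcount z A + rcount z A + (lcount z B + rcount z B) ≤ 2), f = g := by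
  induction hf with
  | base a r =>
    intro g _
    cases normal g with
    | base a' r' => rw [a.eq a', r.eq r']
    | step i o s => exact (a.not_ins i o).elim
  | step i o s hf' h ih =>
    intro g hc
    obtain ⟨g', hg'⟩ := (normal g).peel i o s hc
    -- Insertion is invertible, so it suffices to compare the remainders. Linearity survives: the
    -- source loses both sides of the equation while the target only trades `u` for `v`.
    rw [← cancel_epi i.hom, h, hg', ih g' fun z => by
      have h3 := hc z
      have h4 := s.count_eq z
      have h5 := i.count_eq z
      have h6 := o.count_eq z
      omega]

/-- Between formulae in which every variable occurs at most twice there is at most one arrow. -/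
theorem hom_subsingleton {A B : DotSEqv V}
    (h : ∀ z, lcount z A + rcount z A + (lcount z B + rcount z B) ≤ 2) (f g : A ⟶ B) : f = g :=
  (normal f).eq g h

end NormalForms

end LinearEquality

namespace LinearEquality

universe u w

/-! ### Lifting arrow terms to linear formulae. -/

section Relabelling

variable {V : Type u} {W : Type}

/-- Relabelling of the occurrences of variables in a term; the old variables are kept as second
components. -/
def relabelTerm : ∀ (p : FreeMagma V), (TermOcc p → W) → FreeMagma (W × V)
  | .of v, l => .of (l (), v)
  | .mul p q, l => .mul (relabelTerm p (l ∘ Sum.inl)) (relabelTerm q (l ∘ Sum.inr))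

/-- Relabelling of the occurrences of variables in a formula. -/
def relabel : ∀ (A : Formula V), (Occ A → W) → Formula (W × V)
  | .top, _ => .top
  | .eqv p q, l => .eqv (relabelTerm p (l ∘ Sum.inl)) (relabelTerm q (l ∘ Sum.inr))
  | .and A B, l => .and (relabel A (l ∘ Sum.inl)) (relabel B (l ∘ Sum.inr))

variable {U : Type w} (h : U → V)

/-- Substitution of variables for variables in a term. -/
def mapTerm : FreeMagma U → FreeMagma V
  | .of v => .of (h v)
  | .mul p q => .mul (mapTerm p) (mapTerm q)

/-- Substitution of variables for variables in a formula. -/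
def Formula.map : Formula U → Formula V
  | .top => .top
  | .eqv p q => .eqv (mapTerm h p) (mapTerm h q)
  | .and A B => .and A.map B.map

/-- Substitution of variables for variables in an arrow term. -/
def ArrowTerm.map : ∀ {A B : Formula U}, ArrowTerm A B → ArrowTerm (A.map h) (B.map h)
  | _, _, .id A => .id _
  | _, _, .bRight A B C => .bRight _ _ _
  | _, _, .bLeft A B C => .bLeft _ _ _
  | _, _, .deltaRight A => .deltaRight _
  | _, _, .deltaLeft A => .deltaLeft _
  | _, _, .sigmaRight A => .sigmaRight _
  | _, _, .sigmaLeft A => .sigmaLeft _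
  | _, _, .c A B => .c _ _
  | _, _, .r x => .r _
  | _, _, .t x y z => .t _ _ _
  | _, _, .s x y => .s _ _
  | _, _, .a x y z w => .a _ _ _ _
  | _, _, .tensor f g => .tensor f.map g.map
  | _, _, .comp g f => .comp g.map f.map

theorem ArrowTerm.Eqn.map {A B : Formula U} {f g : ArrowTerm A B} (e : ArrowTerm.Eqn f g) :
    ArrowTerm.Eqn (f.map h) (g.map h) := by
  induction e with
  | refl f => exact .refl _
  | symm _ ih => exact .symm ih
  | trans _ _ ih1 ih2 => exact .trans ih1 ih2
  | tensor_congr _ _ ih1 ih2 => exact .tensor_congr ih1 ih2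
  | comp_congr _ _ ih1 ih2 => exact .comp_congr ih1 ih2
  | id_comp => exact .id_comp _
  | comp_id => exact .comp_id _
  | assoc => exact .assoc _ _ _
  | tensor_id => exact .tensor_id _ _
  | tensor_comp => exact .tensor_comp _ _ _ _
  | b_nat => exact .b_nat _ _ _
  | delta_nat => exact .delta_nat _
  | sigma_nat => exact .sigma_nat _
  | c_nat => exact .c_nat _ _
  | bb_left => exact .bb_left _ _ _
  | bb_right => exact .bb_right _ _ _
  | b5 => exact .b5 _ _ _ _
  | dd_left => exact .dd_left _
  | dd_right => exact .dd_right _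
  | ss_left => exact .ss_left _
  | ss_right => exact .ss_right _
  | bds => exact .bds _ _
  | cc => exact .cc _ _
  | bc => exact .bc _ _ _
  | rt_delta => exact .rt_delta _ _
  | rt_sigma => exact .rt_sigma _ _
  | tb => exact .tb _ _ _ _
  | ss => exact .ss _ _
  | rs => exact .rs _
  | ts => exact .ts _ _ _
  | ra => exact .ra _ _
  | ta => exact .ta _ _ _ _ _ _
  | sa => exact .sa _ _ _ _

theorem mapTerm_relabelTerm (p : FreeMagma V) (l : TermOcc p → W) :
    mapTerm Prod.snd (relabelTerm p l) = p := by
  induction p with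
  | ih1 v => rfl
  | ih2 p q hp hq => exact congrArg₂ FreeMagma.mul (hp _) (hq _)

theorem map_relabel (A : Formula V) (l : Occ A → W) : (relabel A l).map Prod.snd = A := by
  induction A with
  | top => rfl
  | eqv p q => exact congrArg₂ Formula.eqv (mapTerm_relabelTerm _ _) (mapTerm_relabelTerm _ _)
  | and A B hA hB => exact congrArg₂ Formula.and (hA _) (hB _)

/-- A point of the middle row that is connected to an outer row inherits the label found there; by
hypothesis this does not depend on the end chosen. -/
theorem exists_middle_label [Inhabited W] {α β γ : Type} [Finite α] [Finite β] [Finite γ]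
    (R : Brauerian α β) (S : Brauerian β γ) (l : α → W) (n : γ → W)
    (H : ∀ x y, (R.comp S).rel x y → Sum.elim l n x = Sum.elim l n y) :
    ∃ m : β → W, (∀ x y, R.rel x y → Sum.elim l m x = Sum.elim l m y) ∧
      ∀ x y, S.rel x y → Sum.elim m n x = Sum.elim m n y := by
  classical
  let P : α ⊕ (β ⊕ γ) → Prop := fun w => ∃ x, Brauerian.glue R S (Sum.map id .inr x) w
  -- Points on closed circles reach no outer row and receive one arbitrary label, which is constant
  -- on each circle.
  let L : α ⊕ (β ⊕ γ) → W := fun w => if h : P w then Sum.elim l n h.choose else default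
  have hL : ∀ x w, Brauerian.glue R S (Sum.map id .inr x) w → L w = Sum.elim l n x := by
    intro x w hx
    have hP : P w := ⟨x, hx⟩
    have : L w = Sum.elim l n hP.choose := dif_pos hP
    rw [this]
    have hg : Brauerian.glue R S (Sum.map id .inr hP.choose) (Sum.map id .inr x) :=
      Setoid.trans' _ hP.choose_spec (Setoid.symm' _ hx)
    exact H _ _ hg
  have hL' : ∀ w w', Brauerian.glue R S w w' → L w = L w' := by
    intro w w' hw
    by_cases hP : P w
    · obtain ⟨x, hx⟩ := hP
      rw [hL x w hx, hL x w' (Setoid.trans' _ hx hw)]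
    · have hP' : ¬ P w' := fun ⟨x, hx⟩ => hP ⟨x, Setoid.trans' _ hx (Setoid.symm' _ hw)⟩
      have e1 : L w = default := dif_neg hP
      have e2 : L w' = default := dif_neg hP'
      rw [e1, e2]
  have hα : ∀ a, L (.inl a) = l a := fun a => hL (.inl a) _ (Setoid.refl' _ _)
  have hγ : ∀ c, L (.inr (.inr c)) = n c := fun c => hL (.inr c) _ (Setoid.refl' _ _)
  refine ⟨fun b => L (.inr (.inl b)), fun x y hxy => ?_, fun x y hxy => ?_⟩
  · have := hL' _ _ (Brauerian.glue_upper S hxy)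
    rcases x with x | x <;> rcases y with y | y <;> simpa [hα] using this
  · have := hL' _ _ (Brauerian.glue_lower R hxy)
    rcases x with x | x <;> rcases y with y | y <;> simpa [hγ] using this

theorem exists_lift_r (x : FreeMagma V) {a b : TermOcc x → W} (e : a = b) :
    ∃ f : ArrowTerm .top (.eqv (relabelTerm x a) (relabelTerm x b)),
      HEq (f.map Prod.snd) (ArrowTerm.r x) := by
  subst e
  refine ⟨.r _, ?_⟩
  simp only [ArrowTerm.map]
  congr 1; exact mapTerm_relabelTerm _ _

theorem exists_lift_t (x y z : FreeMagma V) {a a' : TermOcc x → W} {b b' : TermOcc y → W}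
    {c c' : TermOcc z → W} (ea : a = a') (eb : b = b') (ec : c = c') :
    ∃ f : ArrowTerm
        (.and (.eqv (relabelTerm x a) (relabelTerm y b)) (.eqv (relabelTerm y b') (relabelTerm z c)))
        (.eqv (relabelTerm x a') (relabelTerm z c')),
      HEq (f.map Prod.snd) (ArrowTerm.t x y z) := by
  subst ea eb ec
  refine ⟨.t _ _ _, ?_⟩
  simp only [ArrowTerm.map]
  congr 1 <;> exact mapTerm_relabelTerm _ _

/-- Labels that are constant on the lines of the diagram turn each primitive arrow term into a
primitive arrow term of the same kind. Only composition needs a choice, namely labels for the middle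
formula. Equality is heterogeneous because the types match only through `map_relabel`. -/
theorem exists_lift [Inhabited W] {A B : Formula V} (f : ArrowTerm A B) :
    ∀ (l : Occ A → W) (m : Occ B → W)
      (_ : ∀ x y, (diagram f).rel x y → Sum.elim l m x = Sum.elim l m y),
      ∃ f' : ArrowTerm (relabel A l) (relabel B m), HEq (f'.map Prod.snd) f := by
  have hE : ∀ {α β : Type} (e : α ≃ β) (l : α → W) (m : β → W),
      (∀ x y, (Brauerian.ofEquiv e).rel x y → Sum.elim l m x = Sum.elim l m y) → l = m ∘ e :=
    fun e l m H => funext fun a => H _ _ (Brauerian.ofEquiv_rel e a)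
  induction f with
  | id A =>
    intro l m H
    obtain rfl : l = m := hE _ _ _ H
    refine ⟨.id _, ?_⟩
    simp only [ArrowTerm.map]
    congr 1; exact map_relabel _ _
  | bRight A B C =>
    intro l m H
    obtain rfl := hE _ _ _ H
    refine ⟨.bRight _ _ _, ?_⟩
    simp only [ArrowTerm.map]
    congr 1 <;> exact map_relabel _ _
  | bLeft A B C =>
    intro l m H
    obtain rfl := hE _ _ _ H
    refine ⟨.bLeft _ _ _, ?_⟩
    simp only [ArrowTerm.map]
    congr 1 <;> exact map_relabel _ _
  | deltaRight A =>
    intro l m H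
    obtain rfl := hE _ _ _ H
    refine ⟨.deltaRight _, ?_⟩
    simp only [ArrowTerm.map]
    congr 1; exact map_relabel _ _
  | deltaLeft A =>
    intro l m H
    obtain rfl := hE _ _ _ H
    refine ⟨.deltaLeft _, ?_⟩
    simp only [ArrowTerm.map]
    congr 1; exact map_relabel _ _
  | sigmaRight A =>
    intro l m H
    obtain rfl := hE _ _ _ H
    refine ⟨.sigmaRight _, ?_⟩
    simp only [ArrowTerm.map]
    congr 1; exact map_relabel _ _
  | sigmaLeft A =>
    intro l m H
    obtain rfl := hE _ _ _ H
    refine ⟨.sigmaLeft _, ?_⟩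
    simp only [ArrowTerm.map]
    congr 1; exact map_relabel _ _
  | c A B =>
    intro l m H
    obtain rfl := hE _ _ _ H
    refine ⟨.c _ _, ?_⟩
    simp only [ArrowTerm.map]
    congr 1 <;> exact map_relabel _ _
  | r x =>
    intro l m H
    have e : m ∘ Sum.inl = m ∘ Sum.inr := funext fun i => H _ _ (Brauerian.caps_rel i)
    exact exists_lift_r x e
  | t x y z =>
    intro l m H
    have e₁ : (l ∘ Sum.inl) ∘ Sum.inl = m ∘ Sum.inl :=
      funext fun i => H (.inl (.inl (.inl i))) (.inr (.inl i)) (.inr rfl)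
    have e₂ : (l ∘ Sum.inl) ∘ Sum.inr = (l ∘ Sum.inr) ∘ Sum.inl :=
      funext fun i => H (.inl (.inl (.inr i))) (.inl (.inr (.inl i))) (.inr rfl)
    have e₃ : (l ∘ Sum.inr) ∘ Sum.inr = m ∘ Sum.inr :=
      funext fun i => H (.inl (.inr (.inr i))) (.inr (.inr i)) (.inr rfl)
    exact exists_lift_t x y z e₁ e₂ e₃
  | s x y =>
    intro l m H
    obtain rfl := hE _ _ _ H
    refine ⟨.s _ _, ?_⟩
    simp only [ArrowTerm.map]
    congr 1 <;> exact mapTerm_relabelTerm _ _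
  | a x y z w =>
    intro l m H
    obtain rfl := hE _ _ _ H
    refine ⟨.a _ _ _ _, ?_⟩
    simp only [ArrowTerm.map]
    congr 1 <;> exact mapTerm_relabelTerm _ _
  | tensor f g ihf ihg =>
    intro l m H
    obtain ⟨f', hf'⟩ := ihf (l ∘ Sum.inl) (m ∘ Sum.inl) fun x y hxy => by
      have := H _ _ (Brauerian.tensor_inl (S := diagram g) hxy)
      rcases x with x | x <;> rcases y with y | y <;> exact this
    obtain ⟨g', hg'⟩ := ihg (l ∘ Sum.inr) (m ∘ Sum.inr) fun x y hxy => by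
      have := H _ _ (Brauerian.tensor_inr (R := diagram f) hxy)
      rcases x with x | x <;> rcases y with y | y <;> exact this
    refine ⟨f'.tensor g', ?_⟩
    simp only [ArrowTerm.map]
    congr 1 <;> exact map_relabel _ _
  | @comp A B C g f ihg ihf =>
    intro l n H
    obtain ⟨m, hm, hm'⟩ := exists_middle_label (diagram f) (diagram g) l n H
    obtain ⟨f', hf'⟩ := ihf l m hm
    obtain ⟨g', hg'⟩ := ihg m n hm'
    refine ⟨g'.comp f', ?_⟩
    simp only [ArrowTerm.map]
    congr 1 <;> exact map_relabel _ _

/-- Realises the count of a relabelled variable by an actual set of occurrences with the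
corresponding label, to which the classes of a diagram can be compared. -/
theorem exists_finset_term (z : W × V) (p : FreeMagma V) (l : TermOcc p → W) :
    ∃ s : Finset (TermOcc p), s.card = tcount z (relabelTerm p l) ∧ ∀ i ∈ s, l i = z.1 := by
  classical
  induction p with
  | ih1 v =>
    by_cases hz : z = (l (), v)
    · refine ⟨({()} : Finset Unit), ?_, fun i _ => by rw [hz]; rfl⟩
      exact (Finset.card_singleton ()).trans (by simp [relabelTerm, tcount, hz])
    · exact ⟨∅, by simp [relabelTerm, tcount, hz], by simp⟩
  | ih2 p q hp hq =>
    obtain ⟨s, hs, hs'⟩ := hp (l ∘ Sum.inl)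
    obtain ⟨t, ht, ht'⟩ := hq (l ∘ Sum.inr)
    refine ⟨s.disjSum t, ?_, ?_⟩
    · exact (Finset.card_disjSum s t).trans (congrArg₂ (· + ·) hs ht)
    · rintro (i | i) hi
      · exact hs' i (Finset.inl_mem_disjSum.1 hi)
      · exact ht' i (Finset.inr_mem_disjSum.1 hi)

theorem exists_finset (z : W × V) (A : Formula V) (l : Occ A → W) :
    ∃ s : Finset (Occ A), s.card = lcount z (relabel A l) + rcount z (relabel A l) ∧
      ∀ i ∈ s, l i = z.1 := by
  induction A with
  | top => exact ⟨∅, rfl, by simp⟩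
  | eqv p q =>
    obtain ⟨s, hs, hs'⟩ := exists_finset_term z p (l ∘ Sum.inl)
    obtain ⟨t, ht, ht'⟩ := exists_finset_term z q (l ∘ Sum.inr)
    refine ⟨s.disjSum t, ?_, ?_⟩
    · exact (Finset.card_disjSum s t).trans (congrArg₂ (· + ·) hs ht)
    · rintro (i | i) hi
      · exact hs' i (Finset.inl_mem_disjSum.1 hi)
      · exact ht' i (Finset.inr_mem_disjSum.1 hi)
  | and A B hA hB =>
    obtain ⟨s, hs, hs'⟩ := hA (l ∘ Sum.inl)
    obtain ⟨t, ht, ht'⟩ := hB (l ∘ Sum.inr)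
    refine ⟨s.disjSum t, ?_, ?_⟩
    · refine (Finset.card_disjSum s t).trans ?_
      rw [hs, ht]
      simp only [relabel, lcount, rcount]
      omega
    · rintro (i | i) hi
      · exact hs' i (Finset.inl_mem_disjSum.1 hi)
      · exact ht' i (Finset.inr_mem_disjSum.1 hi)

/-- Three different occurrences of one new variable would share a label and hence lie in one class,
but each point has a single partner. -/
theorem count_relabel_le {A B : Formula V} (R : Brauerian (Occ A) (Occ B)) (l : Occ A → W)
    (m : Occ B → W) (H : ∀ x y, Sum.elim l m x = Sum.elim l m y → R.rel x y) (z : W × V) :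
    lcount z (relabel A l) + rcount z (relabel A l) +
      (lcount z (relabel B m) + rcount z (relabel B m)) ≤ 2 := by
  obtain ⟨s, hs, hs'⟩ := exists_finset z A l
  obtain ⟨t, ht, ht'⟩ := exists_finset z B m
  rw [← hs, ← ht, ← Finset.card_disjSum]
  by_contra hlt
  obtain ⟨x, hx, y, hy, w, hw, hxy, hxw, hyw⟩ := Finset.two_lt_card.1 (not_le.1 hlt)
  have hz : ∀ x ∈ s.disjSum t, Sum.elim l m x = z.1 := by
    rintro (i | i) hi
    · exact hs' i (Finset.inl_mem_disjSum.1 hi)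
    · exact ht' i (Finset.inr_mem_disjSum.1 hi)
  exact hyw (R.eq_of_rel (H x y ((hz x hx).trans (hz y hy).symm))
    (H x w ((hz x hx).trans (hz w hw).symm)) hxy.symm hxw.symm)

theorem ArrowTerm.Eqn.of_heq {A' B' A B : Formula V} {f' g' : ArrowTerm A' B'}
    {f g : ArrowTerm A B} (hA : A' = A) (hB : B' = B) (hf : HEq f' f) (hg : HEq g' g)
    (e : ArrowTerm.Eqn f' g') : ArrowTerm.Eqn f g := by
  subst hA hB
  cases hf
  cases hg
  exact e

theorem eqn_of_diagram_eq {A B : Formula V} {f g : ArrowTerm A B} (e : diagram f = diagram g) :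
    ArrowTerm.Eqn f g := by
  -- The label of an occurrence is its class, so labels agree exactly on joined occurrences: one
  -- direction gives the lifts, the other gives linearity.
  let L : Occ A ⊕ Occ B → Set (Occ A ⊕ Occ B) := fun x => {y | (diagram f).rel x y}
  have hL : ∀ x y, L x = L y ↔ (diagram f).rel x y := by
    intro x y
    constructor
    · intro h
      have : y ∈ L x := by rw [h]; exact Setoid.refl' _ y
      exact this
    · intro h
      ext w
      exact ⟨fun h' => Setoid.trans' _ (Setoid.symm' _ h) h', fun h' => Setoid.trans' _ h h'⟩
  have hel : ∀ x, Sum.elim (L ∘ Sum.inl) (L ∘ Sum.inr) x = L x := by rintro (x | x) <;> rfl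
  obtain ⟨f', hf'⟩ := exists_lift f (L ∘ Sum.inl) (L ∘ Sum.inr) fun x y h => by
    rw [hel, hel, hL]; exact h
  -- Equality of the diagrams is used here: the labels taken from `f` are also admissible for `g`,
  -- so both lifts have the same source and target.
  obtain ⟨g', hg'⟩ := exists_lift g (L ∘ Sum.inl) (L ∘ Sum.inr) fun x y h => by
    rw [hel, hel, hL, e]; exact h
  have hc := count_relabel_le (diagram f) (L ∘ Sum.inl) (L ∘ Sum.inr) fun x y h => by
    rwa [hel, hel, hL] at h
  have hfg : ArrowTerm.Eqn f' g' := Quotient.exact (hom_subsingleton hc f'.toHom g'.toHom)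
  exact (hfg.map Prod.snd).of_heq (map_relabel _ _) (map_relabel _ _) hf' hg'

theorem Brauerian.reindex_injective {α β α' β' : Type} (e : α ≃ α') (e' : β ≃ β') :
    Function.Injective (Brauerian.reindex e e') := by
  intro R S h
  apply Brauerian.eq_of_le
  intro x y hxy
  have h' : (R.reindex e e').rel (Equiv.sumCongr e e' x) (Equiv.sumCongr e e' y) := by
    change R.rel ((Equiv.sumCongr e e').symm _) ((Equiv.sumCongr e e').symm _)
    rwa [Equiv.symm_apply_apply, Equiv.symm_apply_apply]
  rw [h] at h'
  change S.rel ((Equiv.sumCongr e e').symm _) ((Equiv.sumCongr e e').symm _) at h'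
  rwa [Equiv.symm_apply_apply, Equiv.symm_apply_apply] at h'

end Relabelling

end LinearEquality

theorem mainTheorem7 (V : Type*) : (LinearEquality.G V).Faithful := by
  refine ⟨fun {A B} f g h => ?_⟩
  induction f using Quotient.inductionOn with
  | _ f =>
    induction g using Quotient.inductionOn with
    | _ g =>
      exact Quotient.sound
        (LinearEquality.eqn_of_diagram_eq (LinearEquality.Brauerian.reindex_injective _ _ h))
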